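/- Let $d,m\ge 0$ be integers, let $\mathbf T^d=(\mathbf R/\mathbf Z)^d$ carry its Lebesgue probability measure, and let $\|\cdot\|$, $((\cdot,\cdot))$ denote the $L^2(\mathbf T^d)$ norm and inner product. Let $\mathrm{Sol}(\mathbf T^d)$ be the space of all square-integrable, weakly divergence-free vector fields $v:\mathbf T^d\to\mathbf R^d$ of zero mean. For $v\in L^2(\mathbf T^d,\mathbf R^d)$ put $K[v]=\frac12\int_{\mathbf T^d}|\nabla^m v|^2\,dx$ if $v$ has square-integrable weak derivatives of order $m$, and $K[v]=+\infty$ otherwise. Let $\varphi_0\in L^2(\mathbf T^d,\mathbf R)$ have finite Dirichlet integral, i.e. its distributional gradient is in $L^2$. Then there are $$B\in C^0_w(\mathbf R_+,L^2(\mathbf T^d,\mathbf R^d)),\qquad v\in L^2(\mathbf R_+,\mathrm{Sol}(\mathbf T^d))$$ ($C^0_w$ meaning continuity in time for the weak topology of $L^2$) and $\varphi:\mathbf R_+\to L^2(\mathbf T^d,\mathbf R)$ such that $(B=\nabla\varphi,v)$ is a global dissipative solution with initial datum $\varphi_0$ of $$\partial_t\varphi+\nabla\cdot(\varphi v)=0,\qquad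 (-\Delta)^m v=-\mathbb P\,\nabla\cdot(\nabla\varphi\otimes\nabla\varphi),$$ where $\mathbb P$ is the $L^2$ projection onto $\mathrm{Sol}(\mathbf T^d)$. This means: 1. $\varphi_{t=0}=\varphi_0$ and, for every $t\ge 0$, $\int_{\mathbf T^d}\varphi_t\,dx=\int_{\mathbf T^d}\varphi_0\,dx$ and $B_t=\nabla\varphi_t$ in the sense of distributions. 2. The transport equation $\partial_t\varphi+\nabla\cdot(\varphi v)=0$ with initial value $\varphi_0$ holds in the sense of distributions: for every smooth $\psi:\mathbf R\times\mathbf T^d\to\mathbf R$ vanishing for all large $t$, $$\int_0^\infty\!\!\int_{\mathbf T^d}\varphi\,(\partial_t\psi+v\cdot\nabla\psi)\,dx\,dt+\int_{\mathbf T^d}\varphi_0\,\psi(0,\cdot)\,dx=0 .$$ 3. For every $T>0$, every smooth field $z$ on $[0,T]\times\mathbf T^d$ with $z_t\in\mathrm{Sol}(\mathbf T^d)$ for all $t\in[0,T]$, every constant $r\ge 0$ such that the symmetric matrix $rI_d+\nabla z_t(x)+\nabla z_t(x)^{T}$ is positive semidefinite for all $(t,x)\in[0,T]\times\mathbf T^d$,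 and every $t\in[0,T]$, $$\int_0^t\Big\{2K[v_s]+((B_s\otimes B_s,\;rI_d+\nabla z_s+\nabla z_s^{T}))-2K[z_s]\Big\}e^{-sr}\,ds+\|B_t\|^2e^{-tr}\le\|B_0\|^2 .$$ -/

import Mathlib

open MeasureTheory Set
open scoped ENNReal ContDiff RealInnerProductSpace

noncomputable section

namespace GradFlow

/-- The flat torus `(ℝ/ℤ)^d`. -/
abbrev Torus (d : ℕ) := UnitAddTorus (Fin d)

/-- Lebesgue (Haar probability) measure on the torus: the product of the normalised Haar measures
of the circles. -/
abbrev leb (d : ℕ) : Measure (Torus d) := Measure.pi fun _ => AddCircle.haarAddCircle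

/-- `ℝ^d` with the Euclidean norm. -/
abbrev Vec (d : ℕ) := EuclideanSpace ℝ (Fin d)

/-- `L²(T^d, ℝ)`. -/
abbrev L2 (d : ℕ) := Lp ℝ 2 (leb d)

/-- `L²(T^d, ℝ^d)`. -/
abbrev L2Vec (d : ℕ) := Lp (Vec d) 2 (leb d)

/-- The covering map `ℝ^d → T^d`. -/
def proj {d : ℕ} (x : Fin d → ℝ) : Torus d := fun i => (x i : UnitAddCircle)

/-- Smooth functions on the torus: those whose periodic lift to `ℝ^d` is smooth. -/
def Smooth {d : ℕ} {F : Type*} [NormedAddCommGroup F] [NormedSpace ℝ F]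
    (f : Torus d → F) : Prop :=
  ContDiff ℝ ∞ (fun x : Fin d → ℝ => f (proj x))

/-- Smoothness of a time-dependent function on `I × T^d`. -/
def SmoothOn {d : ℕ} {F : Type*} [NormedAddCommGroup F] [NormedSpace ℝ F]
    (I : Set ℝ) (f : ℝ → Torus d → F) : Prop :=
  ContDiffOn ℝ ∞ (fun p : ℝ × (Fin d → ℝ) => f p.1 (proj p.2)) (I ×ˢ univ)

/-- The partial derivative `∂_i f` on the torus. -/
def pderiv {d : ℕ} {F : Type*} [NormedAddCommGroup F] [NormedSpace ℝ F]
    (i : Fin d) (f : Torus d → F) (x : Torus d) : F :=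
  deriv (fun h : ℝ => f (x + Pi.single i (h : UnitAddCircle))) 0

/-- The iterated partial derivative `∂_{α 0} ⋯ ∂_{α (m-1)} f`. -/
def iterPDeriv {d m : ℕ} {F : Type*} [NormedAddCommGroup F] [NormedSpace ℝ F]
    (α : Fin m → Fin d) (f : Torus d → F) : Torus d → F :=
  (List.ofFn α).foldr pderiv f

/-- The classical gradient of a function on the torus. -/
def grad {d : ℕ} (ψ : Torus d → ℝ) (x : Torus d) : Vec d :=
  WithLp.toLp 2 (fun i => pderiv i ψ x)

/-- The Jacobian matrix `(∇z)_{ij} = ∂_j z_i`. -/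
def jacobian {d : ℕ} (z : Torus d → Vec d) (x : Torus d) : Matrix (Fin d) (Fin d) ℝ :=
  Matrix.of fun i j => pderiv j (fun y => z y i) x

/-- The symmetric matrix `r I_d + ∇z + ∇zᵀ` at the point `x`. -/
def shiftedSymGrad {d : ℕ} (r : ℝ) (z : Torus d → Vec d) (x : Torus d) :
    Matrix (Fin d) (Fin d) ℝ :=
  r • (1 : Matrix (Fin d) (Fin d) ℝ) + jacobian z x + (jacobian z x).transpose

/-- `B = ∇φ` in the sense of distributions on the torus. -/
def HasWeakGrad {d : ℕ} (φ : L2 d) (B : L2Vec d) : Prop :=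
  ∀ ψ : Torus d → ℝ, Smooth ψ → ∀ i : Fin d,
    ∫ x, φ x * pderiv i ψ x ∂(leb d) = - ∫ x, B x i * ψ x ∂(leb d)

/-- The Dirichlet integral `½ ∫ |∇φ|²`, equal to `∞` when `φ` has no square-integrable weak
gradient. (The weak gradient is unique, so the infimum has at most one term.) -/
def dirichlet {d : ℕ} (φ : L2 d) : ℝ≥0∞ :=
  ⨅ (B : L2Vec d) (_ : HasWeakGrad φ B), 2⁻¹ * ∫⁻ x, ‖B x‖ₑ ^ 2 ∂(leb d)

/-- The family `w` consists of all weak partial derivatives of order `m` of `v ∈ L²`. -/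
def HasWeakDerivs {d : ℕ} (m : ℕ) (v : Torus d → Vec d)
    (w : (Fin m → Fin d) → L2Vec d) : Prop :=
  ∀ α : Fin m → Fin d, ∀ ψ : Torus d → ℝ, Smooth ψ →
    ∫ x, iterPDeriv α ψ x • v x ∂(leb d) = (-1 : ℝ) ^ m • ∫ x, ψ x • w α x ∂(leb d)

/-- `K[v] = ½ ∫ |∇^m v|²` for `v ∈ L²`, equal to `∞` when `v` has no square-integrable weak
derivatives of order `m`. (These are unique, so the infimum has at most one term.) -/
def K {d : ℕ} (m : ℕ) (v : Torus d → Vec d) : ℝ≥0∞ :=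
  ⨅ (w : (Fin m → Fin d) → L2Vec d) (_ : HasWeakDerivs m v w),
    2⁻¹ * ∑ α : Fin m → Fin d, ∫⁻ x, ‖w α x‖ₑ ^ 2 ∂(leb d)

/-- Membership in `Sol(T^d)`: square-integrable, (weakly) divergence-free, zero mean. -/
def IsSol {d : ℕ} (v : Torus d → Vec d) : Prop :=
  MemLp v 2 (leb d) ∧
  (∀ ψ : Torus d → ℝ, Smooth ψ → ∫ x, ⟪v x, grad ψ x⟫ ∂(leb d) = 0) ∧
  ∫ x, v x ∂(leb d) = 0

/-- `((B ⊗ B, r I_d + ∇z + ∇zᵀ))`. -/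
def tensorPairing {d : ℕ} (B : L2Vec d) (r : ℝ) (z : Torus d → Vec d) : ℝ :=
  ∫ x, ∑ i, ∑ j, B x i * B x j * shiftedSymGrad r z x i j ∂(leb d)

/-- `B ∈ C_w^0(ℝ_+, L²(T^d, ℝ^d))`. -/
def MemCw {d : ℕ} (B : ℝ → L2Vec d) : Prop :=
  ∀ w : L2Vec d, ContinuousOn (fun t => ⟪B t, w⟫) (Ici 0)

/-- `v ∈ L²(ℝ_+, Sol(T^d))`. -/
def MemL2Sol {d : ℕ} (v : ℝ → L2Vec d) : Prop :=
  MemLp v 2 (volume.restrict (Ici 0)) ∧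
  ∀ᵐ t ∂(volume.restrict (Ici (0 : ℝ))), IsSol (v t)

/-- `∂_t φ + ∇·(φ v) = 0` on `(0,∞) × T^d` with initial value `φ₀`, tested against all smooth
functions that vanish for large times. -/
def SolvesTransport {d : ℕ} (φ₀ : L2 d) (φ : ℝ → L2 d) (v : ℝ → L2Vec d) : Prop :=
  ∀ ψ : ℝ → Torus d → ℝ, SmoothOn univ ψ → (∃ R : ℝ, ∀ t, R ≤ t → ∀ x, ψ t x = 0) →
    (∫ t in Ici (0 : ℝ), ∫ x,
        φ t x * (deriv (fun s => ψ s x) t + ⟪v t x, grad (ψ t) x⟫) ∂(leb d))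
      + ∫ x, φ₀ x * ψ 0 x ∂(leb d) = 0

/-- The dissipation inequality up to time `T`: for all smooth `z` with values in `Sol(T^d)` and
all `r ≥ 0` with `r I_d + ∇z + ∇zᵀ ≥ 0`, and all `t ∈ [0,T]`,
`∫_0^t {2K[v_s] + ((B_s ⊗ B_s, r I_d + ∇z_s + ∇z_sᵀ)) - 2K[z_s]} e^{-rs} ds + ‖B_t‖² e^{-rt} ≤ ‖B_0‖²`.
All terms other than `-2K[z_s]` are nonnegative, and `∫_0^t 2K[z_s] e^{-rs} ds` is finite, so
that this term is written on the right and the inequality is one between elements of `[0,∞]`. -/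
def DissipationInequality {d : ℕ} (m : ℕ) (T : ℝ) (B v : ℝ → L2Vec d) : Prop :=
  ∀ z : ℝ → Torus d → Vec d, SmoothOn (Icc 0 T) z → (∀ t ∈ Icc 0 T, IsSol (z t)) →
  ∀ r : ℝ, 0 ≤ r → (∀ t ∈ Icc 0 T, ∀ x, (shiftedSymGrad r (z t) x).PosSemidef) →
  ∀ t ∈ Icc 0 T,
    (∫⁻ s in Icc 0 t,
        (2 * K m (v s) + ENNReal.ofReal (tensorPairing (B s) r (z s)))
          * ENNReal.ofReal (Real.exp (-(s * r))))
      + ENNReal.ofReal (‖B t‖ ^ 2 * Real.exp (-(t * r)))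
    ≤ ENNReal.ofReal (‖B 0‖ ^ 2)
      + ∫⁻ s in Icc 0 t, 2 * K m (z s) * ENNReal.ofReal (Real.exp (-(s * r)))

/-- `(B = ∇φ, v)` is a global dissipative solution with initial datum `φ₀`. -/
structure IsGlobalDissipativeSolution {d : ℕ} (m : ℕ) (φ₀ : L2 d)
    (φ : ℝ → L2 d) (B v : ℝ → L2Vec d) : Prop where
  initial : φ 0 = φ₀
  mean : ∀ t, 0 ≤ t → ∫ x, φ t x ∂(leb d) = ∫ x, φ₀ x ∂(leb d)
  gradient : ∀ t, 0 ≤ t → HasWeakGrad (φ t) (B t)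
  transport : SolvesTransport φ₀ φ v
  dissipation : ∀ T : ℝ, 0 < T → DissipationInequality m T B v

end GradFlow

end

/-! The solution is a limit of Galerkin approximations. A state is a real trigonometric polynomial
`φ` with frequencies in a box. Its velocity solves `(-Δ)^m v = -ℙ ∇·(∇φ ⊗ ∇φ)` exactly, since the
right side is a trigonometric polynomial with frequencies in a box of twice the size, and `φ`
evolves by `∂_t φ = -T_N (v·∇φ)`, where `T_N` is Fourier truncation.

The a priori bounds survive the truncation, because `T_N` is an orthogonal projection that commutes
with derivatives. As `v` is divergence free, `‖φ‖` does not grow. Up to a gradient, which `v` does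
not see, the force equals `-Δφ ∇φ`; hence `d/dt ‖∇φ‖² = -2 ‖∇^m v‖²` (`inner_bC_galerkin`). Testing
the velocity equation with a solenoidal `z` gives `((∇φ ⊗ ∇φ, rI + ∇z + ∇zᵀ)) = r ‖∇φ‖² + 2 ((∇^m v,
∇^m z))`. Young's inequality for the last term and integration of `d/dt (e^{-rt} ‖∇φ‖²)` yield the
dissipation inequality for the approximations (`rate_add_tensorPairing_le`,
`IsGalerkin.dissipation`).

The quadratic equation for `v` need not pass to a weak limit, but the inequality does: where `rI +
∇z + ∇zᵀ ≥ 0` its left side is convex in `(B, v)`, so lower semicontinuous under weak convergence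
(`quadratic_le_liminf`, `lintegral_topJet_le_liminf`, with Fatou in time).

For compactness, the energy balance makes every Fourier coefficient of `φ` equicontinuous in time,
so a subsequence converges at all times (`exists_galerkinLimit`). With the gradient bound, Rellich's
theorem gives strong convergence of `φ_t` in `L²` (`cauchySeq_of_coef`), and `∇φ_t` converges
weakly. The velocities and their derivatives of order `m` converge weakly in `L²` of space-time
along an ultrafilter; solenoidality and the weak derivative relations are closed linear conditions
and persist. In the transport equation `φ` converges strongly and `v` weakly, so the product `φ v`
passes to the limit, while the uniform rate of `exists_trunc_rate` removes `T_N` from the test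
function (`solvesTransport`). -/

noncomputable section

namespace GradFlow

/-! ### Differentiation and integration of periodic functions -/

section TorusCalculus

open Filter Topology

variable {d : ℕ} {F : Type*} [NormedAddCommGroup F] [NormedSpace ℝ F]

/-- Openness is recorded besides the quotient property because it is stable under products, in
particular with a time axis. -/
lemma isOpenQuotientMap_proj : IsOpenQuotientMap (proj : (Fin d → ℝ) → Torus d) :=
  IsOpenQuotientMap.piMap (f := fun _ => ((↑) : ℝ → UnitAddCircle))
    fun _ => QuotientAddGroup.isOpenQuotientMap_mk

lemma proj_surjective : Function.Surjective (proj : (Fin d → ℝ) → Torus d) :=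
  isOpenQuotientMap_proj.surjective

lemma proj_add_single (x : Fin d → ℝ) (i : Fin d) (h : ℝ) :
    proj x + Pi.single i (h : UnitAddCircle) = proj (x + h • Pi.single i 1) := by
  funext j
  by_cases hj : j = i
  · subst hj; simp [proj]
  · simp [proj, hj]

lemma Smooth.continuous {f : Torus d → F} (hf : Smooth f) : Continuous f :=
  isOpenQuotientMap_proj.isQuotientMap.continuous_iff.2 (ContDiff.continuous hf)

lemma SmoothOn.smooth {I : Set ℝ} {f : ℝ → Torus d → F} (hf : SmoothOn I f) {t : ℝ} (ht : t ∈ I) :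
    Smooth (f t) := by
  have h : ContDiffOn ℝ ∞ (fun x : Fin d → ℝ => ((t, x) : ℝ × (Fin d → ℝ))) univ := by fun_prop
  exact contDiffOn_univ.1 (ContDiffOn.comp (t := I ×ˢ univ) hf h fun x _ => ⟨ht, mem_univ _⟩)

/-- The map `id × proj` is open, so neighbourhoods within `I ×ˢ univ` upstairs are carried onto such
neighbourhoods downstairs. This works for an arbitrary `I`. -/
lemma SmoothOn.continuousOn {I : Set ℝ} {f : ℝ → Torus d → F} (hf : SmoothOn I f) :
    ContinuousOn (fun p : ℝ × Torus d => f p.1 p.2) (I ×ˢ univ) := by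
  have hq : IsOpenQuotientMap (Prod.map (id : ℝ → ℝ) (proj : (Fin d → ℝ) → Torus d)) :=
    IsOpenQuotientMap.id.prodMap isOpenQuotientMap_proj
  have h := ContDiffOn.continuousOn hf
  rintro ⟨t, x⟩ ⟨ht, -⟩
  obtain ⟨y, rfl⟩ := proj_surjective x
  have h1 := h (t, y) ⟨ht, mem_univ _⟩
  unfold ContinuousWithinAt at h1 ⊢
  have h2 : 𝓝[I ×ˢ univ] ((t, proj y) : ℝ × Torus d)
      ≤ map (Prod.map id proj) (𝓝[I ×ˢ univ] ((t, y) : ℝ × (Fin d → ℝ))) := by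
    intro s hs
    rw [mem_map, mem_nhdsWithin_iff_exists_mem_nhds_inter] at hs
    obtain ⟨u, hu, hus⟩ := hs
    rw [mem_nhdsWithin_iff_exists_mem_nhds_inter]
    refine ⟨_, hq.isOpenMap.image_mem_nhds hu, ?_⟩
    rintro _ ⟨⟨⟨t', y'⟩, h', rfl⟩, ht'⟩
    exact hus ⟨h', ht'.1, mem_univ _⟩
  exact (tendsto_map'_iff.2 h1).mono_left h2

lemma pderiv_proj {f : Torus d → F} (hf : Smooth f) (i : Fin d) (x : Fin d → ℝ) :
    HasDerivAt (fun h : ℝ => f (proj x + Pi.single i (h : UnitAddCircle)))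
      (fderiv ℝ (fun x => f (proj x)) x (Pi.single i 1)) 0 := by
  simp_rw [proj_add_single]
  have h1 : HasFDerivAt (fun x => f (proj x)) (fderiv ℝ (fun x => f (proj x)) x)
      (x + (0 : ℝ) • Pi.single i 1) := by
    simpa using ((ContDiff.differentiable hf (by simp)) x).hasFDerivAt
  have h2 : HasDerivAt (fun h : ℝ => x + h • (Pi.single i 1 : Fin d → ℝ)) (Pi.single i 1) 0 := by
    simpa using ((hasDerivAt_id (0 : ℝ)).smul_const (Pi.single i 1 : Fin d → ℝ)).const_add x
  exact h1.comp_hasDerivAt (0 : ℝ) h2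

lemma pderiv_proj_eq {f : Torus d → F} (hf : Smooth f) (i : Fin d) (x : Fin d → ℝ) :
    pderiv i f (proj x) = fderiv ℝ (fun x => f (proj x)) x (Pi.single i 1) :=
  (pderiv_proj hf i x).deriv

lemma Smooth.hasDerivAt {f : Torus d → F} (hf : Smooth f) (i : Fin d) (x : Torus d) :
    HasDerivAt (fun h : ℝ => f (x + Pi.single i (h : UnitAddCircle))) (pderiv i f x) 0 := by
  obtain ⟨y, rfl⟩ := proj_surjective x
  rw [pderiv_proj_eq hf]
  exact pderiv_proj hf i y

lemma Smooth.hasDerivAt' {f : Torus d → F} (hf : Smooth f) (i : Fin d) (x : Torus d) (h : ℝ) :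
    HasDerivAt (fun h : ℝ => f (x + Pi.single i (h : UnitAddCircle)))
      (pderiv i f (x + Pi.single i (h : UnitAddCircle))) h := by
  have h1 := hf.hasDerivAt i (x + Pi.single i (h : UnitAddCircle))
  have h2 : HasDerivAt (fun s : ℝ => s - h) 1 h := (hasDerivAt_id h).sub_const h
  rw [show (0 : ℝ) = h - h by simp] at h1
  have h3 := HasDerivAt.scomp (h := fun s : ℝ => s - h) h h1 h2
  rw [one_smul] at h3
  refine h3.congr_of_eventuallyEq (Eventually.of_forall fun s => ?_)
  simp only [Function.comp]
  rw [add_assoc, ← Pi.single_add]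
  simp

lemma Smooth.pderiv {f : Torus d → F} (hf : Smooth f) (i : Fin d) : Smooth (pderiv i f) := by
  unfold Smooth
  simp_rw [pderiv_proj_eq hf]
  exact (ContDiff.fderiv_right (m := ∞) hf (by simp)).clm_apply contDiff_const

/-- The derivative within `I ×ˢ univ` in the direction `(0, e_i)` is the honest spatial derivative,
also at endpoints of `I`, because the whole slice `{t} × ℝ^d` lies in the set. -/
lemma SmoothOn.pderiv {I : Set ℝ} (hI : UniqueDiffOn ℝ I) {f : ℝ → Torus d → F}
    (hf : SmoothOn I f) (i : Fin d) : SmoothOn I fun t => GradFlow.pderiv i (f t) := by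
  have hU : UniqueDiffOn ℝ (I ×ˢ (univ : Set (Fin d → ℝ))) := hI.prod uniqueDiffOn_univ
  have h1 : ContDiffOn ℝ ∞ (fun p : ℝ × (Fin d → ℝ) =>
      fderivWithin ℝ (fun p : ℝ × (Fin d → ℝ) => f p.1 (proj p.2)) (I ×ˢ univ) p
        ((0, Pi.single i 1) : ℝ × (Fin d → ℝ))) (I ×ˢ univ) :=
    (ContDiffOn.fderivWithin (m := ∞) hf hU (by simp)).clm_apply contDiffOn_const
  refine h1.congr ?_
  rintro ⟨t, x⟩ ⟨ht, -⟩
  have hs : Smooth (f t) := hf.smooth ht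
  dsimp only
  rw [pderiv_proj_eq hs]
  have h2 : HasFDerivWithinAt (fun p : ℝ × (Fin d → ℝ) => f p.1 (proj p.2)) _ (I ×ˢ univ) (t, x) :=
    ((ContDiffOn.differentiableOn hf (by simp)) (t, x) ⟨ht, mem_univ _⟩).hasFDerivWithinAt
  have h3 : HasFDerivAt (fun y : Fin d → ℝ => ((t, y) : ℝ × (Fin d → ℝ)))
      (ContinuousLinearMap.inr ℝ ℝ (Fin d → ℝ)) x := hasFDerivAt_prodMk_right t x
  have h4 := h2.comp x (s := univ) h3.hasFDerivWithinAt fun y _ => ⟨ht, mem_univ _⟩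
  rw [hasFDerivWithinAt_univ] at h4
  have h5 := h4.fderiv
  simp only [Function.comp_def] at h5
  rw [h5]
  simp

lemma SmoothOn.deriv_time {f : ℝ → Torus d → F} (hf : SmoothOn univ f) :
    (∀ t x, HasDerivAt (fun s => f s x) (deriv (fun s => f s x) t) t) ∧
      SmoothOn univ fun t x => deriv (fun s => f s x) t := by
  have hf' : ContDiff ℝ ∞ (fun p : ℝ × (Fin d → ℝ) => f p.1 (proj p.2)) := by
    rw [← contDiffOn_univ, ← univ_prod_univ]; exact hf
  have h0 : ∀ t x, HasDerivAt (fun s => f s (proj x))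
      (fderiv ℝ (fun p : ℝ × (Fin d → ℝ) => f p.1 (proj p.2)) (t, x) (1, 0)) t := by
    intro t x
    have h1 := (hf'.differentiable (by simp) (t, x)).hasFDerivAt
    have h2 : HasDerivAt (fun s : ℝ => ((s, x) : ℝ × (Fin d → ℝ))) (1, 0) t :=
      (hasDerivAt_id t).prodMk (hasDerivAt_const t x)
    exact h1.comp_hasDerivAt t h2
  refine ⟨fun t x => ?_, ?_⟩
  · obtain ⟨y, rfl⟩ := proj_surjective x
    exact (h0 t y).differentiableAt.hasDerivAt
  · unfold SmoothOn
    simp_rw [fun t x => (h0 t x).deriv]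
    exact ((hf'.fderiv_right (m := ∞) (by simp)).clm_apply contDiff_const).contDiffOn

/-! ### Algebra of smooth functions -/

lemma smooth_const (c : F) : Smooth (fun _ : Torus d => c) := contDiff_const

lemma Smooth.add {f g : Torus d → F} (hf : Smooth f) (hg : Smooth g) :
    Smooth (fun x => f x + g x) := ContDiff.add hf hg

lemma Smooth.neg {f : Torus d → F} (hf : Smooth f) : Smooth (fun x => - f x) := ContDiff.neg hf

lemma Smooth.const_smul {f : Torus d → F} (hf : Smooth f) (c : ℝ) : Smooth (fun x => c • f x) :=
  ContDiff.const_smul c hf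

lemma Smooth.smul {f : Torus d → ℝ} {g : Torus d → F} (hf : Smooth f) (hg : Smooth g) :
    Smooth (fun x => f x • g x) := ContDiff.smul hf hg

lemma Smooth.mul {f g : Torus d → ℝ} (hf : Smooth f) (hg : Smooth g) :
    Smooth (fun x => f x * g x) := ContDiff.mul hf hg

lemma Smooth.sum {ι : Type*} {s : Finset ι} {f : ι → Torus d → F} (hf : ∀ i ∈ s, Smooth (f i)) :
    Smooth (fun x => ∑ i ∈ s, f i x) := ContDiff.sum (f := fun i x => f i (proj x)) hf

lemma Smooth.clm {G : Type*} [NormedAddCommGroup G] [NormedSpace ℝ G] {f : Torus d → F}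
    (hf : Smooth f) (L : F →L[ℝ] G) : Smooth (fun x => L (f x)) := L.contDiff.comp hf

lemma Smooth.coord {f : Torus d → Vec d} (hf : Smooth f) (i : Fin d) : Smooth (fun x => f x i) :=
  hf.clm (EuclideanSpace.proj i)

lemma smooth_vec {f : Torus d → Vec d} (hf : ∀ i, Smooth (fun x => f x i)) : Smooth f := by
  unfold Smooth; rw [contDiff_euclidean]; exact hf

lemma Smooth.grad {f : Torus d → ℝ} (hf : Smooth f) : Smooth (grad f) :=
  smooth_vec fun i => hf.pderiv i

lemma Smooth.iterPDeriv {m : ℕ} {f : Torus d → F} (hf : Smooth f) (α : Fin m → Fin d) :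
    Smooth (iterPDeriv α f) := by
  unfold GradFlow.iterPDeriv
  induction List.ofFn α with
  | nil => exact hf
  | cons i l ih => exact ih.pderiv i

lemma pderiv_const (i : Fin d) (c : F) : pderiv i (fun _ => c) = fun _ => 0 := by
  funext x; simp [GradFlow.pderiv]

lemma pderiv_add {f g : Torus d → F} (hf : Smooth f) (hg : Smooth g) (i : Fin d) :
    pderiv i (fun x => f x + g x) = fun x => pderiv i f x + pderiv i g x :=
  funext fun x => ((hf.hasDerivAt i x).add (hg.hasDerivAt i x)).deriv

lemma pderiv_neg {f : Torus d → F} (hf : Smooth f) (i : Fin d) :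
    pderiv i (fun x => - f x) = fun x => - pderiv i f x :=
  funext fun x => (hf.hasDerivAt i x).neg.deriv

lemma pderiv_const_smul {f : Torus d → F} (hf : Smooth f) (c : ℝ) (i : Fin d) :
    pderiv i (fun x => c • f x) = fun x => c • pderiv i f x :=
  funext fun x => ((hf.hasDerivAt i x).const_smul c).deriv

lemma pderiv_sum {ι : Type*} {s : Finset ι} {f : ι → Torus d → F} (hf : ∀ i ∈ s, Smooth (f i))
    (i : Fin d) : pderiv i (fun x => ∑ j ∈ s, f j x) = fun x => ∑ j ∈ s, pderiv i (f j) x :=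
  funext fun x => (HasDerivAt.fun_sum fun j hj => (hf j hj).hasDerivAt i x).deriv

lemma pderiv_smul {f : Torus d → ℝ} {g : Torus d → F} (hf : Smooth f) (hg : Smooth g) (i : Fin d) :
    pderiv i (fun x => f x • g x) = fun x => f x • pderiv i g x + pderiv i f x • g x :=
  funext fun x => by
    have h := ((hf.hasDerivAt i x).fun_smul (hg.hasDerivAt i x)).deriv
    simp only [QuotientAddGroup.mk_zero, Pi.single_zero, add_zero] at h
    exact h

lemma pderiv_mul {f g : Torus d → ℝ} (hf : Smooth f) (hg : Smooth g) (i : Fin d) :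
    pderiv i (fun x => f x * g x) = fun x => f x * pderiv i g x + pderiv i f x * g x :=
  pderiv_smul hf hg i

lemma pderiv_clm {G : Type*} [NormedAddCommGroup G] [NormedSpace ℝ G] {f : Torus d → F}
    (hf : Smooth f) (L : F →L[ℝ] G) (i : Fin d) :
    pderiv i (fun x => L (f x)) = fun x => L (pderiv i f x) :=
  funext fun x => (L.hasFDerivAt.comp_hasDerivAt (0 : ℝ) (hf.hasDerivAt i x)).deriv

lemma pderiv_coord {f : Torus d → Vec d} (hf : Smooth f) (i j : Fin d) :
    pderiv i (fun x => f x j) = fun x => pderiv i f x j :=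
  pderiv_clm hf (EuclideanSpace.proj j) i

@[simp] lemma grad_apply (f : Torus d → ℝ) (x : Torus d) (i : Fin d) :
    grad f x i = pderiv i f x := rfl

lemma iterPDeriv_zero (α : Fin 0 → Fin d) (f : Torus d → F) : iterPDeriv α f = f := by
  simp [GradFlow.iterPDeriv]

lemma iterPDeriv_cons {m : ℕ} (i : Fin d) (α : Fin m → Fin d) (f : Torus d → F) :
    iterPDeriv (Fin.cons i α : Fin (m + 1) → Fin d) f = pderiv i (iterPDeriv α f) := by
  simp [GradFlow.iterPDeriv]

/-! ### Integration -/

lemma integrable_of_continuous {E : Type*} [NormedAddCommGroup E] {f : Torus d → E} (hf : Continuous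
    f) : Integrable f (leb d) :=
  hf.integrable_of_hasCompactSupport (HasCompactSupport.of_compactSpace f)

lemma memLp_of_continuous {E : Type*} [NormedAddCommGroup E] {f : Torus d → E} (hf : Continuous f)
    (p : ℝ≥0∞) : MemLp f p (leb d) :=
  hf.memLp_of_hasCompactSupport (HasCompactSupport.of_compactSpace f)

lemma exists_bound_of_continuous {E : Type*} [NormedAddCommGroup E] {f : Torus d → E} (hf :
    Continuous f) :
    ∃ C, 0 ≤ C ∧ ∀ x, ‖f x‖ ≤ C := by
  obtain ⟨C, hC⟩ := isCompact_univ.exists_bound_of_continuousOn hf.continuousOn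
  exact ⟨max C 0, le_max_right _ _, fun x => (hC x (mem_univ x)).trans (le_max_left _ _)⟩

/-- By translation invariance `h ↦ ∫ f (x + h e_i)` is constant; differentiate under the integral.
-/
lemma integral_pderiv {f : Torus d → F} (hf : Smooth f) (i : Fin d) :
    ∫ x, pderiv i f x ∂(leb d) = 0 := by
  have hc := (hf.pderiv i).continuous
  obtain ⟨C, -, hC⟩ := exists_bound_of_continuous hc
  have h1 := (hasDerivAt_integral_of_dominated_loc_of_deriv_le (μ := leb d) (s := univ) (x₀ := (0 :
      ℝ))
    (F := fun (h : ℝ) x => f (x + Pi.single i (h : UnitAddCircle)))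
    (F' := fun (h : ℝ) x => pderiv i f (x + Pi.single i (h : UnitAddCircle)))
    (bound := fun _ => C) univ_mem
    (Eventually.of_forall fun h => (hf.continuous.comp (by fun_prop)).aestronglyMeasurable)
    (integrable_of_continuous (hf.continuous.comp (by fun_prop)))
    (hc.comp (by fun_prop)).aestronglyMeasurable
    (Eventually.of_forall fun x h _ => hC _) (integrable_const C)
    (Eventually.of_forall fun x h _ => hf.hasDerivAt' i x h)).2
  simp_rw [integral_add_right_eq_self] at h1
  exact h1.unique (hasDerivAt_const _ _)

lemma integral_smul_pderiv {f : Torus d → ℝ} {g : Torus d → F} (hf : Smooth f) (hg : Smooth g)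
    (i : Fin d) : ∫ x, f x • pderiv i g x ∂(leb d) = - ∫ x, pderiv i f x • g x ∂(leb d) := by
  have h := integral_pderiv (hf.smul hg) i
  rw [pderiv_smul hf hg i, integral_add] at h
  · exact eq_neg_of_add_eq_zero_left h
  · exact integrable_of_continuous (hf.smul (hg.pderiv i)).continuous
  · exact integrable_of_continuous ((hf.pderiv i).smul hg).continuous

lemma integral_mul_pderiv {f g : Torus d → ℝ} (hf : Smooth f) (hg : Smooth g) (i : Fin d) :
    ∫ x, f x * pderiv i g x ∂(leb d) = - ∫ x, pderiv i f x * g x ∂(leb d) :=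
  integral_smul_pderiv hf hg i

end TorusCalculus

/-! ### Real trigonometric polynomials and Fourier truncation -/

section TrigPolynomials

open Filter Topology
open scoped Real

variable {d : ℕ}

/-- The frequency vector `2πk`. -/
def freq (k : Fin d → ℤ) (i : Fin d) : ℝ := 2 * π * k i

/-- The real trigonometric monomial `cos (2π k·x + θ)` on the torus. -/
def trig (k : Fin d → ℤ) (θ : ℝ) (x : Torus d) : ℝ :=
  (Complex.exp (θ * Complex.I) * UnitAddTorus.mFourier k x).re

/-- The phases of the cosine and the sine. -/
def phase (b : Bool) : ℝ := if b then -(π / 2) else 0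

/-- Frequencies with all entries at most `N` in absolute value. -/
def box (d N : ℕ) : Finset (Fin d → ℤ) := Fintype.piFinset fun _ => Finset.Icc (-(N : ℤ)) N

lemma mem_box {N : ℕ} {k : Fin d → ℤ} : k ∈ box d N ↔ ∀ i, |k i| ≤ N := by
  simp [box, abs_le]

lemma neg_mem_box {N : ℕ} {k : Fin d → ℤ} : -k ∈ box d N ↔ k ∈ box d N := by
  simp [mem_box]

lemma zero_mem_box {N : ℕ} : (0 : Fin d → ℤ) ∈ box d N := by simp [mem_box]

lemma mFourier_proj (k : Fin d → ℤ) (y : Fin d → ℝ) :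
    UnitAddTorus.mFourier k (proj y) = Complex.exp ((∑ i, freq k i * y i : ℝ) * Complex.I) := by
  simp only [UnitAddTorus.mFourier, ContinuousMap.coe_mk, proj, fourier_coe_apply]
  rw [← Complex.exp_sum]
  congr 1
  push_cast [freq]
  rw [Finset.sum_mul]
  refine Finset.sum_congr rfl fun i _ => ?_
  simp
  ring

lemma trig_proj (k : Fin d → ℤ) (θ : ℝ) (y : Fin d → ℝ) :
    trig k θ (proj y) = Real.cos (∑ i, freq k i * y i + θ) := by
  rw [trig, mFourier_proj, ← Complex.exp_add, ← add_mul, ← Complex.ofReal_add,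
    Complex.exp_ofReal_mul_I_re, add_comm]

lemma smooth_trig (k : Fin d → ℤ) (θ : ℝ) : Smooth (trig k θ) := by
  unfold Smooth
  simp_rw [trig_proj]
  fun_prop

lemma continuous_trig (k : Fin d → ℤ) (θ : ℝ) : Continuous (trig k θ) := (smooth_trig k
    θ).continuous

lemma abs_trig_le (k : Fin d → ℤ) (θ : ℝ) (x : Torus d) : |trig k θ x| ≤ 1 := by
  obtain ⟨y, rfl⟩ := proj_surjective x
  rw [trig_proj]; exact Real.abs_cos_le_one _

lemma pderiv_trig (i : Fin d) (k : Fin d → ℤ) (θ : ℝ) :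
    pderiv i (trig k θ) = fun x => freq k i * trig k (θ + π / 2) x := by
  funext x
  obtain ⟨y, rfl⟩ := proj_surjective x
  refine HasDerivAt.deriv ?_
  simp_rw [proj_add_single, trig_proj]
  have h : ∀ h : ℝ, ∑ j, freq k j * (y + h • (Pi.single i 1 : Fin d → ℝ)) j + θ
      = h * freq k i + (∑ j, freq k j * y j + θ) := by
    intro h
    simp only [Pi.add_apply, Pi.smul_apply, smul_eq_mul, mul_add, Finset.sum_add_distrib]
    have h2 : ∑ j, freq k j * (h * (Pi.single i 1 : Fin d → ℝ) j) = freq k i * h := by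
      rw [Finset.sum_eq_single i (fun j _ hj => by simp [hj]) (by simp)]
      simp
    rw [h2]; ring
  simp_rw [h]
  have h2 := (((hasDerivAt_id (0 : ℝ)).mul_const (freq k i)).add_const
    (∑ j, freq k j * y j + θ)).cos
  refine h2.congr_deriv ?_
  rw [← add_assoc (∑ j, freq k j * y j) θ, Real.cos_add_pi_div_two]
  simp; ring

lemma trig_mul (k l : Fin d → ℤ) (θ η : ℝ) (x : Torus d) :
    trig k θ x * trig l η x = (trig (k + l) (θ + η) x + trig (k - l) (θ - η) x) / 2 := by
  obtain ⟨y, rfl⟩ := proj_surjective x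
  simp_rw [trig_proj]
  have h1 : ∑ i, freq (k + l) i * y i = ∑ i, freq k i * y i + ∑ i, freq l i * y i := by
    rw [← Finset.sum_add_distrib]
    exact Finset.sum_congr rfl fun i _ => by simp [freq]; ring
  have h2 : ∑ i, freq (k - l) i * y i = ∑ i, freq k i * y i - ∑ i, freq l i * y i := by
    rw [← Finset.sum_sub_distrib]
    exact Finset.sum_congr rfl fun i _ => by simp [freq]; ring
  rw [h1, h2]
  set a := ∑ i, freq k i * y i
  set b := ∑ i, freq l i * y i
  rw [show a + b + (θ + η) = (a + θ) + (b + η) by ring,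
    show a - b + (θ - η) = (a + θ) - (b + η) by ring, Real.cos_add (a + θ), Real.cos_sub (a + θ)]
  ring

lemma trig_zero (θ : ℝ) (x : Torus d) : trig 0 θ x = Real.cos θ := by
  obtain ⟨y, rfl⟩ := proj_surjective x
  rw [trig_proj]; simp [freq]

lemma trig_neg (k : Fin d → ℤ) (θ : ℝ) (x : Torus d) : trig (-k) θ x = trig k (-θ) x := by
  obtain ⟨y, rfl⟩ := proj_surjective x
  rw [trig_proj, trig_proj, ← Real.cos_neg]
  congr 1
  simp [freq, Finset.sum_neg_distrib, add_comm]

lemma trig_phase (k : Fin d → ℤ) (θ : ℝ) (x : Torus d) :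
    trig k θ x = Real.cos θ * trig k (phase false) x - Real.sin θ * trig k (phase true) x := by
  obtain ⟨y, rfl⟩ := proj_surjective x
  simp only [trig_proj, phase, Bool.false_eq_true, if_false, if_true, add_zero]
  rw [← sub_eq_add_neg, Real.cos_sub_pi_div_two, Real.cos_add]
  ring

lemma trig_add_pi (k : Fin d → ℤ) (θ : ℝ) (x : Torus d) : trig k (θ + π) x = - trig k θ x := by
  obtain ⟨y, rfl⟩ := proj_surjective x
  rw [trig_proj, trig_proj, ← add_assoc, Real.cos_add_pi]

lemma freq_ne_zero {k : Fin d → ℤ} (hk : k ≠ 0) : ∃ i, freq k i ≠ 0 := by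
  obtain ⟨i, hi⟩ := Function.ne_iff.1 hk
  exact ⟨i, by simpa [freq, Real.pi_ne_zero] using hi⟩

/-- For `k ≠ 0` the monomial is, up to a nonzero factor, a partial derivative of another monomial.
-/
lemma integral_trig (k : Fin d → ℤ) (θ : ℝ) :
    ∫ x, trig k θ x ∂(leb d) = if k = 0 then Real.cos θ else 0 := by
  split_ifs with hk
  · subst hk; simp [trig_zero]
  · obtain ⟨i, hi⟩ := freq_ne_zero hk
    have h := integral_pderiv (smooth_trig k (θ - π / 2)) i
    rw [pderiv_trig, integral_const_mul, sub_add_cancel] at h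
    exact (mul_eq_zero.1 h).resolve_left hi

/-- The Fourier coefficient of `f` along `trig k (phase b)`. -/
def coef (f : Torus d → ℝ) (k : Fin d → ℤ) (b : Bool) : ℝ :=
  ∫ x, f x * trig k (phase b) x ∂(leb d)

/-- Truncation of the Fourier series to the frequencies of a box. -/
def trunc (N : ℕ) (f : Torus d → ℝ) (x : Torus d) : ℝ :=
  ∑ k ∈ box d N, ∑ b : Bool, coef f k b * trig k (phase b) x

lemma integral_trig_mul_trig (k l : Fin d → ℤ) (θ η : ℝ) :
    ∫ x, trig l η x * trig k θ x ∂(leb d)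
      = ((if k = -l then Real.cos (η + θ) else 0) + (if k = l then Real.cos (η - θ) else 0)) / 2 :=
          by
  simp_rw [trig_mul]
  rw [integral_div, integral_add (integrable_of_continuous (continuous_trig _ _))
    (integrable_of_continuous (continuous_trig _ _)), integral_trig, integral_trig]
  simp only [sub_eq_zero, add_eq_zero_iff_neg_eq, @eq_comm _ k]

/-- The family of all `trig k (phase b)` is redundant: `k` and `-k` give the same functions up to
sign. Each contributes one half, which compensates `∫ cos² = 1/2`, so `trunc` needs no normalising
constants, not even at `l = 0`. -/
lemma trunc_trig {N : ℕ} {l : Fin d → ℤ} (hl : l ∈ box d N) (η : ℝ) :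
    trunc N (trig l η) = trig l η := by
  funext x
  have h1 : ∀ k ∈ box d N, ∑ b : Bool, coef (trig l η) k b * trig k (phase b) x
      = (if k = -l then ∑ b : Bool, Real.cos (η + phase b) / 2 * trig k (phase b) x else 0)
        + (if k = l then ∑ b : Bool, Real.cos (η - phase b) / 2 * trig k (phase b) x else 0) := by
    intro k _
    simp only [coef, integral_trig_mul_trig, Fintype.sum_bool]
    split_ifs <;> ring
  rw [trunc, Finset.sum_congr rfl h1, Finset.sum_add_distrib, Finset.sum_ite_eq',
    Finset.sum_ite_eq', if_pos hl, if_pos (neg_mem_box.2 hl)]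
  simp only [Fintype.sum_bool, trig_neg]
  rw [trig_phase l η, trig_phase l (-phase true), trig_phase l (-phase false)]
  simp only [phase, if_true, Bool.false_eq_true, if_false, neg_neg, neg_zero, Real.cos_zero,
    Real.sin_zero, Real.cos_pi_div_two, Real.sin_pi_div_two, add_zero, sub_zero, sub_neg_eq_add,
    Real.cos_add_pi_div_two, ← sub_eq_add_neg, Real.cos_sub_pi_div_two]
  ring

lemma smooth_trunc (N : ℕ) (f : Torus d → ℝ) : Smooth (trunc N f) :=
  Smooth.sum fun k _ => Smooth.sum fun b _ => (smooth_trig k (phase b)).const_smul (coef f k b)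

lemma integrable_mul_continuous {f g : Torus d → ℝ} (hf : Integrable f (leb d))
    (hg : Continuous g) : Integrable (fun x => f x * g x) (leb d) := by
  obtain ⟨C, -, hC⟩ := exists_bound_of_continuous hg
  exact hf.mul_bdd (c := C) hg.aestronglyMeasurable (Eventually.of_forall hC)

lemma integral_mul_trunc {f : Torus d → ℝ} (hf : Integrable f (leb d)) (N : ℕ) (g : Torus d → ℝ) :
    ∫ x, f x * trunc N g x ∂(leb d) = ∑ k ∈ box d N, ∑ b : Bool, coef f k b * coef g k b := by
  simp only [trunc, Finset.mul_sum]
  have hi : ∀ k b, Integrable (fun x => f x * (coef g k b * trig k (phase b) x)) (leb d) :=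
    fun k b => integrable_mul_continuous hf (continuous_const.mul (continuous_trig _ _))
  rw [integral_finsetSum _ fun k _ => integrable_finsetSum _ fun b _ => hi k b]
  refine Finset.sum_congr rfl fun k _ => ?_
  rw [integral_finsetSum _ fun b _ => hi k b]
  refine Finset.sum_congr rfl fun b _ => ?_
  rw [coef.eq_1 f, ← integral_mul_const]
  congr 1; funext x; ring

/-- Truncation is self-adjoint, since either side is the same symmetric sum of products of
coefficients. -/
lemma integral_mul_trunc_comm {f g : Torus d → ℝ} (hf : Integrable f (leb d))
    (hg : Integrable g (leb d)) (N : ℕ) :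
    ∫ x, f x * trunc N g x ∂(leb d) = ∫ x, trunc N f x * g x ∂(leb d) := by
  simp_rw [mul_comm (trunc N f _)]
  rw [integral_mul_trunc hf, integral_mul_trunc hg]
  simp_rw [mul_comm]

lemma trig_shift_coef {f : Torus d → ℝ} (hf : Integrable f (leb d)) (k : Fin d → ℤ) (θ : ℝ) :
    ∫ x, f x * trig k θ x ∂(leb d) = Real.cos θ * coef f k false - Real.sin θ * coef f k true := by
  simp_rw [trig_phase k θ, mul_sub, mul_left_comm (f _)]
  rw [integral_sub ((integrable_mul_continuous hf (continuous_trig _ _)).const_mul _)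
    ((integrable_mul_continuous hf (continuous_trig _ _)).const_mul _), integral_const_mul,
    integral_const_mul]
  rfl

/-- `coef` of a weak partial derivative. -/
lemma coef_of_weak {f g : Torus d → ℝ} (hf : Integrable f (leb d)) {i : Fin d}
    (h : ∀ ψ : Torus d → ℝ, Smooth ψ → ∫ x, f x * pderiv i ψ x ∂(leb d) = - ∫ x, g x * ψ x ∂(leb d))
    (k : Fin d → ℤ) :
    coef g k false = freq k i * coef f k true ∧ coef g k true = - (freq k i * coef f k false) := by
  have h1 : ∀ θ, ∫ x, g x * trig k θ x ∂(leb d)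
      = - (freq k i * ∫ x, f x * trig k (θ + π / 2) x ∂(leb d)) := by
    intro θ
    have := h _ (smooth_trig k θ)
    rw [pderiv_trig] at this
    rw [← integral_const_mul, ← neg_eq_iff_eq_neg, ← this]
    congr 1; funext x; ring
  constructor
  · rw [coef, h1, trig_shift_coef hf]
    simp [phase]
  · rw [coef, h1, trig_shift_coef hf]
    simp [phase]

/-- Stated for weak derivatives because it is needed for the initial datum, whose gradient is only
in `L²`. -/
lemma pderiv_trunc (N : ℕ) (i : Fin d) {f g : Torus d → ℝ} (hf : Integrable f (leb d))
    (h : ∀ ψ : Torus d → ℝ, Smooth ψ →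
      ∫ x, f x * pderiv i ψ x ∂(leb d) = - ∫ x, g x * ψ x ∂(leb d)) :
    pderiv i (trunc N f) = trunc N g := by
  have hs : ∀ k b, Smooth (fun x => coef f k b * trig k (phase b) x) :=
    fun k b => (smooth_trig k (phase b)).const_smul (coef f k b)
  unfold trunc
  rw [pderiv_sum fun k _ => Smooth.sum fun b _ => hs k b]
  funext x
  refine Finset.sum_congr rfl fun k _ => ?_
  rw [pderiv_sum fun b _ => hs k b]
  have h2 : ∀ b, pderiv i (fun x => coef f k b * trig k (phase b) x)
      = fun x => coef f k b * (freq k i * trig k (phase b + π / 2) x) := fun b =>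
    (pderiv_const_smul (smooth_trig k (phase b)) _ i).trans (by rw [pderiv_trig]; rfl)
  simp only [h2, Fintype.sum_bool, (coef_of_weak hf h k).1, (coef_of_weak hf h k).2]
  rw [trig_phase k (phase true + π / 2), trig_phase k (phase false + π / 2)]
  simp [phase]
  ring

lemma pderiv_trunc_smooth (N : ℕ) (i : Fin d) {f : Torus d → ℝ} (hf : Smooth f) :
    pderiv i (trunc N f) = trunc N (pderiv i f) :=
  pderiv_trunc N i (integrable_of_continuous hf.continuous) fun _ hψ => integral_mul_pderiv hf hψ i

/-! ### Spaces of trigonometric polynomials -/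

/-- Real trigonometric polynomials with frequencies in a box. -/
def trigSpace (d N : ℕ) : Submodule ℝ (Torus d → ℝ) :=
  Submodule.span ℝ {f | ∃ k ∈ box d N, ∃ θ, f = trig k θ}

lemma trig_mem {N : ℕ} {k : Fin d → ℤ} (hk : k ∈ box d N) (θ : ℝ) : trig k θ ∈ trigSpace d N :=
  Submodule.subset_span ⟨k, hk, θ, rfl⟩

lemma smooth_of_mem {N : ℕ} {f : Torus d → ℝ} (hf : f ∈ trigSpace d N) : Smooth f := by
  induction hf using Submodule.span_induction with
  | mem f h => obtain ⟨k, _, θ, rfl⟩ := h; exact smooth_trig k θ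
  | zero => exact smooth_const 0
  | add f g _ _ hf hg => exact hf.add hg
  | smul c f _ hf => exact hf.const_smul c

lemma pderiv_mem {N : ℕ} {f : Torus d → ℝ} (hf : f ∈ trigSpace d N) (i : Fin d) :
    pderiv i f ∈ trigSpace d N := by
  induction hf using Submodule.span_induction with
  | mem f h =>
    obtain ⟨k, hk, θ, rfl⟩ := h
    rw [pderiv_trig]
    exact (trigSpace d N).smul_mem (freq k i) (trig_mem hk _)
  | zero => exact (pderiv_const i (0 : ℝ)) ▸ (trigSpace d N).zero_mem
  | add f g hf' hg' hf hg =>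
    have := pderiv_add (smooth_of_mem hf') (smooth_of_mem hg') i
    exact this ▸ (trigSpace d N).add_mem hf hg
  | smul c f hf' hf =>
    have := pderiv_const_smul (smooth_of_mem hf') c i
    exact this ▸ (trigSpace d N).smul_mem c hf

lemma pderiv_comm_of_mem {N : ℕ} {f : Torus d → ℝ} (hf : f ∈ trigSpace d N) (i j : Fin d) :
    pderiv i (pderiv j f) = pderiv j (pderiv i f) := by
  induction hf using Submodule.span_induction with
  | mem f h =>
    obtain ⟨k, hk, θ, rfl⟩ := h
    have h1 : ∀ i j, pderiv i (pderiv j (trig k θ))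
        = fun x => freq k j * (freq k i * trig k (θ + π / 2 + π / 2) x) := fun i j => by
      rw [pderiv_trig]
      exact (pderiv_const_smul (smooth_trig k (θ + π / 2)) (freq k j) i).trans
        (by rw [pderiv_trig]; rfl)
    rw [h1, h1]
    funext x; ring
  | zero =>
    have : ∀ i : Fin d, pderiv i (0 : Torus d → ℝ) = 0 := fun i => pderiv_const i (0 : ℝ)
    simp [this]
  | add f g hf' hg' hf hg =>
    have h1 : ∀ i, pderiv i (f + g) = fun x => pderiv i f x + pderiv i g x := fun i =>
      pderiv_add (smooth_of_mem hf') (smooth_of_mem hg') i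
    rw [h1, h1, pderiv_add ((smooth_of_mem hf').pderiv j) ((smooth_of_mem hg').pderiv j),
      pderiv_add ((smooth_of_mem hf').pderiv i) ((smooth_of_mem hg').pderiv i), hf, hg]
  | smul c f hf' hf =>
    have h1 : ∀ i, pderiv i (c • f) = fun x => c • pderiv i f x := fun i =>
      pderiv_const_smul (smooth_of_mem hf') c i
    rw [h1, h1, pderiv_const_smul ((smooth_of_mem hf').pderiv j),
      pderiv_const_smul ((smooth_of_mem hf').pderiv i), hf]

/-- The product formula for cosines adds and subtracts frequencies. This is why forces and
velocities live in the box of size `N + N`. -/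
lemma mul_mem_trigSpace {N M : ℕ} {f g : Torus d → ℝ} (hf : f ∈ trigSpace d N)
    (hg : g ∈ trigSpace d M) : f * g ∈ trigSpace d (N + M) := by
  refine (Submodule.mul_le.1 ?_ : ∀ f ∈ trigSpace d N, ∀ g ∈ trigSpace d M, _) f hf g hg
  rw [trigSpace, trigSpace, Submodule.span_mul_span, Submodule.span_le]
  rintro _ ⟨_, ⟨k, hk, θ, rfl⟩, _, ⟨l, hl, η, rfl⟩, rfl⟩
  have h : (fun x => trig k θ x * trig l η x)
      = (1 / 2 : ℝ) • trig (k + l) (θ + η) + (1 / 2 : ℝ) • trig (k - l) (θ - η) := by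
    funext x; simp [trig_mul]; ring
  change (fun x => trig k θ x * trig l η x) ∈ trigSpace d (N + M)
  rw [mem_box] at hk hl
  rw [h]
  refine add_mem (Submodule.smul_mem _ _ (trig_mem (mem_box.2 fun i => ?_) _))
    (Submodule.smul_mem _ _ (trig_mem (mem_box.2 fun i => ?_) _))
  · push_cast; exact (abs_add_le _ _).trans (add_le_add (hk i) (hl i))
  · push_cast; exact (abs_sub _ _).trans (add_le_add (hk i) (hl i))

lemma coef_add {f g : Torus d → ℝ} (hf : Integrable f (leb d)) (hg : Integrable g (leb d))
    (k : Fin d → ℤ) (b : Bool) : coef (fun x => f x + g x) k b = coef f k b + coef g k b := by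
  simp only [coef, add_mul]
  exact integral_add (integrable_mul_continuous hf (continuous_trig _ _))
    (integrable_mul_continuous hg (continuous_trig _ _))

lemma coef_const_mul (c : ℝ) (f : Torus d → ℝ) (k : Fin d → ℤ) (b : Bool) :
    coef (fun x => c * f x) k b = c * coef f k b := by
  simp only [coef, mul_assoc, integral_const_mul]

lemma trunc_of_mem {N : ℕ} {f : Torus d → ℝ} (hf : f ∈ trigSpace d N) : trunc N f = f := by
  induction hf using Submodule.span_induction with
  | mem f h => obtain ⟨k, hk, θ, rfl⟩ := h; exact trunc_trig hk θ
  | zero => funext x; simp [trunc, coef]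
  | add f g hf' hg' hf hg =>
    funext x
    nth_rw 2 [← hf, ← hg]
    have : ∀ k b, coef (f + g) k b = coef f k b + coef g k b :=
      coef_add (integrable_of_continuous (smooth_of_mem hf').continuous)
        (integrable_of_continuous (smooth_of_mem hg').continuous)
    simp only [trunc, this, add_mul, Finset.sum_add_distrib, Pi.add_apply]
  | smul c f hf' hf =>
    funext x
    nth_rw 2 [← hf]
    have : ∀ k b, coef (c • f) k b = c * coef f k b := coef_const_mul c f
    simp only [trunc, this, mul_assoc, ← Finset.mul_sum, Pi.smul_apply, smul_eq_mul]

lemma trunc_mem (N : ℕ) (f : Torus d → ℝ) : trunc N f ∈ trigSpace d N := by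
  have h : trunc N f = ∑ k ∈ box d N, ∑ b : Bool, coef f k b • trig k (phase b) := by
    funext x; simp [trunc]
  rw [h]
  exact Submodule.sum_mem _ fun k hk => Submodule.sum_mem _ fun b _ =>
    Submodule.smul_mem _ _ (trig_mem hk _)

/-- Truncation is self-adjoint and idempotent, hence an orthogonal projection. -/
lemma integral_trunc_sq_le (N : ℕ) {f : Torus d → ℝ} (hf : MemLp f 2 (leb d)) :
    ∫ x, trunc N f x ^ 2 ∂(leb d) ≤ ∫ x, f x ^ 2 ∂(leb d) := by
  have hi : Integrable f (leb d) := hf.integrable (by norm_num)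
  have hc := (smooth_trunc N f).continuous
  have h1 : ∫ x, f x * trunc N f x ∂(leb d) = ∫ x, trunc N f x ^ 2 ∂(leb d) := by
    conv_lhs => rw [← trunc_of_mem (trunc_mem N f)]
    rw [integral_mul_trunc_comm hi (integrable_of_continuous hc)]
    simp_rw [sq]
  have h2 : 0 ≤ ∫ x, (f x - trunc N f x) ^ 2 ∂(leb d) := integral_nonneg fun x => sq_nonneg _
  have hi2 := integrable_of_continuous (f := fun x => trunc N f x ^ 2) (hc.pow 2)
  have h3 : ∫ x, (f x - trunc N f x) ^ 2 ∂(leb d) = ∫ x, f x ^ 2 ∂(leb d)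
      - 2 * ∫ x, f x * trunc N f x ∂(leb d) + ∫ x, trunc N f x ^ 2 ∂(leb d) := by
    rw [← integral_const_mul, ← integral_sub hf.integrable_sq
      ((integrable_mul_continuous hi hc).const_mul 2), ← integral_add _ hi2]
    · congr 1; funext x; ring
    · exact hf.integrable_sq.sub ((integrable_mul_continuous hi hc).const_mul 2)
  linarith

end TrigPolynomials

/-! ### Parseval, Poincaré and Rellich inequalities, uniform convergence of Fourier series -/

section FourierSeries

open Filter Topology
open scoped Real

variable {d : ℕ}

lemma mFourierCoeff_ofReal {f : Torus d → ℝ} (hf : Integrable f (leb d)) (k : Fin d → ℤ) :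
    UnitAddTorus.mFourierCoeff (fun x => (f x : ℂ)) k
      = (coef f k false : ℂ) - (coef f k true : ℂ) * Complex.I := by
  have h1 : ∀ x, UnitAddTorus.mFourier (-k) x • (f x : ℂ)
      = ((f x * trig k (phase false) x : ℝ) : ℂ)
        - ((f x * trig k (phase true) x : ℝ) : ℂ) * Complex.I := by
    intro x
    obtain ⟨y, rfl⟩ := proj_surjective x
    rw [mFourier_proj, trig_proj, trig_proj, Complex.exp_ofReal_mul_I]
    simp only [phase, Bool.false_eq_true, if_false, if_true, add_zero, ← sub_eq_add_neg,
      Real.cos_sub_pi_div_two, smul_eq_mul, freq, Pi.neg_apply, Int.cast_neg, mul_neg, neg_mul,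
      Finset.sum_neg_distrib, Real.cos_neg, Real.sin_neg]
    push_cast
    ring
  have h2 : UnitAddTorus.mFourierCoeff (fun x => (f x : ℂ)) k
      = ∫ x, UnitAddTorus.mFourier (-k) x • (f x : ℂ) ∂(leb d) := rfl
  rw [h2]
  simp_rw [h1]
  have hi : ∀ b, Integrable (fun x => ((f x * trig k (phase b) x : ℝ) : ℂ)) (leb d) := fun b =>
    (integrable_mul_continuous hf (continuous_trig _ _)).ofReal
  rw [integral_sub (hi _) ((hi _).mul_const _), integral_mul_const,
    integral_complex_ofReal, integral_complex_ofReal]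
  rfl

/-- For real `f` the squared modulus of the complex coefficient at `k` is the sum of the squares of
the cosine and sine coefficients. Summation runs over all `k`, so no factor `2` appears. -/
lemma parseval {f : Torus d → ℝ} (hf : MemLp f 2 (leb d)) :
    HasSum (fun k => ∑ b : Bool, coef f k b ^ 2) (∫ x, f x ^ 2 ∂(leb d)) := by
  have hg : MemLp (fun x => (f x : ℂ)) 2 (leb d) := hf.ofReal
  have h := UnitAddTorus.hasSum_sq_mFourierCoeff (hg.toLp _)
  have hae := hg.coeFn_toLp
  have h1 : ∀ k, UnitAddTorus.mFourierCoeff (hg.toLp _) k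
      = UnitAddTorus.mFourierCoeff (fun x => (f x : ℂ)) k := fun k => by
    refine integral_congr_ae ?_
    filter_upwards [hae] with x hx
    rw [hx]
  have h2 : ∫ x, ‖(hg.toLp _ : Torus d → ℂ) x‖ ^ 2 ∂(leb d) = ∫ x, f x ^ 2 ∂(leb d) := by
    refine integral_congr_ae ?_
    filter_upwards [hae] with x hx
    rw [hx]; simp
  have h3 : HasSum (fun k => ‖UnitAddTorus.mFourierCoeff (hg.toLp _) k‖ ^ 2)
      (∫ x, ‖(hg.toLp _ : Torus d → ℂ) x‖ ^ 2 ∂(leb d)) := h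
  rw [h2] at h3
  convert h3 using 2 with k
  rw [h1, mFourierCoeff_ofReal (hf.integrable (by norm_num)), ← Complex.normSq_eq_norm_sq,
    Complex.normSq_apply, Fintype.sum_bool]
  simp
  ring

lemma sum_coef_sq_of_weak {f g : Torus d → ℝ} (hf : Integrable f (leb d)) {i : Fin d}
    (h : ∀ ψ : Torus d → ℝ, Smooth ψ → ∫ x, f x * pderiv i ψ x ∂(leb d) = - ∫ x, g x * ψ x ∂(leb d))
    (k : Fin d → ℤ) :
    ∑ b : Bool, coef g k b ^ 2 = freq k i ^ 2 * ∑ b : Bool, coef f k b ^ 2 := by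
  simp only [Fintype.sum_bool, (coef_of_weak hf h k).1, (coef_of_weak hf h k).2]
  ring

lemma sq_le_freq_sq {n : ℤ} {k : Fin d → ℤ} {i : Fin d} (hn : 0 ≤ n) (h : n ≤ |k i|) :
    (n : ℝ) ^ 2 ≤ freq k i ^ 2 := by
  have h1 : (n : ℝ) ≤ |(k i : ℝ)| := by exact_mod_cast h
  rw [← sq_abs (freq k i)]
  have h2 : |(k i : ℝ)| ≤ |freq k i| := by
    rw [freq, abs_mul, abs_of_pos (by positivity : 0 < 2 * π)]
    exact le_mul_of_one_le_left (abs_nonneg _) (by linarith [Real.pi_gt_three])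
  have h3 : (0 : ℝ) ≤ n := by exact_mod_cast hn
  gcongr
  exact h1.trans h2

/-- Quantitative Rellich and Poincaré inequality: the frequencies outside a box are controlled by
the gradient. -/
lemma integral_sq_le_box {f : Torus d → ℝ} {g : Fin d → Torus d → ℝ} (hf : MemLp f 2 (leb d))
    (hg : ∀ i, MemLp (g i) 2 (leb d))
    (h : ∀ i, ∀ ψ : Torus d → ℝ, Smooth ψ →
      ∫ x, f x * pderiv i ψ x ∂(leb d) = - ∫ x, g i x * ψ x ∂(leb d)) (N : ℕ) :
    ∫ x, f x ^ 2 ∂(leb d) ≤ (∑ k ∈ box d N, ∑ b : Bool, coef f k b ^ 2)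
      + ((N : ℝ) + 1)⁻¹ ^ 2 * ∑ i, ∫ x, g i x ^ 2 ∂(leb d) := by
  have h1 := parseval hf
  have h2 : HasSum (fun k => ∑ i, ∑ b : Bool, coef (g i) k b ^ 2)
      (∑ i, ∫ x, g i x ^ 2 ∂(leb d)) := hasSum_sum fun i _ => parseval (hg i)
  have h3 : HasSum (fun k => if k ∈ box d N then ∑ b : Bool, coef f k b ^ 2 else 0)
      (∑ k ∈ box d N, ∑ b : Bool, coef f k b ^ 2) := by
    have := hasSum_sum_of_ne_finset_zero (L := SummationFilter.unconditional _)
      (f := fun k => if k ∈ box d N then ∑ b : Bool, coef f k b ^ 2 else 0) (s := box d N)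
      (fun k hk => if_neg hk)
    rwa [Finset.sum_congr rfl fun k hk => if_pos hk] at this
  refine hasSum_le (fun k => ?_) h1 (h3.add (h2.mul_left (((N : ℝ) + 1)⁻¹ ^ 2)))
  have hi := hf.integrable (by norm_num : (1 : ℝ≥0∞) ≤ 2)
  by_cases hk : k ∈ box d N
  · rw [if_pos hk]
    exact le_add_of_nonneg_right (by positivity)
  · rw [if_neg hk, zero_add]
    simp only [mem_box, not_forall, not_le] at hk
    obtain ⟨i, hi'⟩ := hk
    -- Outside the box some coordinate has `|k i| ≥ N + 1`; the derivative in that one direction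
    -- pays for the coefficient.
    have h4 := sq_le_freq_sq (n := (N : ℤ) + 1) (by positivity) hi'
    push_cast at h4
    have h5 : ∑ b : Bool, coef f k b ^ 2
        ≤ ((N : ℝ) + 1)⁻¹ ^ 2 * ∑ b : Bool, coef (g i) k b ^ 2 := by
      rw [sum_coef_sq_of_weak hi (h i), ← mul_assoc]
      refine le_mul_of_one_le_left (by positivity) ?_
      rw [inv_pow, ← div_eq_inv_mul, le_div_iff₀ (by positivity), one_mul]
      exact h4
    refine h5.trans ?_
    gcongr
    exact Finset.single_le_sum (f := fun i => ∑ b : Bool, coef (g i) k b ^ 2)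
      (fun i _ => by positivity) (Finset.mem_univ i)

/-- Poincaré inequality for smooth functions of zero mean. -/
lemma poincare {f : Torus d → ℝ} (hf : Smooth f) (h0 : ∫ x, f x ∂(leb d) = 0) :
    ∫ x, f x ^ 2 ∂(leb d) ≤ ∑ i, ∫ x, pderiv i f x ^ 2 ∂(leb d) := by
  -- For `N = 0` the box holds only the zero frequency, whose coefficients vanish by the mean
  -- condition, and the factor `(N + 1)⁻¹ ^ 2` is `1`.
  have h := integral_sq_le_box (memLp_of_continuous hf.continuous 2)
    (fun i => memLp_of_continuous (hf.pderiv i).continuous 2)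
    (fun i ψ hψ => integral_mul_pderiv hf hψ i) 0
  have h1 : ∑ k ∈ box d 0, ∑ b : Bool, coef f k b ^ 2 = 0 := by
    refine Finset.sum_eq_zero fun k hk => Finset.sum_eq_zero fun b _ => ?_
    have : k = 0 := by
      funext i; simpa using mem_box.1 hk i
    subst this
    simp [coef, trig_zero, integral_mul_const, h0]
  rw [h1] at h
  simpa using h

lemma box_tendsto : Tendsto (fun N => box d N) atTop atTop := by
  refine tendsto_atTop_finset_of_monotone (fun N M h k hk => ?_) fun k => ?_
  · rw [mem_box] at hk ⊢
    exact fun i => (hk i).trans (by exact_mod_cast h)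
  · refine ⟨∑ i, (k i).natAbs, mem_box.2 fun i => ?_⟩
    rw [Int.abs_eq_natAbs]
    exact_mod_cast Finset.single_le_sum (f := fun i => (k i).natAbs) (fun _ _ => Nat.zero_le _)
      (Finset.mem_univ i)

/-- The integer vector `k` as a real vector. -/
def intVec (k : Fin d → ℤ) : Fin d → ℝ := fun i => (k i : ℝ)

/-- The exponent exceeds the rank `d` of the lattice `ℤ^d`. This fixes `d + 1` as the number of
derivatives used for the decay of coefficients. -/
lemma summable_norm_intVec_inv_pow :
    Summable fun k : Fin d → ℤ => (‖intVec k‖⁻¹) ^ (d + 1) := by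
  let b := Pi.basisFun ℝ (Fin d)
  let L := Submodule.span ℤ (Set.range b)
  have hr : Module.finrank ℤ L < d + 1 := by
    have := Module.finrank_eq_card_basis (b.restrictScalars ℤ)
    rw [this]; simp
  have h := ZLattice.summable_norm_pow_inv L (d + 1) hr
  have hm : ∀ k : Fin d → ℤ, intVec k ∈ L := by
    intro k
    have : intVec k = ∑ i, k i • b i := by
      funext j; simp [intVec, b, Finset.sum_apply, Pi.single_apply]
    rw [this]
    exact Submodule.sum_mem _ fun i _ => Submodule.smul_mem _ _ (Submodule.subset_span ⟨i, rfl⟩)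
  have hinj : Function.Injective fun k : Fin d → ℤ => (⟨intVec k, hm k⟩ : L) := by
    intro k l hkl
    funext i
    have : intVec k i = intVec l i := congrFun (Subtype.ext_iff.1 hkl) i
    simp only [intVec] at this
    exact_mod_cast this
  have := h.comp_injective hinj
  simpa [Function.comp_def] using this

lemma exists_abs_eq_norm {k : Fin d → ℤ} (hk : k ≠ 0) : ∃ i, ‖intVec k‖ ≤ |freq k i| := by
  obtain ⟨i₀, hi₀⟩ := Function.ne_iff.1 hk
  have : Nonempty (Fin d) := ⟨i₀⟩
  obtain ⟨i, -, hi⟩ := Finset.exists_max_image Finset.univ (fun i => |(k i : ℝ)|) ⟨i₀,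
      Finset.mem_univ _⟩
  refine ⟨i, ?_⟩
  have h2 : |(k i : ℝ)| ≤ |freq k i| := by
    rw [freq, abs_mul, abs_of_pos (by positivity : 0 < 2 * π)]
    exact le_mul_of_one_le_left (abs_nonneg _) (by linarith [Real.pi_gt_three])
  refine (pi_norm_le_iff_of_nonneg (abs_nonneg _)).2 fun j => ?_
  exact (hi j (Finset.mem_univ j)).trans h2

lemma coef_le_of_bound {f : Torus d → ℝ} {C : ℝ} (hC : ∀ x, |f x| ≤ C) (k : Fin d → ℤ) (b : Bool) :
    |coef f k b| ≤ C := by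
  have h : ∀ x, ‖f x * trig k (phase b) x‖ ≤ C := fun x => by
    rw [norm_mul, Real.norm_eq_abs, Real.norm_eq_abs]
    exact (mul_le_of_le_one_right (abs_nonneg _) (abs_trig_le _ _ _)).trans (hC x)
  simpa [coef] using norm_integral_le_of_norm_le_const (μ := leb d) (Eventually.of_forall h)

lemma sum_sq_coef_iterate {f : Torus d → ℝ} (hf : Smooth f) (k : Fin d → ℤ) (i : Fin d) (n : ℕ) :
    Smooth ((pderiv i)^[n] f) ∧ ∑ b : Bool, coef ((pderiv i)^[n] f) k b ^ 2
      = (freq k i ^ n) ^ 2 * ∑ b : Bool, coef f k b ^ 2 := by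
  induction n with
  | zero => simpa using hf
  | succ n ih =>
    rw [Function.iterate_succ_apply']
    refine ⟨ih.1.pderiv i, ?_⟩
    rw [sum_coef_sq_of_weak (integrable_of_continuous ih.1.continuous)
      (fun ψ hψ => integral_mul_pderiv ih.1 hψ i), ih.2]
    ring

/-- Differentiate `d + 1` times in the direction where `|k i|` is largest, so that only pure
derivatives occur. The factor `2` is a crude bound for the two phases together. -/
lemma coef_decay {f : Torus d → ℝ} (hf : Smooth f) {C : ℝ}
    (hC : ∀ i x, |(pderiv i)^[d + 1] f x| ≤ C) {k : Fin d → ℤ} (hk : k ≠ 0) (b : Bool) :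
    |coef f k b| ≤ 2 * C * (‖intVec k‖⁻¹) ^ (d + 1) := by
  obtain ⟨i, hi⟩ := exists_abs_eq_norm hk
  have hC0 : 0 ≤ C := (abs_nonneg _).trans (hC i 0)
  have h1 := (sum_sq_coef_iterate hf k i (d + 1)).2
  have h2 : ∑ b : Bool, coef ((pderiv i)^[d + 1] f) k b ^ 2 ≤ (2 * C) ^ 2 := by
    rw [Fintype.sum_bool]
    have := fun b => sq_le_sq' (neg_le_of_abs_le (coef_le_of_bound (hC i) k b))
      (le_of_abs_le (coef_le_of_bound (hC i) k b))
    nlinarith [this true, this false]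
  have hpos : 0 < ‖intVec k‖ := by
    rw [norm_pos_iff]
    intro h0
    exact hk (funext fun i => by simpa [intVec] using congrFun h0 i)
  rw [inv_pow, ← div_eq_mul_inv, le_div_iff₀ (by positivity)]
  refine abs_le_of_sq_le_sq' ?_ (by positivity) |>.2
  calc (|coef f k b| * ‖intVec k‖ ^ (d + 1)) ^ 2
      = (‖intVec k‖ ^ (d + 1)) ^ 2 * coef f k b ^ 2 := by rw [mul_pow, sq_abs]; ring
    _ ≤ (|freq k i| ^ (d + 1)) ^ 2 * ∑ b : Bool, coef f k b ^ 2 := by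
        gcongr
        exact Finset.single_le_sum (f := fun b => coef f k b ^ 2) (fun _ _ => sq_nonneg _)
          (Finset.mem_univ b)
    _ = ∑ b : Bool, coef ((pderiv i)^[d + 1] f) k b ^ 2 := by
        rw [h1, ← pow_mul, ← pow_mul, mul_comm (d + 1) 2, pow_mul, pow_mul, sq_abs]
    _ ≤ (2 * C) ^ 2 := h2

/-- The Fourier series of a smooth function converges uniformly, at a rate controlled by finitely
many derivatives. -/
lemma exists_trunc_rate (d : ℕ) : ∃ ε : ℕ → ℝ, Tendsto ε atTop (𝓝 0) ∧ (∀ N, 0 ≤ ε N) ∧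
    ∀ f : Torus d → ℝ, Smooth f → ∀ C : ℝ, (∀ i x, |(pderiv i)^[d + 1] f x| ≤ C) →
      ∀ N x, |f x - trunc N f x| ≤ C * ε N := by
  have hs := summable_norm_intVec_inv_pow (d := d)
  let a : (Fin d → ℤ) → ℝ := fun k => (‖intVec k‖⁻¹) ^ (d + 1)
  -- The rate is the tail of a convergent lattice sum and does not depend on `f`; the `4` is two
  -- phases times the `2` of `coef_decay`.
  refine ⟨fun N => 4 * ∑' k : {k // k ∉ box d N}, a k, ?_, fun N => ?_, ?_⟩
  · have := (tendsto_tsum_compl_atTop_zero a).comp (box_tendsto (d := d))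
    simpa using this.const_mul 4
  · exact mul_nonneg (by norm_num) (tsum_nonneg fun k => by positivity)
  intro f hf C hC N x
  have hfi := integrable_of_continuous hf.continuous
  have hterm : ∀ k : Fin d → ℤ, k ≠ 0 →
      ‖∑ b : Bool, coef f k b * trig k (phase b) x‖ ≤ C * (4 * a k) := by
    intro k hk
    refine (norm_sum_le _ _).trans ?_
    have h1 : ∀ b, ‖coef f k b * trig k (phase b) x‖ ≤ 2 * C * a k := fun b => by
      rw [norm_mul, Real.norm_eq_abs, Real.norm_eq_abs]
      exact (mul_le_of_le_one_right (abs_nonneg _) (abs_trig_le _ _ _)).trans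
        (coef_decay hf hC hk b)
    rw [Fintype.sum_bool]
    linarith [h1 true, h1 false]
  let g : C(Torus d, ℂ) := ⟨fun x => (f x : ℂ), Complex.continuous_ofReal.comp hf.continuous⟩
  have hsum : Summable (UnitAddTorus.mFourierCoeff g) := by
    refine Summable.of_norm_bounded_eventually (hs.mul_left (4 * C)) ?_
    have : ∀ᶠ k : Fin d → ℤ in cofinite, k ≠ 0 := by
      simp
    filter_upwards [this] with k hk
    have : UnitAddTorus.mFourierCoeff g k = _ := mFourierCoeff_ofReal hfi k
    rw [this]
    refine (norm_sub_le _ _).trans ?_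
    rw [norm_mul, Complex.norm_I, mul_one, Complex.norm_real, Complex.norm_real]
    have := coef_decay hf hC hk
    simp only [Real.norm_eq_abs]
    linarith [this true, this false]
  have h1 := UnitAddTorus.hasSum_mFourier_series_apply_of_summable hsum x
  have h2 : HasSum (fun k => ∑ b : Bool, coef f k b * trig k (phase b) x) (f x) := by
    have h3 := Complex.hasSum_re h1
    have h4 : ∀ k, (UnitAddTorus.mFourierCoeff g k • UnitAddTorus.mFourier k x).re
        = ∑ b : Bool, coef f k b * trig k (phase b) x := by
      intro k
      have : UnitAddTorus.mFourierCoeff g k = _ := mFourierCoeff_ofReal hfi k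
      rw [this]
      obtain ⟨y, rfl⟩ := proj_surjective x
      rw [mFourier_proj, Fintype.sum_bool, trig_proj, trig_proj, Complex.exp_ofReal_mul_I]
      simp only [phase, Bool.false_eq_true, if_false, if_true, add_zero, ← sub_eq_add_neg,
        Real.cos_sub_pi_div_two]
      generalize ∑ i, freq k i * y i = s
      simp [Complex.cos_ofReal_re, Complex.sin_ofReal_re]
      ring
    simp_rw [h4] at h3
    exact h3
  have h5 := h2.summable.sum_add_tsum_subtype_compl (box d N)
  rw [h2.tsum_eq] at h5
  have h6 : f x - trunc N f x
      = ∑' k : {k // k ∉ box d N}, ∑ b : Bool, coef f k b * trig k (phase b) x := by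
    rw [← h5, trunc]; simp
  rw [h6]
  dsimp only
  rw [← tsum_mul_left, ← tsum_mul_left]
  refine tsum_of_norm_bounded (((hs.subtype _).mul_left 4).mul_left C).hasSum fun k => hterm _ ?_
  rintro h0
  exact k.2 (h0 ▸ zero_mem_box)

end FourierSeries

/-! ### Weak convergence in Hilbert spaces -/

section Hilbert

open Filter Topology

variable {X Y : Type*} [NormedAddCommGroup X] [InnerProductSpace ℝ X]
  [NormedAddCommGroup Y] [InnerProductSpace ℝ Y] {ι : Type*} {l : Filter ι}

/-- The pointwise limit of the functionals is linear and bounded by `C`, so the Riesz representation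
theorem supplies `v`. -/
lemma exists_weak_limit [CompleteSpace X] [l.NeBot] {u : ι → X} {C : ℝ} (hC : ∀ᶠ n in l, ‖u n‖ ≤ C)
    (h : ∀ w, ∃ c : ℝ, Tendsto (fun n => ⟪u n, w⟫) l (𝓝 c)) :
    ∃ v : X, ∀ w, Tendsto (fun n => ⟪u n, w⟫) l (𝓝 ⟪v, w⟫) := by
  choose f hf using h
  let L : X →ₗ[ℝ] ℝ := linearMapOfTendsto f (fun n => (innerSL ℝ (u n) : X →ₗ[ℝ] ℝ))
    (tendsto_pi_nhds.2 fun w => hf w)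
  have hL : ∀ w, ‖L w‖ ≤ C * ‖w‖ := fun w => by
    refine le_of_tendsto (hf w).norm ?_
    filter_upwards [hC] with n hn
    exact (norm_inner_le_norm _ _).trans (by gcongr)
  refine ⟨(InnerProductSpace.toDual ℝ X).symm (L.mkContinuous C hL), fun w => ?_⟩
  rw [InnerProductSpace.toDual_symm_apply]
  exact hf w

/-- Along an ultrafilter every bounded real family converges, so no separability or extraction is
needed. -/
lemma exists_weak_limit_ultrafilter [CompleteSpace X] {U : Ultrafilter ι} {u : ι → X} {C : ℝ}
    (hC : ∀ᶠ n in (U : Filter ι), ‖u n‖ ≤ C) :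
    ∃ v : X, ∀ w, Tendsto (fun n => ⟪u n, w⟫) U (𝓝 ⟪v, w⟫) := by
  refine exists_weak_limit hC fun w => ?_
  have h : ((U.map fun n => ⟪u n, w⟫ : Ultrafilter ℝ) : Filter ℝ)
      ≤ 𝓟 (Metric.closedBall 0 (C * ‖w‖)) := by
    rw [le_principal_iff, Ultrafilter.coe_map, mem_map]
    filter_upwards [hC] with n hn
    rw [mem_preimage, mem_closedBall_zero_iff]
    exact (norm_inner_le_norm _ _).trans (by gcongr)
  obtain ⟨c, -, hc⟩ := (isCompact_closedBall (0 : ℝ) (C * ‖w‖)).ultrafilter_le_nhds _ h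
  exact ⟨c, hc⟩

/-- A bounded sequence whose pairings with a total set converge is weakly convergent. -/
lemma exists_weak_limit_of_total [CompleteSpace X] {u : ℕ → X} {C : ℝ} (hC : ∀ n, ‖u n‖ ≤ C) {S :
    Set X}
    (hS : (Submodule.span ℝ S)ᗮ = ⊥) (h : ∀ w ∈ S, ∃ c : ℝ, Tendsto (fun n => ⟪u n, w⟫) atTop (𝓝 c))
        :
    ∃ v : X, ∀ w, Tendsto (fun n => ⟪u n, w⟫) atTop (𝓝 ⟪v, w⟫) := by
  refine exists_weak_limit (Eventually.of_forall hC) fun w => ?_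
  have hw : w ∈ (Submodule.span ℝ S).topologicalClosure := by
    rw [Submodule.topologicalClosure_eq_top_iff.2 hS]; trivial
  have hspan : ∀ w ∈ Submodule.span ℝ S, ∃ c : ℝ, Tendsto (fun n => ⟪u n, w⟫) atTop (𝓝 c) := by
    intro w hw
    induction hw using Submodule.span_induction with
    | mem w hw => exact h w hw
    | zero => exact ⟨0, by simp⟩
    | add x y _ _ hx hy =>
      obtain ⟨a, ha⟩ := hx
      obtain ⟨b, hb⟩ := hy
      exact ⟨a + b, by simpa [inner_add_right] using ha.add hb⟩
    | smul r x _ hx =>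
      obtain ⟨a, ha⟩ := hx
      exact ⟨r * a, by simpa [inner_smul_right] using ha.const_mul r⟩
  have hC0 : 0 ≤ C := (norm_nonneg _).trans (hC 0)
  refine cauchySeq_tendsto_of_complete (Metric.cauchySeq_iff'.2 fun ε hε => ?_)
  -- Replacing `w` by `y` costs at most `ε / 4` at each of the two indices, leaving `ε / 2` for the
  -- pairings with `y`; `C + 1` allows for `C = 0`.
  obtain ⟨y, hy, hyw⟩ := Metric.mem_closure_iff.1 hw (ε / (4 * (C + 1))) (by positivity)
  obtain ⟨c, hc⟩ := hspan y hy
  obtain ⟨N, hN⟩ := Metric.cauchySeq_iff'.1 hc.cauchySeq (ε / 2) (by positivity)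
  refine ⟨N, fun n hn => ?_⟩
  have h1 := hN n hn
  have hb : ∀ n, |⟪u n, w - y⟫| ≤ ε / 4 := fun n => by
    refine (abs_real_inner_le_norm _ _).trans ?_
    rw [dist_eq_norm] at hyw
    calc ‖u n‖ * ‖w - y‖ ≤ (C + 1) * (ε / (4 * (C + 1))) := by
          gcongr
          linarith [hC n]
      _ = ε / 4 := by field_simp
  rw [Real.dist_eq] at h1 ⊢
  have h2 : ⟪u n, w⟫ - ⟪u N, w⟫ = (⟪u n, y⟫ - ⟪u N, y⟫) + ⟪u n, w - y⟫ - ⟪u N, w - y⟫ := by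
    simp only [inner_sub_right]; ring
  rw [h2]
  have := abs_lt.1 h1
  have h3 := abs_le.1 (hb n)
  have h4 := abs_le.1 (hb N)
  exact abs_lt.2 ⟨by linarith, by linarith⟩

/-- Split `g n = g₀ + (g n - g₀)`: the first part uses weak convergence, the second boundedness of
`u`. This handles the product `φ v` in the transport equation. -/
lemma weak_strong_tendsto {u : ι → X} {v : X} {C : ℝ} (hC : ∀ᶠ n in l, ‖u n‖ ≤ C)
    (hu : ∀ w, Tendsto (fun n => ⟪u n, w⟫) l (𝓝 ⟪v, w⟫)) {g : ι → X} {g₀ : X}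
    (hg : Tendsto g l (𝓝 g₀)) : Tendsto (fun n => ⟪u n, g n⟫) l (𝓝 ⟪v, g₀⟫) := by
  have h1 : Tendsto (fun n => ⟪u n, g n - g₀⟫) l (𝓝 0) := by
    have h2 : Tendsto (fun n => C * ‖g n - g₀‖) l (𝓝 0) := by
      simpa using (tendsto_iff_norm_sub_tendsto_zero.1 hg).const_mul C
    refine squeeze_zero_norm' ?_ h2
    filter_upwards [hC] with n hn
    exact (norm_inner_le_norm _ _).trans (by gcongr)
  have h3 := (hu g₀).add h1
  simp only [inner_sub_right, add_sub_cancel, add_zero] at h3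
  exact h3

lemma weak_tendsto_clm [CompleteSpace X] [CompleteSpace Y] {u : ι → X} {v : X}
    (hu : ∀ w, Tendsto (fun n => ⟪u n, w⟫) l (𝓝 ⟪v, w⟫)) (L : X →L[ℝ] Y) (w : Y) :
    Tendsto (fun n => ⟪L (u n), w⟫) l (𝓝 ⟪L v, w⟫) := by
  simpa [ContinuousLinearMap.adjoint_inner_right] using hu (L.adjoint w)

/-- The pattern of the lower semicontinuity results for quadratic quantities: such a quantity lies
above its tangent at the weak limit, and the tangent is affine, hence converges. -/
lemma ofReal_le_liminf {f g : ι → ℝ} {c : ℝ} [l.NeBot] (hg : Tendsto g l (𝓝 c)) (h : ∀ n, g n ≤ f n)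
    :
    ENNReal.ofReal c ≤ liminf (fun n => ENNReal.ofReal (f n)) l := by
  rw [← ((ENNReal.continuous_ofReal.tendsto c).comp hg).liminf_eq]
  exact liminf_le_liminf (Eventually.of_forall fun n => ENNReal.ofReal_le_ofReal (h n))

/-- Weak lower semicontinuity of the square of the norm. -/
lemma norm_sq_le_liminf [l.NeBot] {u : ι → X} {v : X}
    (hu : ∀ w, Tendsto (fun n => ⟪u n, w⟫) l (𝓝 ⟪v, w⟫)) :
    ENNReal.ofReal (‖v‖ ^ 2) ≤ liminf (fun n => ENNReal.ofReal (‖u n‖ ^ 2)) l := by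
  refine ofReal_le_liminf (g := fun n => 2 * ⟪u n, v⟫ - ‖v‖ ^ 2) ?_ fun n => ?_
  · have := ((hu v).const_mul 2).sub_const (‖v‖ ^ 2)
    rwa [real_inner_self_eq_norm_sq, show 2 * ‖v‖ ^ 2 - ‖v‖ ^ 2 = ‖v‖ ^ 2 by ring] at this
  · have := norm_sub_sq_real (u n) v
    nlinarith [sq_nonneg ‖u n - v‖]

/-- A countable product of compact intervals is compact and metrizable; this replaces the diagonal
argument. -/
lemma exists_subseq_of_bounded {J : Type*} [Countable J] (x : ℕ → J → ℝ) (C : J → ℝ)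
    (hx : ∀ n j, |x n j| ≤ C j) :
    ∃ σ : ℕ → ℕ, StrictMono σ ∧ ∀ j, ∃ c, Tendsto (fun n => x (σ n) j) atTop (𝓝 c) := by
  obtain ⟨a, -, σ, hσ, h⟩ := (isCompact_univ_pi fun j => isCompact_Icc (a := -C j) (b := C
      j)).tendsto_subseq
    (x := x) fun n j _ => abs_le.1 (hx n j)
  exact ⟨σ, hσ, fun j => ⟨a j, (tendsto_pi_nhds.1 h) j⟩⟩

end Hilbert

/-! ### Global solutions of ordinary differential equations -/

section ODE

open Filter Topology
open scoped NNReal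

variable {E : Type*} [NormedAddCommGroup E]

/-- As `F` is bounded by `L` everywhere, the Picard–Lindelöf theorem applies on every interval
`[-(n+1), n+1]` with a ball of radius `L (n + 1)`. Uniqueness glues the solutions: the value at `t`
is read off from the index `⌈|t|⌉₊`. -/
lemma exists_global_solution_of_lipschitz [NormedSpace ℝ E] [CompleteSpace E] {F : E → E} {K L :
    ℝ≥0}
    (hK : LipschitzWith K F) (hL : ∀ x, ‖F x‖ ≤ L) (x₀ : E) :
    ∃ X : ℝ → E, X 0 = x₀ ∧ ∀ t, HasDerivAt X (F (X t)) t := by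
  have h1 : ∀ n : ℕ, ∃ X : ℝ → E, X 0 = x₀ ∧
      ∀ t ∈ Ioo (-(n + 1 : ℝ)) (n + 1), HasDerivAt X (F (X t)) t := by
    intro n
    have h0 : (0 : ℝ) ∈ Icc (-(n + 1 : ℝ)) (n + 1) := ⟨by linarith [n.cast_nonneg (α := ℝ)], by
        positivity⟩
    have hp : IsPicardLindelof (fun _ => F) (⟨0, h0⟩ : Icc (-(n + 1 : ℝ)) (n + 1)) x₀
        (L * (n + 1)) 0 L K :=
      .of_time_independent (fun x _ => hL x) hK.lipschitzOnWith (by simp)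
    obtain ⟨X, hX0, hX⟩ := hp.exists_eq_forall_mem_Icc_hasDerivWithinAt₀
    exact ⟨X, hX0, fun t ht => (hX t (Ioo_subset_Icc_self ht)).hasDerivAt (Icc_mem_nhds ht.1 ht.2)⟩
  choose X hX0 hX using h1
  have h2 : ∀ n m : ℕ, n ≤ m → EqOn (X n) (X m) (Ioo (-(n + 1 : ℝ)) (n + 1)) := by
    intro n m hnm
    have hnm' : (n : ℝ) ≤ m := by exact_mod_cast hnm
    exact ODE_solution_unique_of_mem_Ioo (v := fun _ => F) (s := fun _ => univ) (K := K) (t₀ := 0)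
      (fun _ _ => hK.lipschitzOnWith) ⟨by linarith [n.cast_nonneg (α := ℝ)], by positivity⟩
      (fun t ht => ⟨hX n t ht, mem_univ _⟩)
      (fun t ht => ⟨hX m t ⟨by linarith [ht.1], by linarith [ht.2]⟩, mem_univ _⟩)
      ((hX0 n).trans (hX0 m).symm)
  have h3 : ∀ (n : ℕ) (t : ℝ), t ∈ Ioo (-(n + 1 : ℝ)) (n + 1) → X ⌈|t|⌉₊ t = X n t := by
    intro n t ht
    have ht' : t ∈ Ioo (-((⌈|t|⌉₊ : ℕ) + 1 : ℝ)) ((⌈|t|⌉₊ : ℕ) + 1) := by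
      have := abs_le.1 (Nat.le_ceil |t|)
      exact ⟨by linarith, by linarith⟩
    rcases le_total ⌈|t|⌉₊ n with h | h
    · exact h2 _ _ h ht'
    · exact (h2 _ _ h ht).symm
  refine ⟨fun t => X ⌈|t|⌉₊ t, by simpa using hX0 0, fun t => ?_⟩
  have ht : t ∈ Ioo (-((⌈|t|⌉₊ : ℕ) + 1 : ℝ)) ((⌈|t|⌉₊ : ℕ) + 1) := by
    have := abs_le.1 (Nat.le_ceil |t|)
    exact ⟨by linarith, by linarith⟩
  refine (hX _ t ht).congr_of_eventuallyEq ?_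
  filter_upwards [isOpen_Ioo.mem_nhds ht] with s hs
  exact h3 _ s hs

/-- An autonomous ODE whose vector field never points outwards has global forward solutions. -/
lemma exists_global_solution [InnerProductSpace ℝ E] [FiniteDimensional ℝ E] {F : E → E}
    (hF : ContDiff ℝ 1 F) (hin : ∀ x, ⟪x, F x⟫ ≤ 0) (x₀ : E) :
    ∃ X : ℝ → E, Continuous X ∧ X 0 = x₀ ∧ ∀ t, 0 ≤ t → HasDerivAt X (F (X t)) t := by
  -- The cutoff makes the field globally bounded and Lipschitz without changing it on a ball that
  -- contains the forward orbit.
  let χ : ContDiffBump (0 : E) := ⟨‖x₀‖ + 1, ‖x₀‖ + 2, by positivity, by linarith⟩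
  let G : E → E := fun x => χ x • F x
  have hG : ContDiff ℝ 1 G := χ.contDiff.smul hF
  have hGc : HasCompactSupport G := χ.hasCompactSupport.smul_right
  obtain ⟨K, hK⟩ := ContDiff.lipschitzWith_of_hasCompactSupport hGc hG (by simp)
  obtain ⟨L, hL⟩ := hGc.exists_bound_of_continuous hG.continuous
  obtain ⟨X, hX0, hX⟩ := exists_global_solution_of_lipschitz (L := L.toNNReal) hK
    (fun x => (hL x).trans (Real.le_coe_toNNReal L)) x₀
  have hcont : Continuous X := continuous_iff_continuousAt.2 fun t => (hX t).continuousAt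
  refine ⟨X, hcont, hX0, fun t ht => ?_⟩
  -- Since `χ ≥ 0`, the cut-off field does not point outwards either. For `t ≥ 0` the orbit
  -- therefore stays where `χ = 1`; at negative times the curve need not solve the original
  -- equation.
  have hanti : Antitone fun s => ‖X s‖ ^ 2 := by
    refine antitone_of_hasDerivAt_nonpos (f' := fun s => 2 * ⟪X s, G (X s)⟫)
      (fun s => (hX s).norm_sq) fun s => ?_
    have : ⟪X s, G (X s)⟫ = χ (X s) * ⟪X s, F (X s)⟫ := inner_smul_right _ _ _
    change 2 * ⟪X s, G (X s)⟫ ≤ 0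
    rw [this]
    have h1 := mul_nonpos_of_nonneg_of_nonpos (χ.nonneg (x := X s)) (hin (X s))
    linarith
  have hle : ‖X t‖ ≤ ‖x₀‖ := by
    have := hanti ht
    simp only [hX0] at this
    exact (sq_le_sq₀ (norm_nonneg _) (norm_nonneg _)).1 this
  have h1 : χ (X t) = 1 := χ.one_of_mem_closedBall (by
    rw [mem_closedBall_zero_iff]; exact hle.trans (by simp [χ]))
  have := hX t
  simp only [G, h1, one_smul] at this
  exact this

end ODE

/-! ### `L²` spaces, the constraint space of solenoidal jets, quadratic forms -/

section LTwo

open Filter Topology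

variable {d m : ℕ} {F : Type*} [NormedAddCommGroup F] [InnerProductSpace ℝ F]
  [SecondCountableTopology F]

/-- The class in `L²` of a continuous function. -/
def toL2 : C(Torus d, F) →L[ℝ] Lp F 2 (leb d) := ContinuousMap.toLp 2 (leb d) ℝ

lemma coeFn_toL2 (f : C(Torus d, F)) : (toL2 f : Torus d → F) =ᵐ[leb d] f :=
  ContinuousMap.coeFn_toLp (𝕜 := ℝ) (leb d) f

lemma inner_toL2 (u : Lp F 2 (leb d)) (f : C(Torus d, F)) :
    ⟪u, toL2 f⟫ = ∫ x, ⟪u x, f x⟫ ∂(leb d) := by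
  rw [L2.inner_def]
  refine integral_congr_ae ?_
  filter_upwards [coeFn_toL2 f] with x hx
  rw [hx]

lemma inner_toL2_toL2 (f g : C(Torus d, F)) :
    ⟪toL2 f, toL2 g⟫ = ∫ x, ⟪f x, g x⟫ ∂(leb d) := by
  rw [inner_toL2]
  refine integral_congr_ae ?_
  filter_upwards [coeFn_toL2 f] with x hx
  rw [hx]

lemma norm_sq_eq_integral {F : Type*} [NormedAddCommGroup F] [InnerProductSpace ℝ F]
    (u : Lp F 2 (leb d)) : ‖u‖ ^ 2 = ∫ x, ‖u x‖ ^ 2 ∂(leb d) := by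
  rw [← real_inner_self_eq_norm_sq, L2.inner_def]
  simp_rw [real_inner_self_eq_norm_sq]

lemma norm_toL2_sq (f : C(Torus d, F)) : ‖toL2 f‖ ^ 2 = ∫ x, ‖f x‖ ^ 2 ∂(leb d) := by
  rw [← real_inner_self_eq_norm_sq, inner_toL2_toL2]
  simp_rw [real_inner_self_eq_norm_sq]

lemma norm_toL2_le {f : C(Torus d, F)} {C : ℝ} (hC0 : 0 ≤ C) (hC : ∀ x, ‖f x‖ ≤ C) :
    ‖toL2 f‖ ≤ C := by
  refine abs_le_of_sq_le_sq' ?_ hC0 |>.2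
  rw [norm_toL2_sq]
  have h1 : ∀ x, ‖f x‖ ^ 2 ≤ C ^ 2 := fun x => by gcongr; exact hC x
  refine (integral_mono (integrable_of_continuous (by fun_prop)) (integrable_const _) h1).trans ?_
  simp

lemma inner_toL2_real (φ : L2 d) (f : C(Torus d, ℝ)) :
    ⟪φ, toL2 f⟫ = ∫ x, φ x * f x ∂(leb d) := by
  rw [inner_toL2]
  congr 1; funext x; simp [mul_comm]

/-- The vector field `ψ e_i`. -/
def singleC (i : Fin d) (ψ : C(Torus d, ℝ)) : C(Torus d, Vec d) :=
  ⟨fun x => EuclideanSpace.single i (ψ x), by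
    refine (PiLp.continuous_toLp 2 _).comp ((continuous_single i).comp ψ.continuous)⟩

lemma inner_singleC (u : L2Vec d) (i : Fin d) (ψ : C(Torus d, ℝ)) :
    ⟪u, toL2 (singleC i ψ)⟫ = ∫ x, u x i * ψ x ∂(leb d) := by
  rw [inner_toL2]
  congr 1; funext x
  change ⟪u x, EuclideanSpace.single i (ψ x)⟫ = _
  simp [EuclideanSpace.inner_single_right, mul_comm]

lemma memLp_coord {v : Torus d → Vec d} (hv : MemLp v 2 (leb d)) (i : Fin d) :
    MemLp (fun x => v x i) 2 (leb d) := hv.eval_piLp i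

lemma integral_norm_sq_eq_sum {v : Torus d → Vec d} (hv : MemLp v 2 (leb d)) :
    ∫ x, ‖v x‖ ^ 2 ∂(leb d) = ∑ i, ∫ x, v x i ^ 2 ∂(leb d) := by
  rw [← integral_finsetSum _ fun i _ => (memLp_coord hv i).integrable_sq]
  congr 1; funext x
  rw [EuclideanSpace.norm_sq_eq]
  simp

lemma integral_vec_apply {v : Torus d → Vec d} (hv : Integrable v (leb d)) (i : Fin d) :
    (∫ x, v x ∂(leb d)) i = ∫ x, v x i ∂(leb d) :=
  ((EuclideanSpace.proj (𝕜 := ℝ) i).integral_comp_comm hv).symm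

/-- A smooth function as a continuous map. -/
def Smooth.toC {F : Type*} [NormedAddCommGroup F] [NormedSpace ℝ F] {f : Torus d → F}
    (hf : Smooth f) : C(Torus d, F) := ⟨f, hf.continuous⟩

@[simp] lemma Smooth.toC_apply {F : Type*} [NormedAddCommGroup F] [NormedSpace ℝ F]
    {f : Torus d → F} (hf : Smooth f) (x : Torus d) : hf.toC x = f x := rfl

lemma hasWeakGrad_iff {φ : L2 d} {B : L2Vec d} : HasWeakGrad φ B ↔
    ∀ (ψ : Torus d → ℝ) (hψ : Smooth ψ) (i : Fin d),
      ⟪φ, toL2 (hψ.pderiv i).toC⟫ = - ⟪B, toL2 (singleC i hψ.toC)⟫ := by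
  refine forall_congr' fun ψ => forall_congr' fun hψ => forall_congr' fun i => ?_
  rw [inner_toL2_real, inner_singleC]
  rfl

/-- Quantitative Rellich inequality in `L²`. -/
lemma HasWeakGrad.norm_sq_le {φ : L2 d} {B : L2Vec d} (h : HasWeakGrad φ B) (N : ℕ) :
    ‖φ‖ ^ 2 ≤ (∑ k ∈ box d N, ∑ b : Bool, coef φ k b ^ 2) + ((N : ℝ) + 1)⁻¹ ^ 2 * ‖B‖ ^ 2 := by
  rw [norm_sq_eq_integral, norm_sq_eq_integral, integral_norm_sq_eq_sum (Lp.memLp B)]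
  simp_rw [Real.norm_eq_abs, sq_abs]
  exact integral_sq_le_box (Lp.memLp φ) (fun i => memLp_coord (Lp.memLp B) i)
    (fun i ψ hψ => h ψ hψ i) N

/-- The trigonometric vector fields are total in `L²`. -/
lemma span_trig_orthogonal :
    (Submodule.span ℝ {w : L2Vec d | ∃ i k b,
      w = toL2 (singleC i (smooth_trig k (phase b)).toC)})ᗮ = ⊥ := by
  refine (Submodule.eq_bot_iff _).2 fun u hu => ?_
  have h1 : ∀ i k b, coef (fun x => u x i) k b = 0 := fun i k b => by
    have := (Submodule.mem_orthogonal' _ _).1 hu _ (Submodule.subset_span ⟨i, k, b, rfl⟩)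
    rw [inner_singleC] at this
    exact this
  have h2 : ‖u‖ ^ 2 = 0 := by
    rw [norm_sq_eq_integral, integral_norm_sq_eq_sum (Lp.memLp u)]
    refine Finset.sum_eq_zero fun i _ => ?_
    have := parseval (memLp_coord (Lp.memLp u) i)
    simp only [h1] at this
    exact this.unique (by simp)
  exact norm_eq_zero.1 (pow_eq_zero_iff (by norm_num) |>.1 h2)

/-! ### The constraint space -/

/-- Pairs of a vector field and candidates for its derivatives of order `m`. -/
abbrev Jet (d m : ℕ) := PiLp 2 (fun _ : Option (Fin m → Fin d) => L2Vec d)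

/-- The closed space of solenoidal fields together with their weak derivatives of order `m`. -/
def solJet (d m : ℕ) : Submodule ℝ (Jet d m) where
  carrier := {h | (∀ (ψ : Torus d → ℝ) (hψ : Smooth ψ), ⟪h none, toL2 hψ.grad.toC⟫ = 0) ∧
    (∀ i, ⟪h none, toL2 (singleC i 1)⟫ = 0) ∧
    ∀ (α : Fin m → Fin d) (ψ : Torus d → ℝ) (hψ : Smooth ψ) (i : Fin d),
      ⟪h none, toL2 (singleC i (hψ.iterPDeriv α).toC)⟫
        = (-1) ^ m * ⟪h (some α), toL2 (singleC i hψ.toC)⟫}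
  add_mem' {a b} ha hb := by
    refine ⟨fun ψ hψ => ?_, fun i => ?_, fun α ψ hψ i => ?_⟩
    · simp only [PiLp.add_apply, inner_add_left, ha.1 ψ hψ, hb.1 ψ hψ, add_zero]
    · simp only [PiLp.add_apply, inner_add_left, ha.2.1 i, hb.2.1 i, add_zero]
    · simp only [PiLp.add_apply, inner_add_left, ha.2.2 α ψ hψ i, hb.2.2 α ψ hψ i, mul_add]
  zero_mem' := by
    refine ⟨fun ψ hψ => ?_, fun i => ?_, fun α ψ hψ i => ?_⟩ <;> simp
  smul_mem' c a ha := by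
    refine ⟨fun ψ hψ => ?_, fun i => ?_, fun α ψ hψ i => ?_⟩
    · simp only [PiLp.smul_apply, real_inner_smul_left, ha.1 ψ hψ, mul_zero]
    · simp only [PiLp.smul_apply, real_inner_smul_left, ha.2.1 i, mul_zero]
    · simp only [PiLp.smul_apply, real_inner_smul_left, ha.2.2 α ψ hψ i, mul_left_comm]

/-- Each condition equates pairings with fixed elements of `L²`, which are continuous in the jet. -/
lemma isClosed_solJet : IsClosed (solJet d m : Set (Jet d m)) := by
  have hc : ∀ (o : Option (Fin m → Fin d)) (w : L2Vec d),
      Continuous fun h : Jet d m => ⟪h o, w⟫ := fun o w =>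
    (PiLp.continuous_apply 2 _ o).inner continuous_const
  have : (solJet d m : Set (Jet d m)) =
      (⋂ (ψ : Torus d → ℝ) (hψ : Smooth ψ), {h | ⟪h none, toL2 hψ.grad.toC⟫ = 0}) ∩
      ((⋂ i, {h | ⟪h none, toL2 (singleC i 1)⟫ = 0}) ∩
      (⋂ (α : Fin m → Fin d) (ψ : Torus d → ℝ) (hψ : Smooth ψ) (i : Fin d),
        {h | ⟪h none, toL2 (singleC i (hψ.iterPDeriv α).toC)⟫
          = (-1) ^ m * ⟪h (some α), toL2 (singleC i hψ.toC)⟫})) := by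
    ext h
    simp only [mem_inter_iff, mem_iInter, mem_ofPred_eq]
    rfl
  rw [this]
  refine IsClosed.inter (isClosed_iInter fun ψ => isClosed_iInter fun hψ =>
      isClosed_eq (hc _ _) continuous_const) (IsClosed.inter (isClosed_iInter fun i =>
      isClosed_eq (hc _ _) continuous_const) (isClosed_iInter fun α => isClosed_iInter fun ψ =>
      isClosed_iInter fun hψ => isClosed_iInter fun i =>
      isClosed_eq (hc _ _) ((hc _ _).const_mul _)))

lemma integrable_smul_vec {f : Torus d → ℝ} {v : Torus d → Vec d} (hf : Continuous f)
    (hv : Integrable v (leb d)) : Integrable (fun x => f x • v x) (leb d) := by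
  obtain ⟨C, -, hC⟩ := exists_bound_of_continuous hf
  exact hv.bdd_smul C hf.aestronglyMeasurable (Eventually.of_forall hC)

lemma integral_smul_apply {f : Torus d → ℝ} {v : Torus d → Vec d} (hf : Continuous f)
    (hv : Integrable v (leb d)) (i : Fin d) :
    (∫ x, f x • v x ∂(leb d)) i = ∫ x, v x i * f x ∂(leb d) := by
  rw [integral_vec_apply (integrable_smul_vec hf hv)]
  congr 1; funext x; simp [mul_comm]

lemma integrable_L2Vec (u : L2Vec d) : Integrable u (leb d) :=
  (Lp.memLp u).integrable (by norm_num)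

/-- The bridge between scalar pairings, which behave well under weak limits, and the vector-valued
integrals in `IsSol` and `HasWeakDerivs`. -/
lemma mem_solJet_iff {h : Jet d m} :
    h ∈ solJet d m ↔ IsSol (h none) ∧ HasWeakDerivs m (h none) (fun α => h (some α)) := by
  have h1 : (∀ (ψ : Torus d → ℝ) (hψ : Smooth ψ), ⟪h none, toL2 hψ.grad.toC⟫ = 0) ↔
      ∀ ψ : Torus d → ℝ, Smooth ψ → ∫ x, ⟪h none x, grad ψ x⟫ ∂(leb d) = 0 :=
    forall_congr' fun ψ => forall_congr' fun hψ => by rw [inner_toL2]; rfl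
  have h2 : (∀ i, ⟪h none, toL2 (singleC i 1)⟫ = 0) ↔ ∫ x, h none x ∂(leb d) = 0 := by
    constructor
    · intro H
      ext i
      rw [integral_vec_apply (integrable_L2Vec _)]
      have := H i
      rw [inner_singleC] at this
      simpa using this
    · intro H i
      rw [inner_singleC]
      simpa [H] using (integral_vec_apply (integrable_L2Vec (h none)) i).symm
  have h3 : (∀ (α : Fin m → Fin d) (ψ : Torus d → ℝ) (hψ : Smooth ψ) (i : Fin d),
      ⟪h none, toL2 (singleC i (hψ.iterPDeriv α).toC)⟫
        = (-1) ^ m * ⟪h (some α), toL2 (singleC i hψ.toC)⟫) ↔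
      HasWeakDerivs m (h none) (fun α => h (some α)) := by
    refine forall_congr' fun α => forall_congr' fun ψ => forall_congr' fun hψ => ?_
    rw [PiLp.ext_iff]
    refine forall_congr' fun i => ?_
    rw [inner_singleC, inner_singleC, PiLp.smul_apply,
      integral_smul_apply (hψ.iterPDeriv α).continuous (integrable_L2Vec _),
      integral_smul_apply hψ.continuous (integrable_L2Vec _)]
    rfl
  rw [IsSol, and_assoc, and_assoc, ← h1, ← h2, ← h3]
  exact ⟨fun H => ⟨Lp.memLp _, H⟩, fun H => H.2⟩

/-! ### Quadratic forms with continuous positive coefficients -/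

section Quadratic

variable {M : Torus d → Matrix (Fin d) (Fin d) ℝ}

lemma memLp_mulVec (hM : ∀ i j, Continuous fun x => M x i j) (B : L2Vec d) :
    MemLp (fun x => (WithLp.toLp 2 ((M x).mulVec (B x)) : Vec d)) 2 (leb d) := by
  refine MemLp.of_eval_piLp fun i => ?_
  have : (fun x => (M x).mulVec (B x) i) = fun x => ∑ j, M x i j * B x j := by
    funext x; rfl
  simp only [this]
  refine memLp_finsetSum _ fun j _ => ?_
  exact (memLp_coord (Lp.memLp B) j).mul (memLp_of_continuous (hM i j) ∞)

/-- Multiplication of a square-integrable field by a continuous matrix field. -/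
def mulMat (hM : ∀ i j, Continuous fun x => M x i j) (B : L2Vec d) : L2Vec d :=
  (memLp_mulVec hM B).toLp _

lemma inner_mulMat (hM : ∀ i j, Continuous fun x => M x i j) (A B : L2Vec d) :
    ⟪A, mulMat hM B⟫ = ∫ x, ∑ i, ∑ j, A x i * B x j * M x i j ∂(leb d) := by
  rw [L2.inner_def]
  refine integral_congr_ae ?_
  filter_upwards [(memLp_mulVec hM B).coeFn_toLp] with x hx
  rw [mulMat, hx, PiLp.inner_apply]
  refine Finset.sum_congr rfl fun i _ => ?_
  simp only [Matrix.mulVec, dotProduct, RCLike.inner_apply, conj_trivial, Finset.sum_mul]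
  exact Finset.sum_congr rfl fun j _ => by ring

/-- Expand `⟨A - B, M (A - B)⟩ ≥ 0` pointwise; symmetry of `M` merges the two cross terms. The left
side is the tangent at `B` of the quadratic form. -/
lemma quadratic_ge (hM : ∀ i j, Continuous fun x => M x i j) (hpos : ∀ x, (M x).PosSemidef)
    (A B : L2Vec d) :
    2 * ⟪A, mulMat hM B⟫ - ⟪B, mulMat hM B⟫ ≤ ⟪A, mulMat hM A⟫ := by
  have hint : ∀ A B : L2Vec d,
      Integrable (fun x => ∑ i, ∑ j, A x i * B x j * M x i j) (leb d) := fun A B => by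
    refine (L2.integrable_inner (𝕜 := ℝ) A (mulMat hM B)).congr ?_
    filter_upwards [(memLp_mulVec hM B).coeFn_toLp] with x hx
    rw [mulMat, hx, PiLp.inner_apply]
    refine Finset.sum_congr rfl fun i _ => ?_
    simp only [Matrix.mulVec, dotProduct, RCLike.inner_apply, conj_trivial, Finset.sum_mul]
    exact Finset.sum_congr rfl fun j _ => by ring
  rw [inner_mulMat, inner_mulMat, inner_mulMat, ← integral_const_mul,
    ← integral_sub ((hint A B).const_mul 2) (hint B B)]
  refine integral_mono (((hint A B).const_mul 2).sub (hint B B)) (hint A A) fun x => ?_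
  have h1 := (hpos x).dotProduct_mulVec_nonneg (fun i => A x i - B x i)
  simp only [Matrix.mulVec, dotProduct, star_trivial, Finset.mul_sum] at h1
  have h2 : ∑ i, ∑ j, B x i * A x j * M x i j = ∑ i, ∑ j, A x i * B x j * M x i j := by
    rw [Finset.sum_comm]
    refine Finset.sum_congr rfl fun i _ => Finset.sum_congr rfl fun j _ => ?_
    have : M x j i = M x i j := by simpa using (hpos x).1.apply i j
    rw [this]; ring
  have h3 : ∑ i, ∑ j, (A x i - B x i) * (M x i j * (A x j - B x j))
      = ∑ i, ∑ j, A x i * A x j * M x i j - ∑ i, ∑ j, A x i * B x j * M x i j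
        - ∑ i, ∑ j, B x i * A x j * M x i j + ∑ i, ∑ j, B x i * B x j * M x i j := by
    simp only [← Finset.sum_sub_distrib, ← Finset.sum_add_distrib]
    exact Finset.sum_congr rfl fun i _ => Finset.sum_congr rfl fun j _ => by ring
  rw [h3, h2] at h1
  simp only
  linarith

/-- Weak lower semicontinuity of a nonnegative quadratic form. -/
lemma quadratic_le_liminf (hM : ∀ i j, Continuous fun x => M x i j) (hpos : ∀ x, (M x).PosSemidef)
    {ι : Type*} {l : Filter ι} [l.NeBot] {A : ι → L2Vec d} {B : L2Vec d}
    (hA : ∀ w, Tendsto (fun n => ⟪A n, w⟫) l (𝓝 ⟪B, w⟫)) :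
    ENNReal.ofReal (∫ x, ∑ i, ∑ j, B x i * B x j * M x i j ∂(leb d))
      ≤ liminf (fun n => ENNReal.ofReal (∫ x, ∑ i, ∑ j, A n x i * A n x j * M x i j ∂(leb d))) l :=
          by
  simp_rw [← inner_mulMat hM]
  refine ofReal_le_liminf ?_ fun n => quadratic_ge hM hpos (A n) B
  have := ((hA (mulMat hM B)).const_mul 2).sub_const ⟪B, mulMat hM B⟫
  rwa [two_mul, add_sub_cancel_right] at this

end Quadratic

end LTwo

/-! ### The operator `(-Δ)^{-m} ℙ` on trigonometric polynomials -/

section Velocity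

open Filter Topology
open scoped Real

variable {d m : ℕ}

/-- A vector-valued trigonometric polynomial, with all phases shifted by `η`. -/
def vtrig (S : Finset (Fin d → ℤ)) (c : (Fin d → ℤ) → Bool → Vec d) (η : ℝ) (x : Torus d) : Vec d :=
  ∑ k ∈ S, ∑ b : Bool, trig k (phase b + η) x • c k b

lemma smooth_trig_smul (k : Fin d → ℤ) (θ : ℝ) (c : Vec d) : Smooth fun x => trig k θ x • c :=
  (smooth_trig k θ).smul (smooth_const c)

lemma smooth_vtrig (S : Finset (Fin d → ℤ)) (c : (Fin d → ℤ) → Bool → Vec d) (η : ℝ) :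
    Smooth (vtrig S c η) :=
  Smooth.sum fun k _ => Smooth.sum fun _ _ => smooth_trig_smul k _ _

/-- The common shift `η` is there to make the class closed under derivatives: each one multiplies
coefficients by a frequency and adds `π / 2` to the shift. -/
lemma pderiv_vtrig (S : Finset (Fin d → ℤ)) (c : (Fin d → ℤ) → Bool → Vec d) (η : ℝ) (i : Fin d) :
    pderiv i (vtrig S c η) = vtrig S (fun k b => freq k i • c k b) (η + π / 2) := by
  unfold vtrig
  rw [pderiv_sum fun k _ => Smooth.sum fun b _ => smooth_trig_smul k _ _]
  funext x
  refine Finset.sum_congr rfl fun k _ => ?_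
  rw [pderiv_sum fun b _ => smooth_trig_smul k _ _]
  refine Finset.sum_congr rfl fun b _ => ?_
  rw [pderiv_smul (smooth_trig k _) (smooth_const _), pderiv_const, pderiv_trig]
  simp only [smul_zero, zero_add, smul_smul, add_assoc]
  rw [mul_comm]

lemma iterPDeriv_vtrig (S : Finset (Fin d → ℤ)) (c : (Fin d → ℤ) → Bool → Vec d) (η : ℝ)
    (α : Fin m → Fin d) :
    iterPDeriv α (vtrig S c η)
      = vtrig S (fun k b => (∏ j, freq k (α j)) • c k b) (η + m * (π / 2)) := by
  induction m with
  | zero => simp [iterPDeriv_zero]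
  | succ m ih =>
    rw [← Fin.cons_self_tail α, iterPDeriv_cons, ih, pderiv_vtrig]
    congr 1
    · funext k b
      rw [smul_smul, Fin.prod_univ_succ]
      simp
    · push_cast; ring

lemma iterPDeriv_trig (k : Fin d → ℤ) (θ : ℝ) (α : Fin m → Fin d) :
    iterPDeriv α (trig k θ) = fun x => (∏ j, freq k (α j)) * trig k (θ + m * (π / 2)) x := by
  induction m with
  | zero => simp [iterPDeriv_zero]
  | succ m ih =>
    rw [← Fin.cons_self_tail α, iterPDeriv_cons, ih]
    have := pderiv_const_smul (smooth_trig k (θ + m * (π / 2))) (∏ j, freq k (Fin.tail α j)) (α 0)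
    simp only [smul_eq_mul] at this
    rw [this, pderiv_trig, Fin.prod_univ_succ]
    funext x
    simp only [Fin.cons_zero, Fin.cons_succ]
    rw [show θ + ((m + 1 : ℕ) : ℝ) * (π / 2) = θ + m * (π / 2) + π / 2 by push_cast; ring]
    ring

/-- The total shift is `n π`. The resulting sign cancels the `(-1) ^ m` of the definition of weak
derivatives. -/
lemma trig_add_nat_mul_pi (k : Fin d → ℤ) (θ : ℝ) (n : ℕ) (x : Torus d) :
    trig k (θ + n * (π / 2) + n * (π / 2)) x = (-1) ^ n * trig k θ x := by
  induction n with
  | zero => simp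
  | succ n ih =>
    rw [show θ + ((n + 1 : ℕ) : ℝ) * (π / 2) + ((n + 1 : ℕ) : ℝ) * (π / 2)
      = (θ + n * (π / 2) + n * (π / 2)) + π by push_cast; ring, trig_add_pi, ih]
    ring

lemma integral_iterPDeriv_trig {ψ : Torus d → ℝ} (hψ : Smooth ψ) (k : Fin d → ℤ) (θ : ℝ)
    (α : Fin m → Fin d) :
    ∫ x, iterPDeriv α ψ x * trig k θ x ∂(leb d)
      = (-1) ^ m * ((∏ j, freq k (α j)) * ∫ x, ψ x * trig k (θ + m * (π / 2)) x ∂(leb d)) := by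
  induction m generalizing θ with
  | zero => simp [iterPDeriv_zero]
  | succ m ih =>
    rw [← Fin.cons_self_tail α, iterPDeriv_cons]
    have h1 := integral_mul_pderiv (hψ.iterPDeriv (Fin.tail α)) (smooth_trig k θ) (α 0)
    rw [← neg_eq_iff_eq_neg] at h1
    rw [← h1, pderiv_trig]
    simp_rw [mul_left_comm _ (freq k (α 0))]
    rw [integral_const_mul, ih, Fin.prod_univ_succ]
    simp only [Fin.cons_zero, Fin.cons_succ]
    rw [show θ + ((m + 1 : ℕ) : ℝ) * (π / 2) = θ + π / 2 + m * (π / 2) by push_cast; ring]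
    ring

lemma hasWeakDerivs_vtrig (S : Finset (Fin d → ℤ)) (c : (Fin d → ℤ) → Bool → Vec d) (η : ℝ)
    {v : Torus d → Vec d} (hv : v =ᵐ[leb d] vtrig S c η) {w : (Fin m → Fin d) → L2Vec d}
    (hw : ∀ α, w α =ᵐ[leb d] iterPDeriv α (vtrig S c η)) : HasWeakDerivs m v w := by
  intro α ψ hψ
  have h1 : ∫ x, iterPDeriv α ψ x • v x ∂(leb d)
      = ∫ x, iterPDeriv α ψ x • vtrig S c η x ∂(leb d) := by
    refine integral_congr_ae ?_
    filter_upwards [hv] with x hx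
    rw [hx]
  have h2 : ∫ x, ψ x • w α x ∂(leb d)
      = ∫ x, ψ x • vtrig S (fun k b => (∏ j, freq k (α j)) • c k b) (η + m * (π / 2)) x ∂(leb d) :=
          by
    refine integral_congr_ae ?_
    filter_upwards [hw α] with x hx
    rw [hx, iterPDeriv_vtrig]
  have h3 : ∀ (f : Torus d → ℝ), Continuous f → ∀ (c : (Fin d → ℤ) → Bool → Vec d) (η : ℝ),
      ∫ x, f x • vtrig S c η x ∂(leb d)
        = ∑ k ∈ S, ∑ b : Bool, (∫ x, f x * trig k (phase b + η) x ∂(leb d)) • c k b := by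
    intro f hf c η
    simp only [vtrig, Finset.smul_sum, smul_smul]
    have hi : ∀ k b, Integrable (fun x => (f x * trig k (phase b + η) x) • c k b) (leb d) :=
      fun k b => integrable_of_continuous ((hf.mul (continuous_trig _ _)).smul continuous_const)
    rw [integral_finsetSum _ fun k _ => integrable_finsetSum _ fun b _ => hi k b]
    refine Finset.sum_congr rfl fun k _ => ?_
    rw [integral_finsetSum _ fun b _ => hi k b]
    exact Finset.sum_congr rfl fun b _ => integral_smul_const _ _
  rw [h1, h2, h3 _ (hψ.iterPDeriv α).continuous, h3 _ hψ.continuous, Finset.smul_sum]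
  refine Finset.sum_congr rfl fun k _ => ?_
  rw [Finset.smul_sum]
  refine Finset.sum_congr rfl fun b _ => ?_
  rw [integral_iterPDeriv_trig hψ, smul_smul, smul_smul, add_assoc]
  congr 1
  ring

/-- Test with the monomial already shifted by `m π / 2`: differentiating it shifts by as much again
and returns `trig k θ` up to sign. -/
lemma HasWeakDerivs.integral_trig {z : Torus d → Vec d} {w : (Fin m → Fin d) → L2Vec d}
    (h : HasWeakDerivs m z w) (α : Fin m → Fin d) (k : Fin d → ℤ) (θ : ℝ) :
    ∫ x, trig k (θ + m * (π / 2)) x • w α x ∂(leb d)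
      = (∏ j, freq k (α j)) • ∫ x, trig k θ x • z x ∂(leb d) := by
  have h1 := h α _ (smooth_trig k (θ + m * (π / 2)))
  rw [iterPDeriv_trig] at h1
  simp_rw [trig_add_nat_mul_pi, mul_left_comm _ ((-1 : ℝ) ^ m), mul_smul] at h1
  rw [integral_smul, integral_smul] at h1
  exact ((smul_right_injective _ (pow_ne_zero m (by norm_num : (-1 : ℝ) ≠ 0))) h1).symm

/-- The frequency vector as an element of Euclidean space. -/
def freqVec (k : Fin d → ℤ) : Vec d := WithLp.toLp 2 (freq k)

/-- The symbol of the operator `(-Δ)^{-m} ℙ` at the frequency `k`. -/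
def stokesSymbol (m : ℕ) (k : Fin d → ℤ) : Vec d →L[ℝ] Vec d :=
  if k = 0 then 0 else ((∑ i, freq k i ^ 2) ^ m)⁻¹ • (Submodule.span ℝ {freqVec k})ᗮ.starProjection

lemma inner_freqVec (k : Fin d → ℤ) (a : Vec d) : ⟪freqVec k, a⟫ = ∑ i, freq k i * a i := by
  simp [freqVec, PiLp.inner_apply, mul_comm]

lemma inner_freqVec_stokesSymbol (k : Fin d → ℤ) (a : Vec d) :
    ⟪freqVec k, stokesSymbol m k a⟫ = 0 := by
  unfold stokesSymbol
  split_ifs with hk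
  · simp
  · rw [_root_.smul_apply, inner_smul_right,
      (Submodule.mem_orthogonal_singleton_iff_inner_right).1 (Submodule.starProjection_apply_mem _
          a),
      mul_zero]

lemma stokesSymbol_zero (a : Vec d) : stokesSymbol m 0 a = 0 := by simp [stokesSymbol]

lemma sum_freq_sq_ne_zero {k : Fin d → ℤ} (hk : k ≠ 0) : ∑ i, freq k i ^ 2 ≠ 0 := by
  obtain ⟨i, hi⟩ := freq_ne_zero hk
  have h1 : 0 < freq k i ^ 2 := by positivity
  have h2 := Finset.single_le_sum (f := fun i => freq k i ^ 2) (fun _ _ => sq_nonneg _)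
    (Finset.mem_univ i)
  exact (h1.trans_le h2).ne'

/-- The projection is self-adjoint and fixes `z`, and the power of `|2πk|²` cancels its inverse. -/
lemma inner_stokesSymbol {k : Fin d → ℤ} (hk : k ≠ 0) (a z : Vec d) (hz : ⟪freqVec k, z⟫ = 0) :
    (∑ i, freq k i ^ 2) ^ m * ⟪stokesSymbol m k a, z⟫ = ⟪a, z⟫ := by
  rw [stokesSymbol, if_neg hk, _root_.smul_apply, real_inner_smul_left, ← mul_assoc,
    mul_inv_cancel₀ (pow_ne_zero _ (sum_freq_sq_ne_zero hk)), one_mul,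
    Submodule.inner_starProjection_left_eq_right]
  congr 1
  exact Submodule.starProjection_eq_self_iff.2
    (Submodule.mem_orthogonal_singleton_iff_inner_right.2 hz)

/-- The velocity `(-Δ)^{-m} ℙ q`, where `a` lists the Fourier coefficients of `q`. -/
def stokes (m M : ℕ) (a : (Fin d → ℤ) → Bool → Vec d) : Torus d → Vec d :=
  vtrig (box d M) (fun k b => stokesSymbol m k (a k b)) 0

lemma smooth_stokes (M : ℕ) (a : (Fin d → ℤ) → Bool → Vec d) : Smooth (stokes m M a) :=
  smooth_vtrig _ _ _

lemma div_stokes (M : ℕ) (a : (Fin d → ℤ) → Bool → Vec d) (x : Torus d) :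
    ∑ i, pderiv i (fun y => stokes m M a y i) x = 0 := by
  simp_rw [fun i => pderiv_coord (smooth_stokes (m := m) M a) i i, stokes, pderiv_vtrig, vtrig,
    WithLp.ofLp_sum, Finset.sum_apply]
  rw [Finset.sum_comm]
  refine Finset.sum_eq_zero fun k _ => ?_
  rw [Finset.sum_comm]
  refine Finset.sum_eq_zero fun b _ => ?_
  simp only [PiLp.smul_apply, smul_eq_mul]
  rw [← Finset.mul_sum, ← inner_freqVec, inner_freqVec_stokesSymbol, mul_zero]

/-- Only the zero frequency has a mean, and there the symbol was set to `0`. -/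
lemma integral_stokes (M : ℕ) (a : (Fin d → ℤ) → Bool → Vec d) :
    ∫ x, stokes m M a x ∂(leb d) = 0 := by
  unfold stokes vtrig
  have hi : ∀ k b, Integrable (fun x => trig k (phase b + 0) x • stokesSymbol m k (a k b)) (leb d)
      :=
    fun k b => integrable_of_continuous (smooth_trig_smul k _ _).continuous
  rw [integral_finsetSum _ fun k _ => integrable_finsetSum _ fun b _ => hi k b]
  refine Finset.sum_eq_zero fun k _ => ?_
  rw [integral_finsetSum _ fun b _ => hi k b]
  refine Finset.sum_eq_zero fun b _ => ?_
  rw [integral_smul_const, integral_trig]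
  split_ifs with hk
  · subst hk; simp [stokesSymbol_zero]
  · simp

lemma integral_inner_grad_of_div {v : Torus d → Vec d} (hv : Smooth v)
    (hdiv : ∀ x, ∑ i, pderiv i (fun y => v y i) x = 0) {ψ : Torus d → ℝ} (hψ : Smooth ψ) :
    ∫ x, ⟪v x, grad ψ x⟫ ∂(leb d) = 0 := by
  have h1 : ∀ x, ⟪v x, grad ψ x⟫ = ∑ i, v x i * pderiv i ψ x := fun x => by
    simp [PiLp.inner_apply, mul_comm]
  have h2 : ∀ i, Integrable (fun x => pderiv i (fun y => v y i) x * ψ x) (leb d) := fun i =>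
    integrable_of_continuous (((hv.coord i).pderiv i).mul hψ).continuous
  simp_rw [h1]
  rw [integral_finsetSum _ fun i _ =>
    integrable_of_continuous ((hv.coord i).mul (hψ.pderiv i)).continuous]
  simp_rw [fun i => integral_mul_pderiv (hv.coord i) hψ i]
  rw [Finset.sum_neg_distrib, ← integral_finsetSum _ fun i _ => h2 i]
  simp_rw [← Finset.sum_mul, hdiv]
  simp

lemma isSol_of_smooth {v : Torus d → Vec d} (hv : Smooth v)
    (hdiv : ∀ x, ∑ i, pderiv i (fun y => v y i) x = 0) (h0 : ∫ x, v x ∂(leb d) = 0) : IsSol v :=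
  ⟨memLp_of_continuous hv.continuous 2, fun _ hψ => integral_inner_grad_of_div hv hdiv hψ, h0⟩

lemma isSol_stokes (M : ℕ) (a : (Fin d → ℤ) → Bool → Vec d) : IsSol (stokes m M a) :=
  isSol_of_smooth (smooth_stokes M a) (div_stokes M a) (integral_stokes M a)

lemma IsSol.inner_freqVec_integral {z : Torus d → Vec d} (hz : IsSol z) (k : Fin d → ℤ) (θ : ℝ) :
    ⟪freqVec k, ∫ x, trig k θ x • z x ∂(leb d)⟫ = 0 := by
  have hzi : Integrable z (leb d) := hz.1.integrable (by norm_num)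
  rw [← integral_inner (𝕜 := ℝ) (integrable_smul_vec (continuous_trig k θ) hzi)]
  have h := hz.2.1 _ (smooth_trig k (θ - π / 2))
  rw [← h]
  congr 1; funext x
  simp only [PiLp.inner_apply, grad_apply, pderiv_trig, sub_add_cancel]
  refine Finset.sum_congr rfl fun i _ => ?_
  simp [freqVec]
  ring

/-- Multinomial expansion: summing over all multi-indices turns `|∇^m v|²` into the symbol of
`(-Δ)^m`. -/
lemma sum_prod_freq_sq (k : Fin d → ℤ) :
    ∑ α : Fin m → Fin d, (∏ j, freq k (α j)) ^ 2 = (∑ i, freq k i ^ 2) ^ m := by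
  rw [Fintype.sum_pow]
  exact Finset.sum_congr rfl fun α _ => (Finset.prod_pow _ _ _).symm

lemma integral_inner_vtrig {u : Torus d → Vec d} (hu : Integrable u (leb d))
    (S : Finset (Fin d → ℤ)) (c : (Fin d → ℤ) → Bool → Vec d) (η : ℝ) :
    ∫ x, ⟪vtrig S c η x, u x⟫ ∂(leb d)
      = ∑ k ∈ S, ∑ b : Bool, ⟪c k b, ∫ x, trig k (phase b + η) x • u x ∂(leb d)⟫ := by
  simp only [vtrig, sum_inner]
  have hi : ∀ k b, Integrable (fun x => ⟪trig k (phase b + η) x • c k b, u x⟫) (leb d) := by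
    intro k b
    simp_rw [real_inner_smul_left, ← real_inner_smul_right]
    exact (integrable_smul_vec (continuous_trig _ _) hu).const_inner _
  rw [integral_finsetSum _ fun k _ => integrable_finsetSum _ fun b _ => hi k b]
  refine Finset.sum_congr rfl fun k _ => ?_
  rw [integral_finsetSum _ fun b _ => hi k b]
  refine Finset.sum_congr rfl fun b _ => ?_
  rw [← integral_inner (𝕜 := ℝ) (integrable_smul_vec (continuous_trig _ _) hu)]
  simp_rw [real_inner_smul_left, ← real_inner_smul_right]

/-- Weak form of `(-Δ)^m v = ℙ q` for the velocity `v = stokes m M a`. -/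
lemma stokes_pairing (M : ℕ) (a : (Fin d → ℤ) → Bool → Vec d) {z : Torus d → Vec d} (hz : IsSol z)
    {w : (Fin m → Fin d) → L2Vec d} (hw : HasWeakDerivs m z w) :
    ∑ α, ∫ x, ⟪iterPDeriv α (stokes m M a) x, w α x⟫ ∂(leb d)
      = ∑ k ∈ box d M, ∑ b : Bool, ⟪a k b, ∫ x, trig k (phase b) x • z x ∂(leb d)⟫ := by
  simp_rw [stokes, iterPDeriv_vtrig, zero_add,
    fun α => integral_inner_vtrig (integrable_L2Vec (w α)), hw.integral_trig, real_inner_smul_left,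
    real_inner_smul_right]
  rw [Finset.sum_comm]
  refine Finset.sum_congr rfl fun k _ => ?_
  rw [Finset.sum_comm]
  refine Finset.sum_congr rfl fun b _ => ?_
  simp_rw [← mul_assoc, ← sq]
  rw [← Finset.sum_mul, sum_prod_freq_sq]
  -- At the zero frequency both sides vanish because `z` has zero mean; elsewhere the coefficient of
  -- `z` is orthogonal to the frequency because `z` is solenoidal.
  by_cases hk : k = 0
  · subst hk
    simp_rw [trig_zero]
    rw [integral_smul, hz.2.2]
    simp
  · exact inner_stokesSymbol hk _ _ (hz.inner_freqVec_integral k _)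

/-- The Fourier coefficients of a vector field. -/
def vcoef (q : Fin d → Torus d → ℝ) (k : Fin d → ℤ) (b : Bool) : Vec d :=
  WithLp.toLp 2 fun i => coef (q i) k b

/-- The box contains all frequencies of `q`, so its truncated Fourier sum is `q` itself and no error
term appears. -/
lemma stokes_pairing_vcoef {M : ℕ} {q : Fin d → Torus d → ℝ} (hq : ∀ i, q i ∈ trigSpace d M)
    {z : Torus d → Vec d} (hz : IsSol z) {w : (Fin m → Fin d) → L2Vec d}
    (hw : HasWeakDerivs m z w) :
    ∑ α, ∫ x, ⟪iterPDeriv α (stokes m M (vcoef q)) x, w α x⟫ ∂(leb d)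
      = ∑ i, ∫ x, q i x * z x i ∂(leb d) := by
  have hzi : Integrable z (leb d) := hz.1.integrable (by norm_num)
  rw [stokes_pairing M _ hz hw]
  have h1 : ∀ i, ∫ x, q i x * z x i ∂(leb d)
      = ∑ k ∈ box d M, ∑ b : Bool, coef (fun x => z x i) k b * coef (q i) k b := fun i => by
    rw [← integral_mul_trunc (hzi.eval_piLp i), trunc_of_mem (hq i)]
    congr 1; funext x; ring
  simp_rw [h1]
  symm
  rw [Finset.sum_comm]
  refine Finset.sum_congr rfl fun k _ => ?_
  rw [Finset.sum_comm]
  refine Finset.sum_congr rfl fun b _ => ?_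
  rw [PiLp.inner_apply]
  refine Finset.sum_congr rfl fun i _ => ?_
  rw [integral_smul_apply (continuous_trig _ _) hzi]
  simp [vcoef, coef]

/-! ### Poincaré inequality of higher order -/

lemma poincare_vec {f : Torus d → Vec d} (hf : Smooth f) (h0 : ∫ x, f x ∂(leb d) = 0) :
    ∫ x, ‖f x‖ ^ 2 ∂(leb d) ≤ ∑ i, ∫ x, ‖pderiv i f x‖ ^ 2 ∂(leb d) := by
  have hfi := integrable_of_continuous hf.continuous
  simp_rw [integral_norm_sq_eq_sum (memLp_of_continuous hf.continuous 2),
    fun i => integral_norm_sq_eq_sum (memLp_of_continuous (hf.pderiv i).continuous 2)]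
  rw [Finset.sum_comm]
  refine Finset.sum_le_sum fun j _ => ?_
  have := poincare (hf.coord j) (by rw [← integral_vec_apply hfi, h0]; rfl)
  simpa only [pderiv_coord hf] using this

lemma sum_fin_cons (g : (Fin (m + 1) → Fin d) → ℝ) :
    ∑ α, g α = ∑ i, ∑ α : Fin m → Fin d, g (Fin.cons i α : Fin (m + 1) → Fin d) := by
  rw [← Equiv.sum_comp (Fin.consEquiv (fun _ : Fin (m + 1) => Fin d)) g, Fintype.sum_prod_type]
  rfl

/-- Poincaré's inequality is iterated: the function has zero mean by hypothesis, its derivatives by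
periodicity. -/
lemma poincare_iter {f : Torus d → Vec d} (hf : Smooth f) (h0 : ∫ x, f x ∂(leb d) = 0) :
    ∫ x, ‖f x‖ ^ 2 ∂(leb d) ≤ ∑ α : Fin m → Fin d, ∫ x, ‖iterPDeriv α f x‖ ^ 2 ∂(leb d) := by
  induction m with
  | zero => simp [iterPDeriv_zero]
  | succ m ih =>
    refine ih.trans ?_
    rw [sum_fin_cons, Finset.sum_comm]
    refine Finset.sum_le_sum fun α _ => ?_
    have h : ∫ x, iterPDeriv α f x ∂(leb d) = 0 := by
      cases m with
      | zero => rwa [iterPDeriv_zero]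
      | succ m =>
        rw [← Fin.cons_self_tail α, iterPDeriv_cons]
        exact integral_pderiv (hf.iterPDeriv _) _
    refine (poincare_vec (hf.iterPDeriv α) h).trans (le_of_eq ?_)
    exact Finset.sum_congr rfl fun i _ => by rw [← iterPDeriv_cons]

end Velocity

/-! ### Transport by solenoidal fields and the force `-∇·(∇f ⊗ ∇f)` -/

section Stress

variable {d m : ℕ}

lemma integral_transport_eq_zero {v : Torus d → Vec d} (hv : Smooth v)
    (hdiv : ∀ x, ∑ i, pderiv i (fun y => v y i) x = 0) {g : Torus d → ℝ} (hg : Smooth g) :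
    ∫ x, ∑ j, v x j * pderiv j g x ∂(leb d) = 0 := by
  have h := integral_inner_grad_of_div hv hdiv hg
  simpa [PiLp.inner_apply, mul_comm] using h

/-- For divergence-free `v` the derivation `v·∇` integrates to zero; applied to `f g` this is
skew-adjointness. -/
lemma integral_transport_mul {v : Torus d → Vec d} (hv : Smooth v)
    (hdiv : ∀ x, ∑ i, pderiv i (fun y => v y i) x = 0) {f g : Torus d → ℝ} (hf : Smooth f)
    (hg : Smooth g) :
    ∫ x, (∑ j, v x j * pderiv j f x) * g x ∂(leb d)
      = - ∫ x, f x * ∑ j, v x j * pderiv j g x ∂(leb d) := by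
  have h := integral_transport_eq_zero hv hdiv (hf.mul hg)
  simp_rw [pderiv_mul hf hg, mul_add, Finset.sum_add_distrib] at h
  have hc : ∀ {f : Torus d → ℝ}, Smooth f → Smooth fun x => ∑ j, v x j * pderiv j f x :=
    fun hf => Smooth.sum fun j _ => (hv.coord j).mul (hf.pderiv j)
  have h1 : ∀ x, ∑ j, v x j * (f x * pderiv j g x) = f x * ∑ j, v x j * pderiv j g x := fun x => by
    rw [Finset.mul_sum]; exact Finset.sum_congr rfl fun j _ => by ring
  have h2 : ∀ x, ∑ j, v x j * (pderiv j f x * g x) = (∑ j, v x j * pderiv j f x) * g x := fun x =>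
      by
    rw [Finset.sum_mul]; exact Finset.sum_congr rfl fun j _ => by ring
  simp_rw [h1, h2] at h
  rw [integral_add (integrable_of_continuous (hf.mul (hc hg)).continuous)
    (integrable_of_continuous ((hc hf).mul hg).continuous)] at h
  linarith

/-- The force `-∇·(∇f ⊗ ∇f)`. -/
def force (f : Torus d → ℝ) (i : Fin d) (x : Torus d) : ℝ :=
  - ∑ j, pderiv j (fun y => pderiv i f y * pderiv j f y) x

lemma force_mem {N : ℕ} {f : Torus d → ℝ} (hf : f ∈ trigSpace d N) (i : Fin d) :
    force f i ∈ trigSpace d (N + N) := by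
  have : force f i = - ∑ j, pderiv j (pderiv i f * pderiv j f) := by
    funext x; simp [force]; rfl
  rw [this]
  exact neg_mem (sum_mem fun j _ => pderiv_mem (mul_mem_trigSpace (pderiv_mem hf i) (pderiv_mem hf
      j)) j)

lemma integral_force_mul {f ψ : Torus d → ℝ} (hf : Smooth f) (hψ : Smooth ψ) (i : Fin d) :
    ∫ x, force f i x * ψ x ∂(leb d)
      = ∫ x, ∑ j, pderiv i f x * pderiv j f x * pderiv j ψ x ∂(leb d) := by
  have hs : ∀ j, Smooth fun y => pderiv i f y * pderiv j f y := fun j =>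
    (hf.pderiv i).mul (hf.pderiv j)
  simp only [force, neg_mul, Finset.sum_mul]
  rw [integral_neg, integral_finsetSum _ fun j _ =>
      integrable_of_continuous (((hs j).pderiv j).mul hψ).continuous,
    integral_finsetSum _ fun j _ => integrable_of_continuous ((hs j).mul (hψ.pderiv j)).continuous,
    ← Finset.sum_neg_distrib]
  exact Finset.sum_congr rfl fun j _ => (integral_mul_pderiv (hs j) hψ j).symm

/-- The Laplacian on the torus. -/
def lap (f : Torus d → ℝ) (x : Torus d) : ℝ := ∑ i, pderiv i (pderiv i f) x

lemma lap_mem {N : ℕ} {f : Torus d → ℝ} (hf : f ∈ trigSpace d N) : lap f ∈ trigSpace d N := by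
  have : lap f = ∑ i, pderiv i (pderiv i f) := by funext x; simp [lap]
  rw [this]
  exact sum_mem fun i _ => pderiv_mem (pderiv_mem hf i) i

/-- The force is `-Δf ∇f - ½ ∇|∇f|²` by symmetry of second derivatives, and the gradient part is
orthogonal to solenoidal fields. -/
lemma integral_force_inner {N : ℕ} {f : Torus d → ℝ} (hf : f ∈ trigSpace d N)
    {v : Torus d → Vec d} (hv : Smooth v) (hdiv : ∀ x, ∑ i, pderiv i (fun y => v y i) x = 0) :
    ∑ i, ∫ x, force f i x * v x i ∂(leb d)
      = - ∫ x, lap f x * ∑ j, v x j * pderiv j f x ∂(leb d) := by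
  have hs := smooth_of_mem hf
  have hsq : Smooth fun x => ∑ j, pderiv j f x * pderiv j f x :=
    Smooth.sum fun j _ => (hs.pderiv j).mul (hs.pderiv j)
  have hforce : ∀ i, Smooth (force f i) := fun i => smooth_of_mem (force_mem hf i)
  have hg : Smooth fun x => ∑ j, v x j * pderiv j f x :=
    Smooth.sum fun j _ => (hv.coord j).mul (hs.pderiv j)
  have h0 := integral_transport_eq_zero hv hdiv hsq
  have h1 : ∀ x, ∑ i, force f i x * v x i
      = - (lap f x * ∑ j, v x j * pderiv j f x)
        - (1 / 2) * ∑ j, v x j * pderiv j (fun x => ∑ j, pderiv j f x * pderiv j f x) x := by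
    intro x
    have h2 : ∀ i, pderiv i (fun x => ∑ j, pderiv j f x * pderiv j f x) x
        = 2 * ∑ j, pderiv j f x * pderiv j (pderiv i f) x := fun i => by
      rw [pderiv_sum fun j _ => (hs.pderiv j).mul (hs.pderiv j), Finset.mul_sum]
      refine Finset.sum_congr rfl fun j _ => ?_
      rw [pderiv_mul (hs.pderiv j) (hs.pderiv j), pderiv_comm_of_mem hf i j]
      ring
    simp_rw [h2, force, lap, fun i j => pderiv_mul (hs.pderiv i) (hs.pderiv j)]
    rw [Finset.mul_sum, Finset.mul_sum, ← Finset.sum_neg_distrib, ← Finset.sum_sub_distrib]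
    refine Finset.sum_congr rfl fun i _ => ?_
    rw [Finset.sum_add_distrib]
    simp_rw [mul_comm (pderiv _ (pderiv i f) x)]
    rw [← Finset.mul_sum]
    ring
  rw [← integral_finsetSum _ fun i _ => integrable_of_continuous ((hforce i).mul (hv.coord
      i)).continuous]
  simp_rw [h1]
  rw [integral_sub, integral_const_mul, h0, integral_neg]
  · simp
  · exact integrable_of_continuous ((smooth_of_mem (lap_mem hf)).mul hg).neg.continuous
  · exact integrable_of_continuous ((Smooth.sum fun j _ =>
      (hv.coord j).mul (hsq.pderiv j)).const_smul (1 / 2 : ℝ)).continuous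

lemma integral_grad_mul_grad {f g : Torus d → ℝ} (hf : Smooth f) (hg : Smooth g) :
    ∑ i, ∫ x, pderiv i f x * pderiv i g x ∂(leb d) = - ∫ x, lap f x * g x ∂(leb d) := by
  simp only [lap, Finset.sum_mul]
  rw [integral_finsetSum _ fun i _ =>
    integrable_of_continuous (((hf.pderiv i).pderiv i).mul hg).continuous, ← Finset.sum_neg_distrib]
  exact Finset.sum_congr rfl fun i _ => integral_mul_pderiv (hf.pderiv i) hg i

/-- `((∇f ⊗ ∇f, r I + ∇z + ∇zᵀ))` for smooth `f` and `z`. -/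
lemma integral_shiftedSymGrad {f : Torus d → ℝ} (hf : Smooth f) {z : Torus d → Vec d}
    (hz : Smooth z) (r : ℝ) :
    ∫ x, ∑ i, ∑ j, pderiv i f x * pderiv j f x * shiftedSymGrad r z x i j ∂(leb d)
      = r * ∑ i, ∫ x, pderiv i f x ^ 2 ∂(leb d) + 2 * ∑ i, ∫ x, force f i x * z x i ∂(leb d) := by
  have hs : ∀ i, Smooth fun x => ∑ j, pderiv i f x * pderiv j f x * pderiv j (fun y => z y i) x :=
    fun i => Smooth.sum fun j _ => ((hf.pderiv i).mul (hf.pderiv j)).mul ((hz.coord i).pderiv j)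
  have h2 : ∀ i, Smooth fun x => pderiv i f x ^ 2 := fun i => by
    simpa [sq] using (hf.pderiv i).mul (hf.pderiv i)
  have h1 : ∀ x, ∑ i, ∑ j, pderiv i f x * pderiv j f x * shiftedSymGrad r z x i j
      = r * ∑ i, pderiv i f x ^ 2
        + 2 * ∑ i, ∑ j, pderiv i f x * pderiv j f x * pderiv j (fun y => z y i) x := by
    intro x
    have e1 : ∀ i j, pderiv i f x * pderiv j f x * shiftedSymGrad r z x i j
        = (if i = j then r * pderiv i f x ^ 2 else 0)
          + pderiv i f x * pderiv j f x * pderiv j (fun y => z y i) x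
          + pderiv j f x * pderiv i f x * pderiv i (fun y => z y j) x := by
      intro i j
      simp only [shiftedSymGrad, Matrix.add_apply, Matrix.smul_apply, Matrix.one_apply,
        Matrix.transpose_apply, jacobian, Matrix.of_apply, smul_eq_mul]
      split_ifs with h
      · subst h; ring
      · ring
    simp_rw [e1, Finset.sum_add_distrib]
    rw [Finset.sum_comm (f := fun i j => pderiv j f x * pderiv i f x * pderiv i (fun y => z y j) x)]
    simp only [Finset.sum_ite_eq, Finset.mem_univ, if_true, ← Finset.mul_sum]
    ring
  simp_rw [h1, fun i => integral_force_mul hf (hz.coord i) i]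
  rw [integral_add, integral_const_mul, integral_const_mul,
    integral_finsetSum _ fun i _ => integrable_of_continuous (h2 i).continuous,
    integral_finsetSum _ fun i _ => integrable_of_continuous (hs i).continuous]
  · exact integrable_of_continuous ((Smooth.sum fun i _ => h2 i).const_smul r).continuous
  · exact integrable_of_continuous ((Smooth.sum fun i _ => hs i).const_smul (2 : ℝ)).continuous

end Stress

/-! ### The Galerkin system, its energy identity and the pointwise dissipation inequality -/

section Galerkin

variable {d m N : ℕ}

/-- The state space of the Galerkin approximation. -/
abbrev GState (d N : ℕ) := EuclideanSpace ℝ (↥(box d N) × Bool)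

/-- Linear combinations with coefficients in the state space. -/
def lc {V : Type*} [NormedAddCommGroup V] [NormedSpace ℝ V] (e : ↥(box d N) × Bool → V) :
    GState d N →L[ℝ] V := ∑ ι, (EuclideanSpace.proj ι : GState d N →L[ℝ] ℝ).smulRight (e ι)

lemma lc_apply {V : Type*} [NormedAddCommGroup V] [NormedSpace ℝ V] (e : ↥(box d N) × Bool → V)
    (X : GState d N) : lc e X = ∑ ι, X ι • e ι := by
  simp [lc]

/-- The trigonometric basis functions. -/
def trigC (k : Fin d → ℤ) (b : Bool) : C(Torus d, ℝ) := (smooth_trig k (phase b)).toC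

/-- Their partial derivatives. -/
def dtrigC (i : Fin d) (k : Fin d → ℤ) (b : Bool) : C(Torus d, ℝ) :=
  ((smooth_trig k (phase b)).pderiv i).toC

/-- The function represented by a state. -/
def phiC : GState d N →L[ℝ] C(Torus d, ℝ) := lc fun ι => trigC ι.1 ι.2

/-- Its partial derivatives. -/
def gradC (i : Fin d) : GState d N →L[ℝ] C(Torus d, ℝ) := lc fun ι => dtrigC i ι.1 ι.2

lemma phiC_eq_sum (X : GState d N) :
    (phiC X : Torus d → ℝ) = ∑ ι, X ι • trig ι.1.1 (phase ι.2) := by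
  funext x
  simp [phiC, lc_apply, trigC]

lemma phiC_mem (X : GState d N) : (phiC X : Torus d → ℝ) ∈ trigSpace d N := by
  rw [phiC_eq_sum]
  exact sum_mem fun ι _ => Submodule.smul_mem _ _ (trig_mem ι.1.2 _)

lemma smooth_phiC (X : GState d N) : Smooth (phiC X : Torus d → ℝ) := smooth_of_mem (phiC_mem X)

lemma gradC_eq (X : GState d N) (i : Fin d) : (gradC i X : Torus d → ℝ) = pderiv i (phiC X) := by
  have h : (phiC X : Torus d → ℝ) = fun x => ∑ ι, X ι • trig ι.1.1 (phase ι.2) x := by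
    rw [phiC_eq_sum]; funext x; simp
  rw [h, pderiv_sum fun ι _ => (smooth_trig _ _).const_smul _]
  funext x
  simp only [gradC, lc_apply, ContinuousMap.coe_sum, Finset.sum_apply, ContinuousMap.coe_smul,
    Pi.smul_apply]
  refine Finset.sum_congr rfl fun ι _ => ?_
  rw [pderiv_const_smul (smooth_trig _ _)]
  rfl

/-- Integration over the torus. -/
def intC : C(Torus d, ℝ) →L[ℝ] ℝ := (innerSL ℝ (toL2 (1 : C(Torus d, ℝ)))).comp toL2

lemma intC_apply (f : C(Torus d, ℝ)) : intC f = ∫ x, f x ∂(leb d) := by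
  simp [intC, inner_toL2_toL2]

/-- Fourier coefficients of the force of a state. -/
def forceC (X : GState d N) (k : Fin d → ℤ) (b : Bool) : Vec d :=
  WithLp.toLp 2 fun i => intC (∑ j, gradC i X * gradC j X * dtrigC j k b)

/-- Integration by parts: `forceC` is written in weak form so that it is visibly a quadratic
polynomial in the state. -/
lemma forceC_eq (X : GState d N) : forceC X = vcoef (force (phiC X)) := by
  funext k b
  ext i
  simp only [forceC, vcoef, coef]
  rw [intC_apply, integral_force_mul (smooth_phiC X) (smooth_trig k (phase b))]
  simp only [ContinuousMap.coe_sum, Finset.sum_apply, ContinuousMap.coe_mul, Pi.mul_apply, gradC_eq]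
  rfl

/-- The velocity of a state. -/
def vel (m : ℕ) (X : GState d N) : Torus d → Vec d := stokes m (N + N) (forceC X)

/-- The components of the velocity of a state as continuous functions. -/
def velC (m : ℕ) (X : GState d N) (j : Fin d) : C(Torus d, ℝ) :=
  ∑ k ∈ box d (N + N), ∑ b : Bool, (stokesSymbol m k (forceC X k b)) j • trigC k b

lemma velC_apply (X : GState d N) (j : Fin d) (x : Torus d) : velC m X j x = vel m X x j := by
  simp only [velC, vel, stokes, vtrig, ContinuousMap.coe_sum, Finset.sum_apply, WithLp.ofLp_sum,
    ContinuousMap.coe_smul, Pi.smul_apply, PiLp.smul_apply, smul_eq_mul, add_zero, trigC,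
    Smooth.toC_apply]
  simp only [mul_comm]

/-- The transport term `v · ∇φ` of a state. -/
def transC (m : ℕ) (X : GState d N) : C(Torus d, ℝ) := ∑ j, velC m X j * gradC j X

lemma transC_apply (X : GState d N) (x : Torus d) :
    transC m X x = ∑ j, vel m X x j * pderiv j (phiC X) x := by
  simp [transC, velC_apply, gradC_eq]

/-- The vector field of the Galerkin system. -/
def galerkin (m : ℕ) (X : GState d N) : GState d N :=
  WithLp.toLp 2 fun ι => - intC (transC m X * trigC ι.1 ι.2)

lemma contDiff_forceC (k : Fin d → ℤ) (b : Bool) :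
    ContDiff ℝ 1 fun X : GState d N => forceC X k b := by
  unfold forceC
  fun_prop

lemma contDiff_velC (j : Fin d) : ContDiff ℝ 1 fun X : GState d N => velC m X j := by
  have h := fun k b => contDiff_forceC (d := d) (N := N) k b
  unfold velC
  fun_prop

/-- The field is cubic in the state, built from bounded linear maps and products in the Banach
algebra `C(Torus d, ℝ)`; this is the purpose of the versions with values in continuous maps. -/
lemma contDiff_galerkin : ContDiff ℝ 1 (galerkin m : GState d N → GState d N) := by
  have h := fun j => contDiff_velC (d := d) (N := N) (m := m) j
  unfold galerkin transC
  fun_prop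

lemma galerkin_apply (X : GState d N) (ι : ↥(box d N) × Bool) :
    galerkin m X ι = - coef (transC m X) ι.1 ι.2 := by
  simp [galerkin, intC_apply, coef, trigC]

lemma phiC_galerkin (X : GState d N) (x : Torus d) :
    phiC (galerkin m X) x = - trunc N (transC m X) x := by
  simp only [phiC, lc_apply, galerkin_apply, ContinuousMap.coe_sum, Finset.sum_apply,
    ContinuousMap.coe_smul, Pi.smul_apply, smul_eq_mul, neg_mul, Finset.sum_neg_distrib,
    Fintype.sum_prod_type, trunc]
  rw [Finset.sum_coe_sort (box d N) fun k => ∑ b : Bool, coef (transC m X) k b * trigC k b x]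
  rfl

lemma smooth_vel (m : ℕ) (X : GState d N) : Smooth (vel m X) := smooth_stokes _ _

lemma div_vel (X : GState d N) (x : Torus d) : ∑ i, pderiv i (fun y => vel m X y i) x = 0 :=
  div_stokes _ _ _

lemma integral_transC_mul (X : GState d N) {g : Torus d → ℝ} (hg : Smooth g) :
    ∫ x, transC m X x * g x ∂(leb d) = - ∫ x, phiC X x * ⟪vel m X x, grad g x⟫ ∂(leb d) := by
  simp_rw [transC_apply]
  rw [integral_transport_mul (smooth_vel m X) (div_vel X) (smooth_phiC X) hg]
  simp [PiLp.inner_apply, mul_comm]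

/-- Although the coordinates are redundant, the Euclidean pairing equals `-∫ (v·∇φ) φ`, which is
zero by skew-adjointness. This prevents blow-up. -/
lemma inner_galerkin (X : GState d N) : ⟪X, galerkin m X⟫ ≤ 0 := by
  have h1 : ⟪X, galerkin m X⟫ = - ∫ x, transC m X x * phiC X x ∂(leb d) := by
    simp only [PiLp.inner_apply, galerkin_apply, RCLike.inner_apply, conj_trivial, phiC, lc_apply,
      ContinuousMap.coe_sum, Finset.sum_apply, Finset.mul_sum, ContinuousMap.coe_smul,
          Pi.smul_apply,
      smul_eq_mul, neg_mul, Finset.sum_neg_distrib]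
    rw [integral_finsetSum _ fun ι _ => integrable_of_continuous (by fun_prop)]
    congr 1
    refine Finset.sum_congr rfl fun ι _ => ?_
    simp_rw [mul_left_comm _ (X ι)]
    rw [integral_const_mul, mul_comm]
    rfl
  have h2 := integral_transport_mul (smooth_vel m X) (div_vel X) (smooth_phiC X) (smooth_phiC X)
  simp_rw [← transC_apply] at h2
  simp_rw [mul_comm (phiC X _)] at h2
  rw [h1]
  linarith

lemma isSol_vel (X : GState d N) : IsSol (vel m X) := isSol_stokes _ _

/-- The dissipation rate of a state. -/
def rate (m : ℕ) (X : GState d N) : ℝ :=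
  ∑ α : Fin m → Fin d, ∫ x, ‖iterPDeriv α (vel m X) x‖ ^ 2 ∂(leb d)

lemma rate_nonneg (X : GState d N) : 0 ≤ rate m X :=
  Finset.sum_nonneg fun _ _ => integral_nonneg fun _ => by positivity

/-- The jet of the velocity of a state. -/
def jetU (m : ℕ) (X : GState d N) : Jet d m :=
  WithLp.toLp 2 fun o => match o with
    | none => toL2 (smooth_vel m X).toC
    | some α => toL2 ((smooth_vel m X).iterPDeriv α).toC

lemma jetU_none (X : GState d N) : jetU m X none = toL2 (smooth_vel m X).toC := rfl

lemma jetU_some (X : GState d N) (α : Fin m → Fin d) :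
    jetU m X (some α) = toL2 ((smooth_vel m X).iterPDeriv α).toC := rfl

lemma hasWeakDerivs_vel (X : GState d N) :
    HasWeakDerivs m (vel m X) fun α => jetU m X (some α) :=
  hasWeakDerivs_vtrig _ _ _ Filter.EventuallyEq.rfl fun α => by
    rw [jetU_some]; exact coeFn_toL2 _

lemma rate_eq_sum_norm (X : GState d N) : rate m X = ∑ α, ‖jetU m X (some α)‖ ^ 2 := by
  simp only [rate, jetU_some, norm_toL2_sq]
  rfl

lemma norm_jetU_none_sq_le (X : GState d N) : ‖jetU m X none‖ ^ 2 ≤ rate m X := by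
  rw [jetU_none, norm_toL2_sq]
  exact poincare_iter (smooth_vel m X) (integral_stokes _ _)

/-- One `rate` for the derivatives of order `m`, and one for the velocity itself through Poincaré's
inequality. -/
lemma norm_jetU_sq_le (X : GState d N) : ‖jetU m X‖ ^ 2 ≤ 2 * rate m X := by
  rw [PiLp.norm_sq_eq_of_L2, Fintype.sum_option, ← rate_eq_sum_norm]
  linarith [norm_jetU_none_sq_le (m := m) X]

lemma jetU_mem (X : GState d N) : jetU m X ∈ solJet d m := by
  have hae : (jetU m X none : Torus d → Vec d) =ᵐ[leb d] vel m X := coeFn_toL2 _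
  refine mem_solJet_iff.2 ⟨?_, hasWeakDerivs_vtrig _ _ _ hae fun α => ?_⟩
  · obtain ⟨h1, h2, h3⟩ := isSol_vel (m := m) X
    refine ⟨Lp.memLp _, fun ψ hψ => ?_, ?_⟩
    · rw [← h2 ψ hψ]
      refine integral_congr_ae ?_
      filter_upwards [hae] with x hx
      rw [hx]
    · rw [← h3]
      exact integral_congr_ae hae
  · rw [jetU_some]; exact coeFn_toL2 _

/-- The gradient field of a state. -/
def bC : GState d N →L[ℝ] C(Torus d, Vec d) := lc fun ι => (smooth_trig ι.1.1 (phase ι.2)).grad.toC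

lemma bC_apply (X : GState d N) (x : Torus d) : bC X x = grad (phiC X) x := by
  ext i
  rw [grad_apply, ← gradC_eq]
  simp [bC, gradC, lc_apply, dtrigC]

lemma norm_bC_sq (X : GState d N) :
    ‖toL2 (bC X)‖ ^ 2 = ∑ i, ∫ x, pderiv i (phiC X) x ^ 2 ∂(leb d) := by
  rw [norm_toL2_sq, integral_norm_sq_eq_sum (memLp_of_continuous (bC X).continuous 2)]
  simp only [bC_apply, grad_apply]

lemma hasWeakGrad_state (X : GState d N) : HasWeakGrad (toL2 (phiC X)) (toL2 (bC X)) := by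
  intro ψ hψ i
  have h1 : ∫ x, toL2 (phiC X) x * pderiv i ψ x ∂(leb d) = ∫ x, phiC X x * pderiv i ψ x ∂(leb d) :=
      by
    refine integral_congr_ae ?_
    filter_upwards [coeFn_toL2 (phiC X)] with x hx
    rw [hx]
  have h2 : ∫ x, toL2 (bC X) x i * ψ x ∂(leb d) = ∫ x, pderiv i (phiC X) x * ψ x ∂(leb d) := by
    refine integral_congr_ae ?_
    filter_upwards [coeFn_toL2 (bC X)] with x hx
    rw [hx, bC_apply, grad_apply]
  rw [h1, h2, integral_mul_pderiv (smooth_phiC X) hψ]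

/-- The weak velocity equation holds exactly, against every `z` in `Sol` with weak derivatives of
order `m`, and not only against trigonometric fields. -/
lemma sum_inner_jetU (X : GState d N) {z : Torus d → Vec d} (hz : IsSol z)
    {w : (Fin m → Fin d) → L2Vec d} (hw : HasWeakDerivs m z w) :
    ∑ α, ⟪jetU m X (some α), w α⟫ = ∑ i, ∫ x, force (phiC X) i x * z x i ∂(leb d) := by
  rw [← stokes_pairing_vcoef (fun i => force_mem (phiC_mem X) i) hz hw]
  refine Finset.sum_congr rfl fun α _ => ?_
  rw [jetU_some, real_inner_comm, inner_toL2, ← forceC_eq]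
  refine integral_congr_ae (Filter.Eventually.of_forall fun x => ?_)
  exact real_inner_comm _ _

lemma rate_eq_force (X : GState d N) :
    rate m X = ∑ i, ∫ x, force (phiC X) i x * vel m X x i ∂(leb d) := by
  rw [← sum_inner_jetU X (isSol_vel X) (hasWeakDerivs_vel X), rate_eq_sum_norm]
  simp_rw [real_inner_self_eq_norm_sq]

/-- The energy identity. -/
lemma inner_bC_galerkin (X : GState d N) :
    ⟪toL2 (bC X), toL2 (bC (galerkin m X))⟫ = - rate m X := by
  have h1 : ⟪toL2 (bC X), toL2 (bC (galerkin m X))⟫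
      = ∑ i, ∫ x, pderiv i (phiC X) x * pderiv i (phiC (galerkin m X)) x ∂(leb d) := by
    rw [inner_toL2_toL2, ← integral_finsetSum _ fun i _ => integrable_of_continuous
      (((smooth_phiC X).pderiv i).mul ((smooth_phiC (galerkin m X)).pderiv i)).continuous]
    congr 1; funext x
    simp only [bC_apply, PiLp.inner_apply, grad_apply, RCLike.inner_apply, conj_trivial, mul_comm]
  have hlap := (smooth_of_mem (lap_mem (phiC_mem X))).continuous
  rw [h1, integral_grad_mul_grad (smooth_phiC X) (smooth_phiC _), rate_eq_force,
    integral_force_inner (phiC_mem X) (smooth_vel m X) (div_vel X)]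
  simp_rw [phiC_galerkin, mul_neg, ← transC_apply]
  -- The truncation is moved onto the Laplacian of the state, which already lies in `trigSpace d N`
  -- and is unchanged.
  rw [integral_neg, integral_mul_trunc_comm (integrable_of_continuous hlap)
    (integrable_of_continuous (transC m X).continuous), trunc_of_mem (lap_mem (phiC_mem X))]

lemma tensorPairing_state (X : GState d N) (r : ℝ) {z : Torus d → Vec d} (hz : Smooth z) :
    tensorPairing (toL2 (bC X)) r z = r * ‖toL2 (bC X)‖ ^ 2
      + 2 * ∑ i, ∫ x, force (phiC X) i x * z x i ∂(leb d) := by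
  rw [norm_bC_sq, ← integral_shiftedSymGrad (smooth_phiC X) hz, tensorPairing]
  refine integral_congr_ae ?_
  filter_upwards [coeFn_toL2 (bC X)] with x hx
  simp only [hx, bC_apply, grad_apply]

lemma continuous_shiftedSymGrad {z : Torus d → Vec d} (hz : Smooth z) (r : ℝ) (i j : Fin d) :
    Continuous fun x => shiftedSymGrad r z x i j := by
  have h1 := ((hz.coord i).pderiv j).continuous
  have h2 := ((hz.coord j).pderiv i).continuous
  simp only [shiftedSymGrad, Matrix.add_apply, Matrix.smul_apply, Matrix.transpose_apply, jacobian,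
    Matrix.of_apply]
  fun_prop

lemma tensorPairing_nonneg (B : L2Vec d) {r : ℝ} {z : Torus d → Vec d}
    (hpos : ∀ x, (shiftedSymGrad r z x).PosSemidef) : 0 ≤ tensorPairing B r z := by
  refine integral_nonneg fun x => ?_
  have h1 := (hpos x).dotProduct_mulVec_nonneg (fun i => B x i)
  simp only [Matrix.mulVec, dotProduct, star_trivial, Finset.mul_sum] at h1
  refine h1.trans_eq (Finset.sum_congr rfl fun i _ => Finset.sum_congr rfl fun j _ => by ring)

lemma lintegral_enorm_sq {F : Type*} [NormedAddCommGroup F] [InnerProductSpace ℝ F]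
    (u : Lp F 2 (leb d)) : ∫⁻ x, ‖u x‖ₑ ^ 2 ∂(leb d) = ENNReal.ofReal (‖u‖ ^ 2) := by
  rw [norm_sq_eq_integral, ofReal_integral_eq_lintegral_ofReal]
  · congr 1; funext x
    rw [ENNReal.ofReal_pow (norm_nonneg _), ofReal_norm]
  · exact (Lp.memLp u).integrable_norm_pow (by norm_num)
  · exact Filter.Eventually.of_forall fun x => by positivity

lemma two_mul_K_le {v : Torus d → Vec d} {w : (Fin m → Fin d) → L2Vec d}
    (hw : HasWeakDerivs m v w) : 2 * K m v ≤ ENNReal.ofReal (∑ α, ‖w α‖ ^ 2) := by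
  have h : K m v ≤ 2⁻¹ * ∑ α : Fin m → Fin d, ∫⁻ x, ‖w α x‖ₑ ^ 2 ∂(leb d) := iInf₂_le w hw
  refine (mul_le_mul_right h 2).trans ?_
  rw [← mul_assoc, ENNReal.mul_inv_cancel (by norm_num) (by norm_num), one_mul,
    ENNReal.ofReal_sum_of_nonneg fun _ _ => by positivity]
  simp_rw [lintegral_enorm_sq]
  rfl

/-- `K` is an infimum, so lower bounds are proved for every candidate family and upper bounds by
exhibiting one. Uniqueness of weak derivatives is never needed, and `K = ∞` is covered. -/
lemma le_two_mul_K {v : Torus d → Vec d} {c : ℝ≥0∞}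
    (h : ∀ w : (Fin m → Fin d) → L2Vec d, HasWeakDerivs m v w →
      c ≤ ENNReal.ofReal (∑ α, ‖w α‖ ^ 2)) : c ≤ 2 * K m v := by
  rw [mul_comm, ← ENNReal.div_le_iff_le_mul (by simp) (by simp)]
  refine le_iInf₂ fun w hw => ?_
  rw [ENNReal.div_le_iff_le_mul (by simp) (by simp), mul_comm, ← mul_assoc,
    ENNReal.mul_inv_cancel (by norm_num) (by norm_num), one_mul]
  refine (h w hw).trans ?_
  rw [ENNReal.ofReal_sum_of_nonneg fun _ _ => by positivity]
  simp_rw [lintegral_enorm_sq]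
  rfl

/-- The pointwise inequality behind the dissipation inequality. -/
lemma rate_add_tensorPairing_le (X : GState d N) {r : ℝ} (hr : 0 ≤ r) {z : Torus d → Vec d}
    (hz : Smooth z) (hsol : IsSol z) (hpos : ∀ x, (shiftedSymGrad r z x).PosSemidef) :
    ENNReal.ofReal (rate m X) + ENNReal.ofReal (tensorPairing (toL2 (bC X)) r z)
      ≤ ENNReal.ofReal (2 * rate m X + r * ‖toL2 (bC X)‖ ^ 2) + 2 * K m z := by
  rw [← tsub_le_iff_left]
  refine le_two_mul_K fun w hw => ?_
  rw [tsub_le_iff_left, ← ENNReal.ofReal_add (rate_nonneg X) (tensorPairing_nonneg _ hpos),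
    ← ENNReal.ofReal_add (by have := rate_nonneg (m := m) X; positivity) (by positivity)]
  refine ENNReal.ofReal_le_ofReal ?_
  rw [tensorPairing_state X r hz, ← sum_inner_jetU X hsol hw]
  -- Young's inequality for the cross term; it spends one of the two copies of `rate m X` on the
  -- right of the claim.
  have : 2 * ∑ α, ⟪jetU m X (some α), w α⟫ ≤ rate m X + ∑ α, ‖w α‖ ^ 2 := by
    rw [rate_eq_sum_norm, ← Finset.sum_add_distrib, Finset.mul_sum]
    refine Finset.sum_le_sum fun α _ => ?_
    have h1 := norm_sub_sq_real (jetU m X (some α)) (w α)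
    nlinarith [sq_nonneg ‖jetU m X (some α) - w α‖]
  linarith

end Galerkin

/-! ### Time evolution of the approximations: energy balance, bounds, dissipation -/

section Dynamics

open Filter Topology

variable {d m N : ℕ}

lemma SmoothOn.coord {I : Set ℝ} {z : ℝ → Torus d → Vec d} (hz : SmoothOn I z) (i : Fin d) :
    SmoothOn I fun t x => z t x i :=
  (EuclideanSpace.proj (𝕜 := ℝ) i).contDiff.comp_contDiffOn hz

lemma SmoothOn.continuous {F : Type*} [NormedAddCommGroup F] [NormedSpace ℝ F]
    {f : ℝ → Torus d → F} (hf : SmoothOn univ f) : Continuous fun p : ℝ × Torus d => f p.1 p.2 := by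
  rw [← continuousOn_univ, ← univ_prod_univ]
  exact hf.continuousOn

/-- A jointly continuous function as a curve of continuous functions. -/
def curve {F : Type*} [TopologicalSpace F] (f : ℝ → Torus d → F)
    (hf : Continuous fun p : ℝ × Torus d => f p.1 p.2) (t : ℝ) : C(Torus d, F) :=
  ContinuousMap.curry ⟨fun p : ℝ × Torus d => f p.1 p.2, hf⟩ t

lemma continuous_curve {F : Type*} [TopologicalSpace F] (f : ℝ → Torus d → F)
    (hf : Continuous fun p : ℝ × Torus d => f p.1 p.2) : Continuous (curve f hf) :=
  (ContinuousMap.curry ⟨fun p : ℝ × Torus d => f p.1 p.2, hf⟩).continuous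

@[simp] lemma curve_apply {F : Type*} [TopologicalSpace F] (f : ℝ → Torus d → F)
    (hf : Continuous fun p : ℝ × Torus d => f p.1 p.2) (t : ℝ) (x : Torus d) :
    curve f hf t x = f t x := rfl

/-- `X` is a Galerkin approximation with initial datum `φ₀`. -/
structure IsGalerkin (m : ℕ) (φ₀ : L2 d) (X : ℝ → GState d N) : Prop where
  cont : Continuous X
  init : ∀ ι, X 0 ι = coef φ₀ ι.1 ι.2
  ode : ∀ t, 0 ≤ t → HasDerivAt X (galerkin m (X t)) t

lemma exists_isGalerkin (m N : ℕ) (φ₀ : L2 d) : ∃ X : ℝ → GState d N, IsGalerkin m φ₀ X := by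
  obtain ⟨X, h1, h2, h3⟩ := exists_global_solution (contDiff_galerkin (d := d) (N := N) (m := m))
    inner_galerkin (WithLp.toLp 2 fun ι => coef φ₀ ι.1 ι.2)
  exact ⟨X, h1, fun ι => by rw [h2], h3⟩

variable {φ₀ : L2 d} {X : ℝ → GState d N}

lemma IsGalerkin.phiC_zero (h : IsGalerkin m φ₀ X) : (phiC (X 0) : Torus d → ℝ) = trunc N φ₀ := by
  funext x
  simp only [phiC, lc_apply, h.init, ContinuousMap.coe_sum, Finset.sum_apply,
    ContinuousMap.coe_smul, Pi.smul_apply, smul_eq_mul, Fintype.sum_prod_type, trunc]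
  rw [Finset.sum_coe_sort (box d N) fun k => ∑ b : Bool, coef φ₀ k b * trigC k b x]
  rfl

lemma integrable_L2 (u : L2 d) : Integrable u (leb d) := (Lp.memLp u).integrable (by norm_num)

/-- Truncation commutes with weak derivatives and is a contraction of `L²`. -/
lemma IsGalerkin.norm_bC_zero_le (h : IsGalerkin m φ₀ X) {B₀ : L2Vec d} (hB : HasWeakGrad φ₀ B₀) :
    ‖toL2 (bC (X 0))‖ ^ 2 ≤ ‖B₀‖ ^ 2 := by
  rw [norm_bC_sq, h.phiC_zero, norm_sq_eq_integral, integral_norm_sq_eq_sum (Lp.memLp B₀)]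
  refine Finset.sum_le_sum fun i _ => ?_
  rw [pderiv_trunc N i (integrable_L2 φ₀) (g := fun x => B₀ x i) fun ψ hψ => hB ψ hψ i]
  exact integral_trunc_sq_le N (memLp_coord (Lp.memLp B₀) i)

lemma IsGalerkin.norm_phiC_zero_le (h : IsGalerkin m φ₀ X) : ‖toL2 (phiC (X 0))‖ ^ 2 ≤ ‖φ₀‖ ^ 2 :=
    by
  rw [norm_toL2_sq, norm_sq_eq_integral, h.phiC_zero]
  simp only [Real.norm_eq_abs, sq_abs]
  exact integral_trunc_sq_le N (Lp.memLp φ₀)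

/-- The energy of a state. -/
def energy (X : GState d N) : ℝ := ‖toL2 (bC X)‖ ^ 2

lemma IsGalerkin.hasDerivAt_energy (h : IsGalerkin m φ₀ X) {t : ℝ} (ht : 0 ≤ t) :
    HasDerivAt (fun s => energy (X s)) (-2 * rate m (X t)) t := by
  have h1 : HasDerivAt (fun s => toL2 (bC (X s))) (toL2 (bC (galerkin m (X t)))) t :=
    (toL2.comp bC).hasFDerivAt.comp_hasDerivAt t (h.ode t ht)
  have h2 := h1.norm_sq
  rw [inner_bC_galerkin] at h2
  refine h2.congr_deriv (by ring)

lemma IsGalerkin.antitoneOn_energy (h : IsGalerkin m φ₀ X) :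
    AntitoneOn (fun s => energy (X s)) (Ici 0) := by
  refine antitoneOn_of_deriv_nonpos (convex_Ici 0)
    (fun t ht => (h.hasDerivAt_energy ht).continuousAt.continuousWithinAt) (fun t ht => ?_)
    fun t ht => ?_
  · rw [interior_Ici] at ht
    exact (h.hasDerivAt_energy (le_of_lt ht)).differentiableAt.differentiableWithinAt
  · rw [interior_Ici] at ht
    rw [(h.hasDerivAt_energy (le_of_lt ht)).deriv]
    linarith [rate_nonneg (m := m) (X t)]

lemma IsGalerkin.energy_le (h : IsGalerkin m φ₀ X) {B₀ : L2Vec d} (hB : HasWeakGrad φ₀ B₀) {t : ℝ}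
    (ht : 0 ≤ t) : energy (X t) ≤ ‖B₀‖ ^ 2 :=
  (h.antitoneOn_energy self_mem_Ici ht ht).trans (h.norm_bC_zero_le hB)

/-- Self-adjointness transfers the truncation from the equation to the test function, where
smoothness makes it harmless. -/
lemma integral_phiC_galerkin (Y : GState d N) {g : Torus d → ℝ} (hg : Smooth g) :
    intC (phiC (galerkin m Y) * hg.toC)
      = ∫ x, phiC Y x * ⟪vel m Y x, grad (trunc N g) x⟫ ∂(leb d) := by
  rw [intC_apply]
  simp only [ContinuousMap.mul_apply, phiC_galerkin, neg_mul, Smooth.toC_apply]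
  rw [integral_neg, ← integral_mul_trunc_comm (integrable_of_continuous (transC m Y).continuous)
    (integrable_of_continuous hg.continuous), integral_transC_mul Y (smooth_trunc N g), neg_neg]

/-- Test the equation with the state itself, which truncation does not change: the `L²` norm is
conserved, and initially it is at most that of the datum. -/
lemma IsGalerkin.norm_phiC_le (h : IsGalerkin m φ₀ X) {t : ℝ} (ht : 0 ≤ t) :
    ‖toL2 (phiC (X t))‖ ≤ ‖φ₀‖ := by
  have h1 : ∀ s, 0 ≤ s → HasDerivAt (fun s => ‖toL2 (phiC (X s))‖ ^ 2) 0 s := fun s hs => by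
    have h1 : HasDerivAt (fun s => toL2 (phiC (X s))) (toL2 (phiC (galerkin m (X s)))) s :=
      (toL2.comp phiC).hasFDerivAt.comp_hasDerivAt s (h.ode s hs)
    refine h1.norm_sq.congr_deriv ?_
    have h2 : ⟪toL2 (phiC (X s)), toL2 (phiC (galerkin m (X s)))⟫
        = intC (phiC (galerkin m (X s)) * (smooth_phiC (X s)).toC) := by
      rw [inner_toL2_toL2, intC_apply]
      rfl
    rw [h2, integral_phiC_galerkin, trunc_of_mem (phiC_mem _)]
    have h3 := integral_transport_mul (smooth_vel m (X s)) (div_vel (X s)) (smooth_phiC (X s))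
      (smooth_phiC (X s))
    simp_rw [mul_comm (∑ j, _) (phiC (X s) _)] at h3
    simp only [PiLp.inner_apply, grad_apply, RCLike.inner_apply, conj_trivial]
    simp_rw [mul_comm (pderiv _ _ _)]
    linarith
  have h2 : AntitoneOn (fun s => ‖toL2 (phiC (X s))‖ ^ 2) (Ici 0) := by
    refine antitoneOn_of_deriv_nonpos (convex_Ici 0)
      (fun t ht => (h1 t ht).continuousAt.continuousWithinAt) (fun t ht => ?_) fun t ht => ?_
    · rw [interior_Ici] at ht
      exact (h1 t (le_of_lt ht)).differentiableAt.differentiableWithinAt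
    · rw [interior_Ici] at ht
      rw [(h1 t (le_of_lt ht)).deriv]
  have h3 := (h2 self_mem_Ici ht ht).trans h.norm_phiC_zero_le
  exact (sq_le_sq₀ (norm_nonneg _) (norm_nonneg _)).1 h3

lemma hasDerivAt_integral_smoothOn {ψ : ℝ → Torus d → ℝ} (hψ : SmoothOn univ ψ)
    (b : C(Torus d, ℝ)) (t : ℝ) :
    HasDerivAt (fun s => ∫ x, b x * ψ s x ∂(leb d))
      (∫ x, b x * _root_.deriv (fun s => ψ s x) t ∂(leb d)) t := by
  obtain ⟨h1, h2⟩ := hψ.deriv_time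
  have hc := h2.continuous
  obtain ⟨C, hC⟩ := ((isCompact_Icc (a := t - 1) (b := t + 1)).prod
    (isCompact_univ (X := Torus d))).exists_bound_of_continuousOn
    (f := fun p : ℝ × Torus d => b p.2 * _root_.deriv (fun s => ψ s p.2) p.1) (by fun_prop)
  refine (hasDerivAt_integral_of_dominated_loc_of_deriv_le (s := Icc (t - 1) (t + 1))
    (bound := fun _ => C) (F' := fun s x => b x * _root_.deriv (fun s => ψ s x) s)
    (Icc_mem_nhds (by linarith) (by linarith))
    (Eventually.of_forall fun s => ?_) ?_ ?_ (Eventually.of_forall fun x s hs => ?_)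
    (integrable_const C) (Eventually.of_forall fun x s _ => (h1 s x).const_mul (b x))).2
  · exact (b.continuous.mul (hψ.smooth (mem_univ s)).continuous).aestronglyMeasurable
  · exact integrable_of_continuous (b.continuous.mul (hψ.smooth (mem_univ t)).continuous)
  · exact (b.continuous.mul (h2.smooth (mem_univ t)).continuous).aestronglyMeasurable
  · exact hC (s, x) ⟨hs, mem_univ _⟩

/-- Time derivative of the pairing with a smooth test function. -/
lemma IsGalerkin.hasDerivAt_pairing (h : IsGalerkin m φ₀ X) {ψ : ℝ → Torus d → ℝ}
    (hψ : SmoothOn univ ψ) {t : ℝ} (ht : 0 ≤ t) :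
    HasDerivAt (fun s => intC (phiC (X s) * curve ψ hψ.continuous s))
      (intC (phiC (galerkin m (X t)) * curve ψ hψ.continuous t)
        + intC (phiC (X t) * curve (fun s x => _root_.deriv (fun u => ψ u x) s)
            hψ.deriv_time.2.continuous t)) t := by
  have h1 : ∀ (Y : GState d N) (g : C(Torus d, ℝ)),
      intC (phiC Y * g) = ∑ ι, Y ι * ∫ x, trigC ι.1 ι.2 x * g x ∂(leb d) := by
    intro Y g
    rw [intC_apply]
    simp only [phiC, lc_apply, ContinuousMap.mul_apply, ContinuousMap.coe_sum, Finset.sum_apply,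
      ContinuousMap.coe_smul, Pi.smul_apply, smul_eq_mul, Finset.sum_mul, mul_assoc]
    rw [integral_finsetSum _ fun ι _ => integrable_of_continuous (by fun_prop)]
    exact Finset.sum_congr rfl fun ι _ => integral_const_mul _ _
  simp_rw [h1]
  rw [← Finset.sum_add_distrib]
  refine HasDerivAt.fun_sum fun ι _ => ?_
  have h2 : HasDerivAt (fun s => X s ι) (galerkin m (X t) ι) t :=
    (EuclideanSpace.proj (𝕜 := ℝ) ι).hasFDerivAt.comp_hasDerivAt t (h.ode t ht)
  exact h2.mul (hasDerivAt_integral_smoothOn hψ (trigC ι.1 ι.2) t)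

lemma continuous_galerkin : Continuous (galerkin m : GState d N → GState d N) :=
  contDiff_galerkin.continuous

/-- Weak form of the transport equation for the Galerkin approximation. -/
lemma IsGalerkin.weak_form (h : IsGalerkin m φ₀ X) {ψ : ℝ → Torus d → ℝ}
    (hψ : SmoothOn univ ψ) {t : ℝ} (ht : 0 ≤ t) :
    ∫ s in (0 : ℝ)..t, (∫ x, phiC (X s) x * _root_.deriv (fun s => ψ s x) s ∂(leb d)
        + ∫ x, phiC (X s) x * ⟪vel m (X s) x, grad (trunc N (ψ s)) x⟫ ∂(leb d))
      = ∫ x, phiC (X t) x * ψ t x ∂(leb d) - ∫ x, phiC (X 0) x * ψ 0 x ∂(leb d) := by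
  have hc := h.cont
  have hg := (continuous_galerkin (m := m)).comp hc
  have h1 := continuous_curve _ hψ.continuous
  have h2 := continuous_curve (fun s x => _root_.deriv (fun u => ψ u x) s)
      hψ.deriv_time.2.continuous
  have h3 := intervalIntegral.integral_eq_sub_of_hasDerivAt (a := 0) (b := t)
    (fun s hs => h.hasDerivAt_pairing hψ (by rw [uIcc_of_le ht] at hs; exact hs.1))
    (Continuous.intervalIntegrable (by simp only [Function.comp_def] at hg; fun_prop) _ _)
  rw [intC_apply, intC_apply] at h3
  refine Eq.trans (intervalIntegral.integral_congr fun s _ => ?_) h3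
  have h4 := integral_phiC_galerkin (m := m) (X s) (hψ.smooth (mem_univ s))
  rw [← h4, add_comm, intC_apply, intC_apply, intC_apply]
  rfl

/-! ### Bounds on the velocity -/

lemma continuous_vtrig_curve {Z : Type*} [TopologicalSpace Z] (S : Finset (Fin d → ℤ))
    {c : Z → (Fin d → ℤ) → Bool → Vec d} (hc : ∀ k b, Continuous fun z => c z k b) (η : ℝ) :
    Continuous fun z => (smooth_vtrig S (c z) η).toC := by
  refine ContinuousMap.continuous_of_continuous_uncurry _ ?_
  change Continuous fun p : Z × Torus d => vtrig S (c p.1) η p.2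
  simp only [vtrig]
  refine continuous_finsetSum _ fun k _ => continuous_finsetSum _ fun b _ => ?_
  exact ((continuous_trig k (phase b + η)).comp continuous_snd).smul ((hc k b).comp continuous_fst)

lemma continuous_jetU : Continuous (jetU m : GState d N → Jet d m) := by
  have hf : ∀ k b, Continuous fun X : GState d N => stokesSymbol m k (forceC X k b) := fun k b =>
    (stokesSymbol m k).continuous.comp (contDiff_forceC k b).continuous
  refine (PiLp.continuous_toLp 2 _).comp (continuous_pi fun o => ?_)
  cases o with
  | none => exact toL2.continuous.comp (continuous_vtrig_curve _ hf 0)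
  | some α =>
    have h1 : ∀ X : GState d N, ((smooth_vel m X).iterPDeriv α).toC
        = (smooth_vtrig (box d (N + N)) (fun k b => (∏ j, freq k (α j)) •
          stokesSymbol m k (forceC X k b)) (0 + m * (Real.pi / 2))).toC := fun X => by
      ext x : 1
      simp only [Smooth.toC_apply]
      rw [vel, stokes, iterPDeriv_vtrig]
    simp_rw [h1]
    have h2 := continuous_vtrig_curve (box d (N + N)) (c := fun (X : GState d N) k b =>
      (∏ j, freq k (α j)) • stokesSymbol m k (forceC X k b)) (fun k b => by
        have := hf k b
        fun_prop)
      (0 + m * (Real.pi / 2))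
    exact toL2.continuous.comp h2

lemma continuous_rate : Continuous (rate m : GState d N → ℝ) := by
  have : (rate m : GState d N → ℝ) = fun X => ∑ α, ‖jetU m X (some α)‖ ^ 2 := by
    funext X; exact rate_eq_sum_norm X
  rw [this]
  exact continuous_finsetSum _ fun α _ =>
    ((PiLp.continuous_apply 2 _ (some α)).comp continuous_jetU).norm.pow 2

lemma IsGalerkin.integral_rate (h : IsGalerkin m φ₀ X) {t : ℝ} (ht : 0 ≤ t) :
    ∫ s in (0 : ℝ)..t, 2 * rate m (X s) = energy (X 0) - energy (X t) := by
  have h1 := intervalIntegral.integral_eq_sub_of_hasDerivAt (a := 0) (b := t)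
    (fun s hs => h.hasDerivAt_energy (by rw [uIcc_of_le ht] at hs; exact hs.1))
    (Continuous.intervalIntegrable (continuous_const.mul (continuous_rate.comp h.cont)) _ _)
  rw [intervalIntegral.integral_const_mul] at h1 ⊢
  linarith

lemma IsGalerkin.integrableOn_rate (h : IsGalerkin m φ₀ X) {B₀ : L2Vec d}
    (hB : HasWeakGrad φ₀ B₀) :
    IntegrableOn (fun s => 2 * rate m (X s)) (Ioi 0) ∧
      ∫ s in Ioi (0 : ℝ), 2 * rate m (X s) ≤ ‖B₀‖ ^ 2 := by
  have hc : Continuous fun s => 2 * rate m (X s) := continuous_const.mul (continuous_rate.comp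
      h.cont)
  have hb : ∀ n : ℕ, ∫ s in (0 : ℝ)..n, 2 * rate m (X s) ≤ ‖B₀‖ ^ 2 := fun n => by
    rw [h.integral_rate n.cast_nonneg]
    have h1 := h.energy_le hB le_rfl
    have h2 : 0 ≤ energy (X n) := sq_nonneg _
    linarith
  have hint : IntegrableOn (fun s => 2 * rate m (X s)) (Ioi 0) := by
    refine integrableOn_Ioi_of_intervalIntegral_norm_bounded (l := atTop) (b := fun n : ℕ => (n :
        ℝ))
      (‖B₀‖ ^ 2) 0 (fun n => hc.integrableOn_Ioc) tendsto_natCast_atTop_atTop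
      (Eventually.of_forall fun n => ?_)
    simpa only [Real.norm_of_nonneg (mul_nonneg zero_le_two (rate_nonneg (m := m) (X _)))] using hb
        n
  exact ⟨hint, le_of_tendsto (intervalIntegral_tendsto_integral_Ioi 0 hint
    tendsto_natCast_atTop_atTop) (Eventually.of_forall hb)⟩

/-- The energy balance bounds the time integral of `2 * rate`, which is just what `norm_jetU_sq_le`
asks for; the bound does not depend on `N`. -/
lemma IsGalerkin.memLp_jetU (h : IsGalerkin m φ₀ X) {B₀ : L2Vec d} (hB : HasWeakGrad φ₀ B₀) :
    MemLp (fun s => jetU m (X s)) 2 (volume.restrict (Ici (0 : ℝ))) ∧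
      ∫ s in Ici (0 : ℝ), ‖jetU m (X s)‖ ^ 2 ≤ ‖B₀‖ ^ 2 := by
  have hc : Continuous fun s => jetU m (X s) := continuous_jetU.comp h.cont
  obtain ⟨h1, h2⟩ := h.integrableOn_rate hB
  have h3 : IntegrableOn (fun s => ‖jetU m (X s)‖ ^ 2) (Ioi (0 : ℝ)) := by
    refine h1.mono' (hc.norm.pow 2).aestronglyMeasurable (Eventually.of_forall fun s => ?_)
    rw [Real.norm_of_nonneg (by positivity)]
    exact norm_jetU_sq_le (X s)
  refine ⟨?_, ?_⟩
  · rw [memLp_two_iff_integrable_sq_norm hc.aestronglyMeasurable]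
    exact (integrableOn_Ici_iff_integrableOn_Ioi (by simp)).2 h3
  · rw [integral_Ici_eq_integral_Ioi]
    exact (integral_mono h3 h1 fun s => norm_jetU_sq_le (X s)).trans h2

/-! ### Equicontinuity in time -/

lemma abs_integral_transport_le (Y : GState d N) {g : Torus d → ℝ} (hg : Smooth g) {C : ℝ}
    (hC : ∀ x, ‖grad g x‖ ≤ C) :
    |∫ x, phiC Y x * ⟪vel m Y x, grad g x⟫ ∂(leb d)| ≤ C * (‖toL2 (phiC Y)‖ * ‖jetU m Y none‖) := by
  let G : C(Torus d, Vec d) := ⟨fun x => phiC Y x • grad g x, (phiC Y).continuous.smul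
      hg.grad.continuous⟩
  have hC0 : 0 ≤ C := (norm_nonneg _).trans (hC 0)
  have h1 : ∫ x, phiC Y x * ⟪vel m Y x, grad g x⟫ ∂(leb d) = ⟪jetU m Y none, toL2 G⟫ := by
    rw [jetU_none, inner_toL2_toL2]
    congr 1; funext x
    exact (real_inner_smul_right _ _ _).symm
  have h2 : ‖toL2 G‖ ≤ C * ‖toL2 (phiC Y)‖ := by
    refine abs_le_of_sq_le_sq' ?_ (by positivity) |>.2
    rw [mul_pow, norm_toL2_sq, norm_toL2_sq, ← integral_const_mul]
    refine integral_mono (integrable_of_continuous (by fun_prop))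
      (integrable_of_continuous (by fun_prop)) fun x => ?_
    change ‖phiC Y x • grad g x‖ ^ 2 ≤ C ^ 2 * ‖phiC Y x‖ ^ 2
    rw [norm_smul, mul_pow, mul_comm]
    gcongr
    exact hC x
  rw [h1]
  refine (abs_real_inner_le_norm _ _).trans ?_
  calc ‖jetU m Y none‖ * ‖toL2 G‖ ≤ ‖jetU m Y none‖ * (C * ‖toL2 (phiC Y)‖) := by gcongr
    _ = _ := by ring

lemma exists_bound_grad_trig (k : Fin d → ℤ) (b : Bool) :
    ∃ C, 0 ≤ C ∧ ∀ x, ‖grad (trig k (phase b)) x‖ ≤ C :=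
  exists_bound_of_continuous (smooth_trig k (phase b)).grad.continuous

lemma IsGalerkin.hasDerivAt_coef (h : IsGalerkin m φ₀ X) {k : Fin d → ℤ} (hk : k ∈ box d N)
    (b : Bool) {t : ℝ} (ht : 0 ≤ t) :
    HasDerivAt (fun s => coef (phiC (X s)) k b)
      (∫ x, phiC (X t) x * ⟪vel m (X t) x, grad (trig k (phase b)) x⟫ ∂(leb d)) t := by
  have h1 := integral_phiC_galerkin (m := m) (X t) (smooth_trig k (phase b))
  rw [trunc_trig hk] at h1
  rw [← h1]
  let L : C(Torus d, ℝ) →L[ℝ] ℝ := intC.comp ((ContinuousLinearMap.mul ℝ C(Torus d, ℝ)).flip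
    (smooth_trig k (phase b)).toC)
  have h2 : HasDerivAt (fun s => L (phiC (X s))) (L (phiC (galerkin m (X t)))) t :=
    (L.comp phiC).hasFDerivAt.comp_hasDerivAt t (h.ode t ht)
  refine h2.congr_of_eventuallyEq (Eventually.of_forall fun s => ?_)
  simp only [L, ContinuousLinearMap.comp_apply, ContinuousLinearMap.flip_apply,
    ContinuousLinearMap.mul_apply', intC_apply]
  rfl

/-- Equicontinuity in time of the Fourier coefficients. -/
lemma IsGalerkin.coef_equicontinuous (h : IsGalerkin m φ₀ X) {B₀ : L2Vec d}
    (hB : HasWeakGrad φ₀ B₀) {k : Fin d → ℤ} (hk : k ∈ box d N) (b : Bool) {C : ℝ}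
    (hC : ∀ x, ‖grad (trig k (phase b)) x‖ ≤ C) {δ : ℝ} (hδ : 0 < δ) {s t : ℝ} (hs : 0 ≤ s)
    (hst : s ≤ t) :
    |coef (phiC (X t)) k b - coef (phiC (X s)) k b|
      ≤ C * ‖φ₀‖ * (δ⁻¹ * (t - s) + δ * ‖B₀‖ ^ 2) := by
  have hC0 : 0 ≤ C := (norm_nonneg _).trans (hC 0)
  have hbound : ∀ u, 0 ≤ u →
      |∫ x, phiC (X u) x * ⟪vel m (X u) x, grad (trig k (phase b)) x⟫ ∂(leb d)|
        ≤ C * ‖φ₀‖ * (δ⁻¹ + δ * (2 * rate m (X u))) := by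
    intro u hu
    refine (abs_integral_transport_le (X u) (smooth_trig k (phase b)) hC).trans ?_
    rw [mul_assoc]
    refine mul_le_mul_of_nonneg_left ?_ hC0
    refine mul_le_mul (h.norm_phiC_le hu) ?_ (norm_nonneg _) (norm_nonneg _)
    have h1 := norm_jetU_none_sq_le (m := m) (X u)
    set a := ‖jetU m (X u) none‖
    -- Completing the square gives `2a ≤ δ a² + δ⁻¹`, a bound for the velocity by the dissipation
    -- rate with a small factor.
    have h2 : 0 ≤ δ * (a - δ⁻¹) ^ 2 := by positivity
    have h3 : δ * (a - δ⁻¹) ^ 2 = δ * a ^ 2 - 2 * a + δ⁻¹ := by field_simp; ring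
    have h4 : δ * a ^ 2 ≤ δ * rate m (X u) := by gcongr
    have h5 : 0 ≤ δ * rate m (X u) := mul_nonneg hδ.le (rate_nonneg _)
    have h6 : 0 < δ⁻¹ := by positivity
    linarith
  -- The drift of `±coef` is dominated by that of `A (δ⁻¹ u - δ energy)`, as the energy decreases at
  -- the speed `2 * rate`. Monotonicity for both signs gives the estimate without integrating the
  -- rate.
  have key : ∀ σ : ℝ, |σ| = 1 →
      MonotoneOn (fun u => σ * coef (phiC (X u)) k b
        + C * ‖φ₀‖ * (δ⁻¹ * u - δ * energy (X u))) (Ici 0) := by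
    intro σ hσ
    have hd : ∀ u, 0 ≤ u → HasDerivAt (fun u => σ * coef (phiC (X u)) k b
        + C * ‖φ₀‖ * (δ⁻¹ * u - δ * energy (X u)))
        (σ * (∫ x, phiC (X u) x * ⟪vel m (X u) x, grad (trig k (phase b)) x⟫ ∂(leb d))
          + C * ‖φ₀‖ * (δ⁻¹ * 1 - δ * (-2 * rate m (X u)))) u := fun u hu =>
      ((h.hasDerivAt_coef hk b hu).const_mul σ).add ((((hasDerivAt_id u).const_mul δ⁻¹).sub
        ((h.hasDerivAt_energy hu).const_mul δ)).const_mul (C * ‖φ₀‖))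
    refine monotoneOn_of_deriv_nonneg (convex_Ici 0)
      (fun u hu => (hd u hu).continuousAt.continuousWithinAt) (fun u hu => ?_) fun u hu => ?_
    · rw [interior_Ici] at hu
      exact (hd u (le_of_lt hu)).differentiableAt.differentiableWithinAt
    · rw [interior_Ici] at hu
      rw [(hd u (le_of_lt hu)).deriv]
      have h1 := hbound u (le_of_lt hu)
      set I := ∫ x, phiC (X u) x * ⟪vel m (X u) x, grad (trig k (phase b)) x⟫ ∂(leb d)
      have h2 : |σ * I| ≤ C * ‖φ₀‖ * (δ⁻¹ + δ * (2 * rate m (X u))) := by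
        rw [abs_mul, hσ, one_mul]; exact h1
      have h3 := (abs_le.1 h2).1
      have h4 : C * ‖φ₀‖ * (δ⁻¹ * 1 - δ * (-2 * rate m (X u)))
          = C * ‖φ₀‖ * (δ⁻¹ + δ * (2 * rate m (X u))) := by ring
      linarith
  have ht : 0 ≤ t := hs.trans hst
  have h1 := key 1 (by simp) hs ht hst
  have h2 := key (-1) (by simp) hs ht hst
  have h3 : C * ‖φ₀‖ * (δ * (energy (X s) - energy (X t))) ≤ C * ‖φ₀‖ * (δ * ‖B₀‖ ^ 2) := by
    have h4 := h.energy_le hB hs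
    have h5 : 0 ≤ energy (X t) := sq_nonneg _
    gcongr
    linarith
  simp only at h1 h2
  rw [abs_le]
  constructor <;> nlinarith

/-! ### The dissipation inequality -/

/-- The field `z` is controlled only for times in `[0, T]`; clamping time gives a globally
continuous matrix field with the same values there. -/
lemma continuous_shiftedSymGrad_clamp {T : ℝ} (hT : 0 < T) {z : ℝ → Torus d → Vec d}
    (hz : SmoothOn (Icc 0 T) z) (r : ℝ) (i j : Fin d) :
    Continuous fun p : ℝ × Torus d => shiftedSymGrad r (z (projIcc 0 T hT.le p.1)) p.2 i j := by
  have h1 : ∀ i j, Continuous fun p : ℝ × Torus d =>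
      pderiv j (fun y => z (projIcc 0 T hT.le p.1) y i) p.2 := by
    intro i j
    have h := ((hz.coord i).pderiv (uniqueDiffOn_Icc hT) j).continuousOn
    have h2 : Continuous fun p : ℝ × Torus d => (((projIcc 0 T hT.le p.1 : ℝ), p.2) : ℝ × Torus d)
        :=
      (continuous_subtype_val.comp (continuous_projIcc.comp continuous_fst)).prodMk continuous_snd
    exact h.comp_continuous h2 fun p => ⟨(projIcc 0 T hT.le p.1).2, mem_univ _⟩
  have h3 := h1 i j
  have h4 := h1 j i
  simp only [shiftedSymGrad, Matrix.add_apply, Matrix.smul_apply, Matrix.transpose_apply, jacobian,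
    Matrix.of_apply]
  fun_prop

lemma continuousOn_tensorPairing {Y : ℝ → GState d N} (hY : Continuous Y) {T : ℝ} (hT : 0 < T)
    {z : ℝ → Torus d → Vec d} (hz : SmoothOn (Icc 0 T) z) (r : ℝ) :
    ContinuousOn (fun s => tensorPairing (toL2 (bC (Y s))) r (z s)) (Icc 0 T) := by
  have hc := fun i j => continuous_curve (fun s x => shiftedSymGrad r (z (projIcc 0 T hT.le s)) x i
      j)
    (continuous_shiftedSymGrad_clamp hT hz r i j)
  have h1 : Continuous fun s => intC (∑ i, ∑ j, gradC i (Y s) * gradC j (Y s)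
      * curve (fun s x => shiftedSymGrad r (z (projIcc 0 T hT.le s)) x i j)
        (continuous_shiftedSymGrad_clamp hT hz r i j) s) := by
    fun_prop
  refine h1.continuousOn.congr fun s hs => ?_
  dsimp only
  rw [intC_apply, tensorPairing]
  refine integral_congr_ae ?_
  filter_upwards [coeFn_toL2 (bC (Y s))] with x hx
  simp only [hx, bC_apply, grad_apply, ContinuousMap.coe_sum, Finset.sum_apply,
    ContinuousMap.mul_apply, gradC_eq, curve_apply, projIcc_of_mem hT.le hs]

/-- The function `f` is minus the derivative of `energy * exp (-s r)`, so the pointwise inequality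
integrates to the claim. -/
lemma IsGalerkin.dissipation (h : IsGalerkin m φ₀ X) {T : ℝ} {z : ℝ → Torus d → Vec d}
    (hz : SmoothOn (Icc 0 T) z) (hsol : ∀ t ∈ Icc 0 T, IsSol (z t)) {r : ℝ} (hr : 0 ≤ r)
    (hpos : ∀ t ∈ Icc 0 T, ∀ x, (shiftedSymGrad r (z t) x).PosSemidef) {t : ℝ}
    (ht : t ∈ Icc 0 T) :
    (∫⁻ s in Icc 0 t, (ENNReal.ofReal (rate m (X s))
        + ENNReal.ofReal (tensorPairing (toL2 (bC (X s))) r (z s)))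
          * ENNReal.ofReal (Real.exp (-(s * r))))
      + ENNReal.ofReal (energy (X t) * Real.exp (-(t * r)))
    ≤ ENNReal.ofReal (energy (X 0))
      + ∫⁻ s in Icc 0 t, 2 * K m (z s) * ENNReal.ofReal (Real.exp (-(s * r))) := by
  have hR : Continuous fun s => rate m (X s) := continuous_rate.comp h.cont
  have hE : Continuous fun s => energy (X s) :=
    ((toL2.comp bC).continuous.comp h.cont).norm.pow 2
  let f : ℝ → ℝ := fun s => (2 * rate m (X s) + r * energy (X s)) * Real.exp (-(s * r))
  have hf : Continuous f := by fun_prop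
  have hf0 : ∀ s, 0 ≤ f s := fun s => by
    have := rate_nonneg (m := m) (X s)
    have : 0 ≤ energy (X s) := sq_nonneg _
    positivity
  have h1 : ∫⁻ s in Icc 0 t, (ENNReal.ofReal (rate m (X s))
        + ENNReal.ofReal (tensorPairing (toL2 (bC (X s))) r (z s)))
          * ENNReal.ofReal (Real.exp (-(s * r)))
      ≤ ∫⁻ s in Icc 0 t, (ENNReal.ofReal (f s)
        + 2 * K m (z s) * ENNReal.ofReal (Real.exp (-(s * r)))) := by
    refine setLIntegral_mono' measurableSet_Icc fun s hs => ?_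
    have hs' : s ∈ Icc 0 T := ⟨hs.1, hs.2.trans ht.2⟩
    rw [ENNReal.ofReal_mul' (Real.exp_nonneg _), ← add_mul]
    exact mul_le_mul_left
      (rate_add_tensorPairing_le (X s) hr (hz.smooth hs') (hsol s hs') (hpos s hs')) _
  have h2 : ∫⁻ s in Icc 0 t, ENNReal.ofReal (f s)
      = ENNReal.ofReal (energy (X 0) - energy (X t) * Real.exp (-(t * r))) := by
    rw [← ofReal_integral_eq_lintegral_ofReal hf.integrableOn_Icc (Eventually.of_forall hf0),
      integral_Icc_eq_integral_Ioc, ← intervalIntegral.integral_of_le ht.1]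
    congr 1
    have hd : ∀ s ∈ uIcc 0 t,
        HasDerivAt (fun s => - (energy (X s) * Real.exp (-(s * r)))) (f s) s := by
      intro s hs
      rw [uIcc_of_le ht.1] at hs
      have he : HasDerivAt (fun s : ℝ => Real.exp (-(s * r))) (Real.exp (-(s * r)) * -(1 * r)) s :=
        ((hasDerivAt_id s).mul_const r).neg.exp
      refine ((h.hasDerivAt_energy hs.1).mul he).neg.congr_deriv ?_
      simp only [f]
      ring
    rw [intervalIntegral.integral_eq_sub_of_hasDerivAt hd (hf.intervalIntegrable _ _)]
    simp
    ring
  refine (add_le_add_left h1 _).trans ?_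
  rw [lintegral_add_left (by fun_prop), h2, add_right_comm]
  gcongr
  -- This keeps the difference inside `ENNReal.ofReal` nonnegative, so that nothing is cut off at
  -- zero.
  have h3 : energy (X t) * Real.exp (-(t * r)) ≤ energy (X 0) * 1 := by
    have h4 := h.antitoneOn_energy self_mem_Ici (mem_Ici.2 ht.1) ht.1
    refine mul_le_mul h4 (Real.exp_le_one_iff.2 ?_) (Real.exp_nonneg _) (sq_nonneg _)
    have := mul_nonneg ht.1 hr
    linarith
  have h5 : 0 ≤ energy (X t) * Real.exp (-(t * r)) := mul_nonneg (sq_nonneg _) (Real.exp_nonneg _)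
  rw [← ENNReal.ofReal_add (by linarith) h5, sub_add_cancel]

end Dynamics

/-! ### Compactness: convergence of the states and of their gradients -/

section Limit

open Filter Topology

variable {d m : ℕ}

/-! ### Limits of states -/

section Equicontinuity

variable {f : ℕ → ℝ → ℝ}

/-- Compare with a rational time slightly after `t`. Equicontinuity is asked only for large `n`, as
a coefficient satisfies it only once its frequency has entered the box. -/
lemma exists_limit_of_equicontinuous
    (H : ∀ ε > 0, ∃ η > 0, ∀ᶠ n in atTop, ∀ s t, 0 ≤ s → s ≤ t → t - s < η → |f n t - f n s| ≤ ε)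
    (hq : ∀ q : ℚ, 0 ≤ q → ∃ c, Tendsto (fun n => f n q) atTop (𝓝 c)) {t : ℝ} (ht : 0 ≤ t) :
    ∃ c, Tendsto (fun n => f n t) atTop (𝓝 c) := by
  refine cauchySeq_tendsto_of_complete (Metric.cauchySeq_iff.2 fun ε hε => ?_)
  obtain ⟨η, hη, h1⟩ := H (ε / 4) (by positivity)
  obtain ⟨q, hq1, hq2⟩ := exists_rat_btwn (show t < t + η by linarith)
  obtain ⟨c, hc⟩ := hq q (by exact_mod_cast ht.trans hq1.le)
  obtain ⟨M, hM⟩ := Metric.cauchySeq_iff.1 hc.cauchySeq (ε / 4) (by positivity)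
  obtain ⟨M', hM'⟩ := eventually_atTop.1 h1
  refine ⟨max M M', fun a ha b hb => ?_⟩
  have h2 := hM a (le_of_max_le_left ha) b (le_of_max_le_left hb)
  have h3 := hM' a (le_of_max_le_right ha) t q ht hq1.le (by linarith)
  have h4 := hM' b (le_of_max_le_right hb) t q ht hq1.le (by linarith)
  rw [Real.dist_eq] at h2 ⊢
  rw [abs_le] at h3 h4
  rw [abs_lt] at h2 ⊢
  constructor <;> linarith

lemma continuousOn_limit_of_equicontinuous
    (H : ∀ ε > 0, ∃ η > 0, ∀ᶠ n in atTop, ∀ s t, 0 ≤ s → s ≤ t → t - s < η → |f n t - f n s| ≤ ε)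
    {g : ℝ → ℝ} (hg : ∀ t, 0 ≤ t → Tendsto (fun n => f n t) atTop (𝓝 (g t))) :
    ContinuousOn g (Ici 0) := by
  refine Metric.continuousOn_iff.2 fun t ht ε hε => ?_
  obtain ⟨η, hη, h1⟩ := H (ε / 2) (by positivity)
  have key : ∀ s t, 0 ≤ s → s ≤ t → t - s < η → |g t - g s| ≤ ε / 2 := fun s t hs hst h =>
    le_of_tendsto ((hg t (hs.trans hst)).sub (hg s hs)).abs
      (h1.mono fun n hn => hn s t hs hst h)
  refine ⟨η, hη, fun s hs hst => ?_⟩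
  rw [Real.dist_eq] at hst ⊢
  rw [abs_lt] at hst
  rcases le_total s t with h | h
  · rw [abs_sub_comm]
    linarith [key s t hs h (by linarith)]
  · linarith [key t s ht h (by linarith)]

end Equicontinuity

lemma coef_eq_inner (φ : L2 d) (k : Fin d → ℤ) (b : Bool) : coef φ k b = ⟪φ, toL2 (trigC k b)⟫ :=
  (inner_toL2_real φ (trigC k b)).symm

lemma coef_toL2 (f : C(Torus d, ℝ)) (k : Fin d → ℤ) (b : Bool) : coef (toL2 f) k b = coef f k b :=
    by
  refine integral_congr_ae ?_
  filter_upwards [coeFn_toL2 f] with x hx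
  rw [hx]

lemma eq_of_coef {f g : L2 d} (h : ∀ k b, coef f k b = coef g k b) : f = g := by
  have h1 : ∀ k b, coef (f - g : L2 d) k b = 0 := fun k b => by
    rw [coef_eq_inner, inner_sub_left, ← coef_eq_inner, ← coef_eq_inner, h, sub_self]
  have h2 := parseval (Lp.memLp (f - g))
  simp only [h1] at h2
  have h3 : ‖f - g‖ ^ 2 = 0 := by
    rw [norm_sq_eq_integral]
    simp only [Real.norm_eq_abs, sq_abs]
    exact h2.unique (by simp)
  rw [← sub_eq_zero, ← norm_eq_zero]
  exact pow_eq_zero_iff two_ne_zero |>.1 h3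

lemma HasWeakGrad.sub {f g : L2 d} {A B : L2Vec d} (hf : HasWeakGrad f A) (hg : HasWeakGrad g B) :
    HasWeakGrad (f - g) (A - B) := by
  rw [hasWeakGrad_iff] at *
  intro ψ hψ i
  rw [inner_sub_left, inner_sub_left, hf ψ hψ i, hg ψ hψ i]
  ring

/-- Rellich's theorem, for sequences whose Fourier coefficients converge. -/
lemma cauchySeq_of_coef {φ : ℕ → L2 d} {B : ℕ → L2Vec d} (h : ∀ n, HasWeakGrad (φ n) (B n)) {C : ℝ}
    (hC : ∀ n, ‖B n‖ ≤ C) (hc : ∀ k b, ∃ c, Tendsto (fun n => coef (φ n) k b) atTop (𝓝 c)) :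
    CauchySeq φ := by
  have hC0 : 0 ≤ C := (norm_nonneg _).trans (hC 0)
  have h1 : ∀ M : ℕ, Tendsto (fun p : ℕ × ℕ => ∑ k ∈ box d M, ∑ b : Bool,
      coef (φ p.1 - φ p.2 : L2 d) k b ^ 2) atTop (𝓝 0) := by
    intro M
    have : (0 : ℝ) = ∑ k ∈ box d M, ∑ b : Bool, 0 ^ 2 := by simp
    rw [this]
    refine tendsto_finsetSum _ fun k _ => tendsto_finsetSum _ fun b _ => Tendsto.pow ?_ 2
    obtain ⟨c, hc⟩ := hc k b
    have h2 := (cauchySeq_iff_tendsto_dist_atTop_0.1 hc.cauchySeq)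
    rw [tendsto_zero_iff_abs_tendsto_zero]
    refine h2.congr fun p => ?_
    rw [Real.dist_eq, Function.comp_apply, coef_eq_inner, coef_eq_inner, coef_eq_inner,
      inner_sub_left]
  have h2 : Tendsto (fun M : ℕ => ((M : ℝ) + 1)⁻¹ ^ 2 * (2 * C) ^ 2) atTop (𝓝 (0 ^ 2 * (2 * C) ^ 2))
      :=
    ((tendsto_natCast_atTop_atTop.atTop_add tendsto_const_nhds).inv_tendsto_atTop.pow 2).mul_const _
  rw [zero_pow two_ne_zero, zero_mul] at h2
  rw [cauchySeq_iff_tendsto_dist_atTop_0, Metric.tendsto_nhds]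
  intro ε hε
  -- `M` is fixed first: it makes the high frequencies small uniformly in the sequence and leaves
  -- finitely many convergent coefficients.
  obtain ⟨M, hM⟩ := (h2.eventually_lt_const (show (0 : ℝ) < ε ^ 2 / 2 by positivity)).exists
  filter_upwards [(h1 M).eventually_lt_const (show (0 : ℝ) < ε ^ 2 / 2 by positivity)] with p hp
  have h3 := ((h p.1).sub (h p.2)).norm_sq_le M
  have h4 : ‖B p.1 - B p.2‖ ^ 2 ≤ (2 * C) ^ 2 := by
    refine pow_le_pow_left₀ (norm_nonneg _) ((norm_sub_le _ _).trans ?_) 2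
    linarith [hC p.1, hC p.2]
  have h5 : ((M : ℝ) + 1)⁻¹ ^ 2 * ‖B p.1 - B p.2‖ ^ 2 ≤ ((M : ℝ) + 1)⁻¹ ^ 2 * (2 * C) ^ 2 := by
      gcongr
  rw [Real.dist_0_eq_abs, abs_of_nonneg dist_nonneg, dist_eq_norm]
  refine lt_of_pow_lt_pow_left₀ 2 hε.le ?_
  linarith

lemma norm_le_of_weak {Y ι : Type*} [NormedAddCommGroup Y] [InnerProductSpace ℝ Y] {l : Filter ι}
    [l.NeBot] {u : ι → Y} {v : Y} {C : ℝ} (hC : ∀ n, ‖u n‖ ≤ C)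
    (hu : ∀ w, Tendsto (fun n => ⟪u n, w⟫) l (𝓝 ⟪v, w⟫)) : ‖v‖ ≤ C := by
  have h1 : ⟪v, v⟫ ≤ C * ‖v‖ := le_of_tendsto (hu v) (Eventually.of_forall fun n =>
    (real_inner_le_norm _ _).trans (mul_le_mul_of_nonneg_right (hC n) (norm_nonneg _)))
  rw [real_inner_self_eq_norm_mul_norm] at h1
  rcases (norm_nonneg v).eq_or_lt with h | h
  · rw [← h]
    obtain ⟨n⟩ : Nonempty ι := l.nonempty_of_neBot
    exact (norm_nonneg _).trans (hC n)
  · exact le_of_mul_le_mul_right h1 h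

/-- Sequences of Galerkin approximations whose Fourier coefficients converge at all times. -/
structure GalerkinLimit (m : ℕ) (φ₀ : L2 d) (B₀ : L2Vec d) (N : ℕ → ℕ)
    (X : ∀ n, ℝ → GState d (N n)) : Prop where
  weakGrad : HasWeakGrad φ₀ B₀
  tendsto : Tendsto N atTop atTop
  galerkin : ∀ n, IsGalerkin m φ₀ (X n)
  coef : ∀ t, 0 ≤ t → ∀ k b, ∃ c, Tendsto (fun n => coef (phiC (X n t)) k b) atTop (𝓝 c)

lemma eventually_mem_box {N : ℕ → ℕ} (hN : Tendsto N atTop atTop) (k : Fin d → ℤ) :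
    ∀ᶠ n in atTop, k ∈ box d (N n) := by
  have h1 := (box_tendsto (d := d)).comp hN
  filter_upwards [h1.eventually_ge_atTop {k}] with n hn
  exact hn (Finset.mem_singleton_self k)

lemma equicontinuous_coef {φ₀ : L2 d} {B₀ : L2Vec d} {N : ℕ → ℕ} {X : ∀ n, ℝ → GState d (N n)}
    (hB : HasWeakGrad φ₀ B₀) (hN : Tendsto N atTop atTop) (hX : ∀ n, IsGalerkin m φ₀ (X n))
    (k : Fin d → ℤ) (b : Bool) :
    ∀ ε > 0, ∃ η > 0, ∀ᶠ n in atTop, ∀ s t, 0 ≤ s → s ≤ t → t - s < η →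
      |coef (phiC (X n t)) k b - coef (phiC (X n s)) k b| ≤ ε := by
  intro ε hε
  obtain ⟨C, hC0, hC⟩ := exists_bound_grad_trig k b
  set A := C * ‖φ₀‖
  have hA : 0 ≤ A := by positivity
  -- `δ` makes the energy contribution at most `ε / 2`; the time step is then chosen so that the
  -- `δ⁻¹` contribution is at most `ε / 2`. The added `1` avoids division by zero.
  set δ := ε / (2 * (A * ‖B₀‖ ^ 2 + 1))
  have hδ : 0 < δ := by positivity
  refine ⟨ε * δ / (2 * (A + 1)), by positivity, ?_⟩
  filter_upwards [eventually_mem_box hN k] with n hn s t hs hst hts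
  refine ((hX n).coef_equicontinuous hB hn b hC hδ hs hst).trans ?_
  have h1 : A * (δ * ‖B₀‖ ^ 2) ≤ ε / 2 := by
    have : A * (δ * ‖B₀‖ ^ 2) = ε / 2 * ((A * ‖B₀‖ ^ 2) / (A * ‖B₀‖ ^ 2 + 1)) := by
      simp only [δ]; field_simp
    rw [this]
    refine mul_le_of_le_one_right (by positivity) (div_le_one_of_le₀ (by linarith) (by positivity))
  have h2 : A * (δ⁻¹ * (t - s)) ≤ ε / 2 := by
    calc A * (δ⁻¹ * (t - s)) ≤ A * (δ⁻¹ * (ε * δ / (2 * (A + 1)))) := by gcongr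
      _ = ε / 2 * (A / (A + 1)) := by field_simp
      _ ≤ ε / 2 := mul_le_of_le_one_right (by positivity)
        (div_le_one_of_le₀ (by linarith) (by positivity))
  rw [mul_add]
  linarith

lemma abs_coef_le (φ : L2 d) (k : Fin d → ℤ) (b : Bool) : |coef φ k b| ≤ ‖φ‖ := by
  rw [coef_eq_inner]
  refine (abs_real_inner_le_norm _ _).trans (mul_le_of_le_one_right (norm_nonneg _) ?_)
  exact norm_toL2_le zero_le_one fun x => abs_trig_le k (phase b) x

lemma exists_galerkinLimit (m : ℕ) {φ₀ : L2 d} {B₀ : L2Vec d} (hB : HasWeakGrad φ₀ B₀) :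
    ∃ (N : ℕ → ℕ) (X : ∀ n, ℝ → GState d (N n)), GalerkinLimit m φ₀ B₀ N X := by
  choose Y hY using fun n => exists_isGalerkin m n φ₀
  -- Absolute values of rational times keep the index set simple: the bounds hold only at
  -- nonnegative times.
  obtain ⟨σ, hσ, h1⟩ := exists_subseq_of_bounded
    (fun n (j : (Fin d → ℤ) × Bool × ℚ) => coef (phiC (Y n |(j.2.2 : ℝ)|)) j.1 j.2.1)
    (fun _ => ‖φ₀‖) fun n j => by
      rw [← coef_toL2]
      exact (abs_coef_le _ _ _).trans ((hY n).norm_phiC_le (abs_nonneg _))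
  refine ⟨σ, fun n => Y (σ n), hB, hσ.tendsto_atTop, fun n => hY (σ n), fun t ht k b => ?_⟩
  refine exists_limit_of_equicontinuous (equicontinuous_coef hB hσ.tendsto_atTop
    (fun n => hY (σ n)) k b) (fun q hq => ?_) ht
  obtain ⟨c, hc⟩ := h1 (k, b, q)
  refine ⟨c, ?_⟩
  simpa only [abs_of_nonneg (show (0 : ℝ) ≤ q by exact_mod_cast hq)] using hc

variable {φ₀ : L2 d} {B₀ : L2Vec d} {N : ℕ → ℕ} {X : ∀ n, ℝ → GState d (N n)}

namespace GalerkinLimit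

lemma norm_bC_le (h : GalerkinLimit m φ₀ B₀ N X) (n : ℕ) {t : ℝ} (ht : 0 ≤ t) :
    ‖toL2 (bC (X n t))‖ ≤ ‖B₀‖ :=
  (sq_le_sq₀ (norm_nonneg _) (norm_nonneg _)).1 ((h.galerkin n).energy_le h.weakGrad ht)

lemma exists_tendsto_phi (h : GalerkinLimit m φ₀ B₀ N X) {t : ℝ} (ht : 0 ≤ t) :
    ∃ φ : L2 d, Tendsto (fun n => toL2 (phiC (X n t))) atTop (𝓝 φ) :=
  cauchySeq_tendsto_of_complete <| cauchySeq_of_coef (fun n => hasWeakGrad_state (X n t))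
    (fun n => h.norm_bC_le n ht) fun k b => by simpa only [coef_toL2] using h.coef t ht k b

/-- Pairings of the gradient with trigonometric fields are pairings of the state with derivatives of
monomials, which converge; totality and the energy bound do the rest. -/
lemma exists_tendsto_grad (h : GalerkinLimit m φ₀ B₀ N X) {t : ℝ} (ht : 0 ≤ t) :
    ∃ B : L2Vec d, ∀ w, Tendsto (fun n => ⟪toL2 (bC (X n t)), w⟫) atTop (𝓝 ⟪B, w⟫) := by
  refine exists_weak_limit_of_total (fun n => h.norm_bC_le n ht) span_trig_orthogonal ?_
  rintro w ⟨i, k, b, rfl⟩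
  obtain ⟨φ, hφ⟩ := h.exists_tendsto_phi ht
  refine ⟨- ⟪φ, toL2 ((smooth_trig k (phase b)).pderiv i).toC⟫, ?_⟩
  refine ((hφ.inner tendsto_const_nhds).neg).congr fun n => ?_
  rw [hasWeakGrad_iff.1 (hasWeakGrad_state (X n t)) _ (smooth_trig k (phase b)) i, neg_neg]

/-- The limit of the states at time `t`. -/
def phi (h : GalerkinLimit m φ₀ B₀ N X) (t : ℝ) : L2 d :=
  if ht : 0 ≤ t then (h.exists_tendsto_phi ht).choose else 0

/-- The limit of the gradients at time `t`. -/
def grad (h : GalerkinLimit m φ₀ B₀ N X) (t : ℝ) : L2Vec d :=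
  if ht : 0 ≤ t then (h.exists_tendsto_grad ht).choose else 0

lemma tendsto_phi (h : GalerkinLimit m φ₀ B₀ N X) {t : ℝ} (ht : 0 ≤ t) :
    Tendsto (fun n => toL2 (phiC (X n t))) atTop (𝓝 (h.phi t)) := by
  rw [phi, dif_pos ht]
  exact (h.exists_tendsto_phi ht).choose_spec

lemma tendsto_grad (h : GalerkinLimit m φ₀ B₀ N X) {t : ℝ} (ht : 0 ≤ t) (w : L2Vec d) :
    Tendsto (fun n => ⟪toL2 (bC (X n t)), w⟫) atTop (𝓝 ⟪h.grad t, w⟫) := by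
  rw [grad, dif_pos ht]
  exact (h.exists_tendsto_grad ht).choose_spec w

lemma norm_grad_le (h : GalerkinLimit m φ₀ B₀ N X) {t : ℝ} (ht : 0 ≤ t) : ‖h.grad t‖ ≤ ‖B₀‖ :=
  norm_le_of_weak (fun n => h.norm_bC_le n ht) (h.tendsto_grad ht)

lemma norm_phi_le (h : GalerkinLimit m φ₀ B₀ N X) {t : ℝ} (ht : 0 ≤ t) : ‖h.phi t‖ ≤ ‖φ₀‖ :=
  le_of_tendsto (h.tendsto_phi ht).norm
    (Eventually.of_forall fun n => (h.galerkin n).norm_phiC_le ht)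

lemma hasWeakGrad (h : GalerkinLimit m φ₀ B₀ N X) {t : ℝ} (ht : 0 ≤ t) :
    HasWeakGrad (h.phi t) (h.grad t) :=
  hasWeakGrad_iff.2 fun ψ hψ i => tendsto_nhds_unique
    ((h.tendsto_phi ht).inner tendsto_const_nhds) (((h.tendsto_grad ht _).neg).congr fun n =>
      (hasWeakGrad_iff.1 (hasWeakGrad_state (X n t)) ψ hψ i).symm)

lemma tendsto_coef (h : GalerkinLimit m φ₀ B₀ N X) {t : ℝ} (ht : 0 ≤ t) (k : Fin d → ℤ) (b : Bool) :
    Tendsto (fun n => GradFlow.coef (phiC (X n t)) k b) atTop (𝓝 (GradFlow.coef (h.phi t) k b)) :=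
        by
  rw [coef_eq_inner]
  refine ((h.tendsto_phi ht).inner tendsto_const_nhds).congr fun n => ?_
  rw [← coef_eq_inner, coef_toL2]

/-- Each coefficient of the truncated datum equals that of `φ₀` as soon as its frequency is in the
box. -/
lemma phi_zero (h : GalerkinLimit m φ₀ B₀ N X) : h.phi 0 = φ₀ := by
  refine eq_of_coef fun k b => tendsto_nhds_unique (h.tendsto_coef le_rfl k b) ?_
  refine tendsto_const_nhds.congr' ?_
  filter_upwards [eventually_mem_box h.tendsto k] with n hn
  rw [(h.galerkin n).phiC_zero, GradFlow.coef, GradFlow.coef, ← integral_mul_trunc_comm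
    (integrable_L2 φ₀) (integrable_of_continuous (continuous_trig _ _)), trunc_trig hn]

lemma integral_phi (h : GalerkinLimit m φ₀ B₀ N X) {t : ℝ} (ht : 0 ≤ t) :
    ∫ x, h.phi t x ∂(leb d) = ∫ x, φ₀ x ∂(leb d) := by
  have h1 : ∀ f : Torus d → ℝ, ∫ x, f x ∂(leb d) = GradFlow.coef f 0 false := fun f => by
    simp [GradFlow.coef, trig_zero, phase]
  have h3 : GradFlow.coef φ₀ 0 false = GradFlow.coef (h.phi 0) 0 false := by rw [h.phi_zero]
  rw [h1, h1, h3]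
  refine tendsto_nhds_unique (h.tendsto_coef ht 0 false) ((h.tendsto_coef le_rfl 0 false).congr
    fun n => ?_)
  -- The mean is the coefficient of the constant function, whose gradient is zero; with `C = 0` the
  -- equicontinuity estimate says that it is conserved.
  have h2 := (h.galerkin n).coef_equicontinuous h.weakGrad zero_mem_box false (C := 0)
    (fun x => le_of_eq ?_) zero_lt_one le_rfl ht
  · rw [zero_mul, zero_mul] at h2
    exact (sub_eq_zero.1 (abs_nonpos_iff.1 h2)).symm
  · rw [norm_eq_zero]
    ext i
    rw [grad_apply, pderiv_trig]
    simp [freq]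

lemma continuousOn_coef (h : GalerkinLimit m φ₀ B₀ N X) (k : Fin d → ℤ) (b : Bool) :
    ContinuousOn (fun t => GradFlow.coef (h.phi t) k b) (Ici 0) :=
  continuousOn_limit_of_equicontinuous (equicontinuous_coef h.weakGrad h.tendsto h.galerkin k b)
    fun _ ht => h.tendsto_coef ht k b

/-- Against a trigonometric field the pairing is a frequency times a coefficient of `h.phi t`,
continuous in time. The uniform bound on `h.grad` extends this to all of `L²` by uniform
approximation. -/
lemma memCw (h : GalerkinLimit m φ₀ B₀ N X) : MemCw h.grad := by
  intro w
  have hspan : ∀ w ∈ Submodule.span ℝ {w : L2Vec d | ∃ i k b,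
      w = toL2 (singleC i (smooth_trig k (phase b)).toC)},
      ContinuousOn (fun t => ⟪h.grad t, w⟫) (Ici 0) := by
    intro w hw
    induction hw using Submodule.span_induction with
    | mem w hw =>
      obtain ⟨i, k, b, rfl⟩ := hw
      have h1 : ∀ t ∈ Ici (0 : ℝ), _ := fun t ht =>
        coef_of_weak (integrable_L2 (h.phi t)) (i := i) (g := fun x => h.grad t x i)
          (fun ψ hψ => h.hasWeakGrad ht ψ hψ i) k
      have h2 : ∀ t, ⟪h.grad t, toL2 (singleC i (smooth_trig k (phase b)).toC)⟫
          = GradFlow.coef (fun x => h.grad t x i) k b := fun t => inner_singleC _ _ _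
      simp_rw [h2]
      cases b with
      | false => exact ((h.continuousOn_coef k true).const_mul _).congr fun t ht => (h1 t ht).1
      | true => exact ((h.continuousOn_coef k false).const_mul _).neg.congr fun t ht => (h1 t ht).2
    | zero => simpa using continuousOn_const
    | add u v _ _ hu hv => simp only [inner_add_right]; exact ContinuousOn.add hu hv
    | smul c u _ hu => simpa only [inner_smul_right] using hu.const_mul c
  have hw : w ∈ closure (Submodule.span ℝ {w : L2Vec d | ∃ i k b,
      w = toL2 (singleC i (smooth_trig k (phase b)).toC)} : Set (L2Vec d)) := by
    rw [← Submodule.topologicalClosure_coe,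
      Submodule.topologicalClosure_eq_top_iff.2 span_trig_orthogonal]
    trivial
  refine continuousOn_of_uniform_approx_of_continuousOn fun u hu => ?_
  obtain ⟨ε, hε, hu⟩ := Metric.mem_uniformity_dist.1 hu
  obtain ⟨w', hw', hd⟩ := Metric.mem_closure_iff.1 hw (ε / (‖B₀‖ + 1)) (by positivity)
  refine ⟨fun t => ⟪h.grad t, w'⟫, hspan w' hw', fun t ht => hu ?_⟩
  rw [Real.dist_eq, ← inner_sub_right]
  refine (abs_real_inner_le_norm _ _).trans_lt ?_
  rw [dist_eq_norm, lt_div_iff₀ (by positivity)] at hd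
  have h1 := mul_le_mul_of_nonneg_right (h.norm_grad_le ht) (norm_nonneg (w - w'))
  nlinarith [norm_nonneg (w - w')]

end GalerkinLimit

end Limit

/-! ### Weak limit of the velocities and the dissipation inequality -/

section Velocity

open Filter Topology

variable {d m : ℕ}

/-! ### Lower semicontinuity -/

/-- In the compact space `[0, ∞]` everything converges along an ultrafilter, so each liminf is a
limit and addition is continuous. -/
lemma ultrafilter_liminf_add {ι : Type*} (U : Ultrafilter ι) (f g : ι → ℝ≥0∞) :
    liminf f U + liminf g U ≤ liminf (fun n => f n + g n) U := by
  have h : ∀ f : ι → ℝ≥0∞, Tendsto f U (𝓝 (liminf f U)) := fun f => by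
    have h1 : Tendsto f U (𝓝 (U.map f).lim) := (U.map f).le_nhds_lim
    rwa [← h1.liminf_eq] at h1
  exact (((h f).add (h g)).liminf_eq).ge

lemma mul_liminf_le {ι : Type*} {l : Filter ι} [l.NeBot] (f : ι → ℝ≥0∞) (c : ℝ≥0∞) :
    liminf f l * c ≤ liminf (fun n => f n * c) l := by
  have h := ENNReal.le_liminf_mul (u := f) (v := fun _ => c) (f := l)
  rwa [liminf_const] at h

lemma integrable_inner_of_memLp {Ω E : Type*} [MeasurableSpace Ω] {μ : Measure Ω}
    [NormedAddCommGroup E] [InnerProductSpace ℝ E] {f g : Ω → E} (hf : MemLp f 2 μ)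
    (hg : MemLp g 2 μ) : Integrable (fun s => ⟪f s, g s⟫) μ := by
  refine (L2.integrable_inner (𝕜 := ℝ) (hf.toLp f) (hg.toLp g)).congr ?_
  filter_upwards [hf.coeFn_toLp, hg.coeFn_toLp] with s h1 h2
  rw [h1, h2]

/-- The projection onto the orthogonal complement. It turns membership in a closed subspace into a
linear equation, which can be imposed at almost every time and passes to weak limits. -/
lemma exists_clm_ker_eq {E : Type*} [NormedAddCommGroup E] [InnerProductSpace ℝ E] [CompleteSpace E]
    {K : Submodule ℝ E} (hK : IsClosed (K : Set E)) : ∃ P : E →L[ℝ] E, ∀ x, P x = 0 ↔ x ∈ K := by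
  refine ⟨Submodule.starProjection (Submodule.orthogonal K), fun x => ?_⟩
  rw [Submodule.starProjection_apply_eq_zero_iff, Submodule.orthogonal_orthogonal_eq_closure,
    hK.submodule_topologicalClosure_eq]

/-- The part of a jet that consists of the derivatives of order `m`. -/
def topJet (h : Jet d m) : Jet d m := WithLp.toLp 2 fun o => o.elim 0 fun α => h (some α)

lemma inner_topJet (h k : Jet d m) : ⟪h, topJet k⟫ = ∑ α, ⟪h (some α), k (some α)⟫ := by
  simp [topJet, PiLp.inner_apply, Fintype.sum_option]

variable {μ : Measure ℝ}

lemma memLp_topJet {u : ℝ → Jet d m} (hu : MemLp u 2 μ) {ρ : ℝ → ℝ} (hρ : Measurable ρ)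
    (h0 : ∀ s, |ρ s| ≤ 1) : MemLp (fun s => ρ s • topJet (u s)) 2 μ := by
  have h1 : MemLp (fun s => topJet (u s)) 2 μ := by
    refine MemLp.of_eval_piLp fun o => ?_
    cases o with
    | none => exact MemLp.zero
    | some α => exact hu.eval_piLp (some α)
  refine MemLp.of_le h1 (hρ.aestronglyMeasurable.smul h1.1) (Eventually.of_forall fun s => ?_)
  rw [norm_smul, Real.norm_eq_abs]
  exact mul_le_of_le_one_left (norm_nonneg _) (h0 s)

lemma lintegral_topJet {u : ℝ → Jet d m} (hu : MemLp u 2 μ) {ρ : ℝ → ℝ} (hρ : Measurable ρ)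
    (h0 : ∀ s, 0 ≤ ρ s) (h1 : ∀ s, ρ s ≤ 1) :
    ∫⁻ s, ENNReal.ofReal (∑ α, ‖u s (some α)‖ ^ 2) * ENNReal.ofReal (ρ s) ∂μ
      = ENNReal.ofReal (∫ s, ⟪u s, ρ s • topJet (u s)⟫ ∂μ) := by
  have h2 := memLp_topJet hu hρ fun s => abs_le.2 ⟨by linarith [h0 s], h1 s⟩
  have h3 : ∀ s, ⟪u s, ρ s • topJet (u s)⟫ = (∑ α, ‖u s (some α)‖ ^ 2) * ρ s := fun s => by
    rw [real_inner_smul_right, inner_topJet, mul_comm]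
    simp only [real_inner_self_eq_norm_sq]
  have h4 : Integrable (fun s => ⟪u s, ρ s • topJet (u s)⟫) μ := integrable_inner_of_memLp hu h2
  rw [ofReal_integral_eq_lintegral_ofReal h4 (Eventually.of_forall fun s => ?_)]
  · refine lintegral_congr fun s => ?_
    rw [h3, ENNReal.ofReal_mul' (h0 s)]
  · dsimp only
    rw [Pi.zero_apply, h3]
    exact mul_nonneg (Finset.sum_nonneg fun α _ => by positivity) (h0 s)

/-- Weak lower semicontinuity of the weighted dissipation. -/
lemma lintegral_topJet_le_liminf {ι : Type*} {l : Filter ι} [l.NeBot] {u : ι → Lp (Jet d m) 2 μ}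
    {v : Lp (Jet d m) 2 μ} (hu : ∀ w, Tendsto (fun n => ⟪u n, w⟫) l (𝓝 ⟪v, w⟫)) {ρ : ℝ → ℝ}
    (hρ : Measurable ρ) (h0 : ∀ s, 0 ≤ ρ s) (h1 : ∀ s, ρ s ≤ 1) :
    ∫⁻ s, ENNReal.ofReal (∑ α, ‖v s (some α)‖ ^ 2) * ENNReal.ofReal (ρ s) ∂μ
      ≤ liminf (fun n => ∫⁻ s, ENNReal.ofReal (∑ α, ‖u n s (some α)‖ ^ 2)
        * ENNReal.ofReal (ρ s) ∂μ) l := by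
  have hb : ∀ s, |ρ s| ≤ 1 := fun s => abs_le.2 ⟨by linarith [h0 s], h1 s⟩
  have hv := memLp_topJet (Lp.memLp v) hρ hb
  simp only [lintegral_topJet (Lp.memLp _) hρ h0 h1]
  set w : Lp (Jet d m) 2 μ := hv.toLp _
  have hw : ∀ f : Lp (Jet d m) 2 μ, ⟪f, w⟫ = ∫ s, ⟪f s, ρ s • topJet (v s)⟫ ∂μ := fun f => by
    rw [L2.inner_def]
    refine integral_congr_ae ?_
    filter_upwards [hv.coeFn_toLp] with s hs
    rw [hs]
  rw [← hw]
  refine ofReal_le_liminf (g := fun n => 2 * ⟪u n, w⟫ - ⟪v, w⟫) ?_ fun n => ?_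
  · have h2 := ((hu w).const_mul 2).sub_const ⟪v, w⟫
    rwa [two_mul, add_sub_cancel_right] at h2
  · have hn := memLp_topJet (Lp.memLp (u n)) hρ hb
    have i1 : Integrable (fun s => ⟪u n s, ρ s • topJet (v s)⟫) μ :=
      integrable_inner_of_memLp (Lp.memLp (u n)) hv
    have i2 : Integrable (fun s => ⟪v s, ρ s • topJet (v s)⟫) μ := integrable_inner_of_memLp
        (Lp.memLp v) hv
    have i3 : Integrable (fun s => ⟪u n s, ρ s • topJet (u n s)⟫) μ :=
      integrable_inner_of_memLp (Lp.memLp (u n)) hn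
    rw [hw, hw, ← integral_const_mul, ← integral_sub (i1.const_mul 2) i2]
    refine integral_mono ((i1.const_mul 2).sub i2) i3 fun s => ?_
    simp only [real_inner_smul_right, inner_topJet]
    have h3 : 2 * ∑ α, ⟪u n s (some α), v s (some α)⟫ - ∑ α, ⟪v s (some α), v s (some α)⟫
        ≤ ∑ α, ⟪u n s (some α), u n s (some α)⟫ := by
      rw [Finset.mul_sum, ← Finset.sum_sub_distrib]
      refine Finset.sum_le_sum fun α _ => ?_
      have h4 := real_inner_self_nonneg (x := u n s (some α) - v s (some α))
      rw [real_inner_sub_sub_self] at h4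
      linarith
    have h5 := mul_le_mul_of_nonneg_left h3 (h0 s)
    linarith

/-! ### The limit velocity -/

variable {φ₀ : L2 d} {B₀ : L2Vec d} {N : ℕ → ℕ} {X : ∀ n, ℝ → GState d (N n)}

namespace GalerkinLimit

/-- The jets of the velocities, as elements of `L²` in time. -/
def jets (h : GalerkinLimit m φ₀ B₀ N X) (n : ℕ) : Lp (Jet d m) 2 (volume.restrict (Ici (0 : ℝ))) :=
  ((h.galerkin n).memLp_jetU h.weakGrad).1.toLp _

lemma coeFn_jets (h : GalerkinLimit m φ₀ B₀ N X) (n : ℕ) :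
    h.jets n =ᵐ[volume.restrict (Ici (0 : ℝ))] fun s => jetU m (X n s) :=
  ((h.galerkin n).memLp_jetU h.weakGrad).1.coeFn_toLp

lemma norm_jets_le (h : GalerkinLimit m φ₀ B₀ N X) (n : ℕ) : ‖h.jets n‖ ≤ ‖B₀‖ := by
  refine (sq_le_sq₀ (norm_nonneg _) (norm_nonneg _)).1 (le_trans (le_of_eq ?_)
    ((h.galerkin n).memLp_jetU h.weakGrad).2)
  rw [← real_inner_self_eq_norm_sq, L2.inner_def]
  refine integral_congr_ae ?_
  filter_upwards [h.coeFn_jets n] with s hs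
  rw [hs, real_inner_self_eq_norm_sq]

lemma exists_jets_limit (h : GalerkinLimit m φ₀ B₀ N X) :
    ∃ u : Lp (Jet d m) 2 (volume.restrict (Ici (0 : ℝ))),
      ∀ w, Tendsto (fun n => ⟪h.jets n, w⟫) (hyperfilter ℕ) (𝓝 ⟪u, w⟫) :=
  exists_weak_limit_ultrafilter (Eventually.of_forall h.norm_jets_le)

/-- The weak limit of the jets. -/
def jet (h : GalerkinLimit m φ₀ B₀ N X) : Lp (Jet d m) 2 (volume.restrict (Ici (0 : ℝ))) :=
  h.exists_jets_limit.choose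

lemma tendsto_jets (h : GalerkinLimit m φ₀ B₀ N X)
    (w : Lp (Jet d m) 2 (volume.restrict (Ici (0 : ℝ)))) :
    Tendsto (fun n => ⟪h.jets n, w⟫) (hyperfilter ℕ) (𝓝 ⟪h.jet, w⟫) :=
  h.exists_jets_limit.choose_spec w

/-- The operator with kernel `solJet`, applied at each time, is bounded on `L²` in time, hence
weakly continuous; it kills the approximations and so the limit. -/
lemma jet_mem (h : GalerkinLimit m φ₀ B₀ N X) :
    ∀ᵐ s ∂(volume.restrict (Ici (0 : ℝ))), h.jet s ∈ solJet d m := by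
  obtain ⟨P, hP⟩ := exists_clm_ker_eq (isClosed_solJet (d := d) (m := m))
  have h1 : ∀ n, P.compLpL 2 (volume.restrict (Ici (0 : ℝ))) (h.jets n) = 0 := fun n => by
    refine Lp.ext ?_
    filter_upwards [P.coeFn_compLpL (h.jets n), h.coeFn_jets n, Lp.coeFn_zero (Jet d m) 2
        (volume.restrict (Ici (0 : ℝ)))]
      with s h1 h2 h3
    rw [h1, h2, h3, (hP _).2 (jetU_mem _), Pi.zero_apply]
  have h2 : P.compLpL 2 (volume.restrict (Ici (0 : ℝ))) h.jet = 0 := by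
    refine ext_inner_right ℝ fun w => ?_
    refine tendsto_nhds_unique (weak_tendsto_clm h.tendsto_jets
      (P.compLpL 2 (volume.restrict (Ici (0 : ℝ)))) w) ?_
    simp only [h1]
    exact tendsto_const_nhds
  filter_upwards [P.coeFn_compLpL h.jet, Lp.coeFn_zero (Jet d m) 2 (volume.restrict (Ici (0 : ℝ)))]
    with s h3 h4
  rw [← hP, ← h3, h2, h4, Pi.zero_apply]

/-- The limit velocity. -/
def vel (h : GalerkinLimit m φ₀ B₀ N X) (s : ℝ) : L2Vec d := h.jet s none

lemma memL2Sol (h : GalerkinLimit m φ₀ B₀ N X) : MemL2Sol h.vel :=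
  ⟨(Lp.memLp h.jet).eval_piLp none, h.jet_mem.mono fun _ hs => (mem_solJet_iff.1 hs).1⟩

/-! ### The dissipation inequality -/

/-- The three terms on the left are separately lower semicontinuous: `a` by weak convergence in
space-time, `b` by weak convergence at each time and Fatou's lemma, `c` by weak convergence at the
final time. -/
lemma dissipationInequality (h : GalerkinLimit m φ₀ B₀ N X) {T : ℝ} (hT : 0 < T) :
    DissipationInequality m T h.grad h.vel := by
  intro z hz hsol r hr hpos t ht
  let e : ℝ → ℝ≥0∞ := fun s => ENNReal.ofReal (Real.exp (-(s * r)))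
  have hec : Measurable e := by fun_prop
  let a : ℕ → ℝ≥0∞ := fun n => ∫⁻ s in Icc 0 t, ENNReal.ofReal (rate m (X n s)) * e s
  let b : ℕ → ℝ≥0∞ := fun n => ∫⁻ s in Icc 0 t,
    ENNReal.ofReal (tensorPairing (toL2 (bC (X n s))) r (z s)) * e s
  let c : ℕ → ℝ≥0∞ := fun n => ENNReal.ofReal (‖toL2 (bC (X n t))‖ ^ 2) * e t
  set R := ENNReal.ofReal (‖h.grad 0‖ ^ 2)
      + ∫⁻ s in Icc 0 t, 2 * K m (z s) * ENNReal.ofReal (Real.exp (-(s * r)))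
  have hcont : ∀ n, Continuous fun s => rate m (X n s) := fun n =>
    continuous_rate.comp (h.galerkin n).cont
  -- The initial energies are compared with `h.grad 0`, itself a weak gradient of `φ₀`; its equality
  -- with `B₀` is then not needed.
  have h0 : HasWeakGrad φ₀ (h.grad 0) := by
    have := h.hasWeakGrad le_rfl
    rwa [h.phi_zero] at this
  have habc : ∀ n, a n + b n + c n ≤ R := by
    intro n
    refine le_trans (le_of_eq ?_) (((h.galerkin n).dissipation hz hsol hr hpos ht).trans
      (add_le_add_left (ENNReal.ofReal_le_ofReal ((h.galerkin n).norm_bC_zero_le h0)) _))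
    simp only [a, b, c]
    have hm : Measurable fun s => ENNReal.ofReal (rate m (X n s)) * e s :=
      (hcont n).measurable.ennreal_ofReal.mul hec
    rw [← lintegral_add_left hm, energy, ENNReal.ofReal_mul (sq_nonneg _)]
    simp only [add_mul]
    rfl
  have hU : (hyperfilter ℕ : Filter ℕ) ≤ atTop := Nat.hyperfilter_le_atTop
  have hc : ENNReal.ofReal (‖h.grad t‖ ^ 2) * e t ≤ liminf c (hyperfilter ℕ) :=
    (mul_le_mul_left (norm_sq_le_liminf fun w => (h.tendsto_grad ht.1 w).mono_left hU) _).trans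
      (mul_liminf_le _ _)
  have hb : ∫⁻ s in Icc 0 t, ENNReal.ofReal (tensorPairing (h.grad s) r (z s)) * e s
      ≤ liminf b (hyperfilter ℕ) := by
    have h1 : ∀ s ∈ Icc 0 t, ENNReal.ofReal (tensorPairing (h.grad s) r (z s)) * e s
        ≤ liminf (fun n => ENNReal.ofReal (tensorPairing (toL2 (bC (X n s))) r (z s)) * e s) atTop
            := by
      intro s hs
      have hs' : s ∈ Icc 0 T := ⟨hs.1, hs.2.trans ht.2⟩
      exact (mul_le_mul_left (quadratic_le_liminf
        (fun i j => continuous_shiftedSymGrad (hz.smooth hs') r i j) (hpos s hs')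
        (h.tendsto_grad hs.1)) _).trans (mul_liminf_le _ _)
    -- Fatou's lemma is a statement on sequences and is applied along `atTop`; passing to the finer
    -- hyperfilter can only raise the liminf.
    refine (setLIntegral_mono' measurableSet_Icc h1).trans ((lintegral_liminf_le' fun n => ?_).trans
      (liminf_le_liminf_of_le hU))
    refine AEMeasurable.mul (AEMeasurable.ennreal_ofReal ?_) hec.aemeasurable
    exact ((continuousOn_tensorPairing (h.galerkin n).cont hT hz r).mono
      (Icc_subset_Icc_right ht.2)).aemeasurable measurableSet_Icc
  -- The restriction to `[0, t]` is absorbed into a weight with values in `[0, 1]`, since the weak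
  -- convergence of the jets takes place on the half-line.
  have hset : ∀ f : ℝ → ℝ≥0∞, ∫⁻ s in Icc 0 t, f s * e s = ∫⁻ s in Ici 0, f s
      * ENNReal.ofReal ((Icc 0 t).indicator (fun s => Real.exp (-(s * r))) s) := by
    intro f
    have h1 : ∀ s, f s * ENNReal.ofReal ((Icc 0 t).indicator (fun s => Real.exp (-(s * r))) s)
        = (Icc 0 t).indicator (fun s => f s * e s) s := fun s => by
      by_cases hs : s ∈ Icc 0 t <;> simp [hs, e]
    simp_rw [h1]
    rw [lintegral_indicator measurableSet_Icc, Measure.restrict_restrict measurableSet_Icc,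
      inter_eq_left.2 fun s hs => hs.1]
  have ha : ∫⁻ s in Icc 0 t, ENNReal.ofReal (∑ α, ‖h.jet s (some α)‖ ^ 2) * e s
      ≤ liminf a (hyperfilter ℕ) := by
    have h1 : a = fun n => ∫⁻ s in Ici 0, ENNReal.ofReal (∑ α, ‖h.jets n s (some α)‖ ^ 2)
        * ENNReal.ofReal ((Icc 0 t).indicator (fun s => Real.exp (-(s * r))) s) := by
      funext n
      simp only [a]
      rw [hset]
      refine lintegral_congr_ae ?_
      filter_upwards [h.coeFn_jets n] with s hs
      rw [hs, rate_eq_sum_norm]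
    rw [hset, h1]
    refine lintegral_topJet_le_liminf h.tendsto_jets
      ((by fun_prop : Measurable fun s : ℝ => Real.exp (-(s * r))).indicator measurableSet_Icc)
      (fun s => indicator_nonneg (fun s _ => Real.exp_nonneg _) s) fun s => ?_
    refine indicator_apply_le' (fun hs => Real.exp_le_one_iff.2 ?_) fun _ => zero_le_one
    have := mul_nonneg hs.1 hr
    linarith
  have hmeas : AEMeasurable (fun s => ENNReal.ofReal (∑ α, ‖h.jet s (some α)‖ ^ 2) * e s)
      (volume.restrict (Icc 0 t)) := by
    have h1 : AEStronglyMeasurable h.jet (volume.restrict (Icc 0 t)) :=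
      (Lp.aestronglyMeasurable h.jet).mono_measure (Measure.restrict_mono Icc_subset_Ici_self
          le_rfl)
    refine AEMeasurable.mul (AEMeasurable.ennreal_ofReal ?_) hec.aemeasurable
    refine Finset.aemeasurable_fun_sum _ fun α _ => ?_
    exact (((PiLp.continuous_apply 2 _ (some α)).comp_aestronglyMeasurable
        h1).norm.aemeasurable).pow_const 2
  have hK : ∀ᵐ s ∂(volume.restrict (Icc 0 t)), 2 * K m (h.vel s)
      ≤ ENNReal.ofReal (∑ α, ‖h.jet s (some α)‖ ^ 2) := by
    have h1 : volume.restrict (Icc 0 t) ≤ volume.restrict (Ici (0 : ℝ)) :=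
      Measure.restrict_mono Icc_subset_Ici_self le_rfl
    exact (Eventually.filter_mono (ae_mono h1) h.jet_mem).mono fun s hs => two_mul_K_le
        (mem_solJet_iff.1 hs).2
  calc _ ≤ ((∫⁻ s in Icc 0 t, ENNReal.ofReal (∑ α, ‖h.jet s (some α)‖ ^ 2) * e s)
        + ∫⁻ s in Icc 0 t, ENNReal.ofReal (tensorPairing (h.grad s) r (z s)) * e s)
        + ENNReal.ofReal (‖h.grad t‖ ^ 2) * e t := by
        rw [ENNReal.ofReal_mul (sq_nonneg _), ← lintegral_add_left' hmeas]
        refine add_le_add_left (lintegral_mono_ae (hK.mono fun s hs => ?_)) _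
        rw [← add_mul]
        exact mul_le_mul_left (add_le_add_left hs _) _
    _ ≤ liminf a (hyperfilter ℕ) + liminf b (hyperfilter ℕ) + liminf c (hyperfilter ℕ) :=
        add_le_add (add_le_add ha hb) hc
    _ ≤ liminf (fun n => a n + b n + c n) (hyperfilter ℕ) :=
        (add_le_add_left (ultrafilter_liminf_add _ a b) _).trans (ultrafilter_liminf_add _ _ c)
    _ ≤ liminf (fun _ => R) (hyperfilter ℕ : Filter ℕ) :=
        liminf_le_liminf (Eventually.of_forall habc)
    _ = R := liminf_const R

end GalerkinLimit

end Velocity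

/-! ### The transport equation for the approximations, up to a truncation error -/

section Transport

open Filter Topology

variable {d m : ℕ}

lemma memLp_smulC (φ : L2 d) (F : C(Torus d, Vec d)) : MemLp (fun x => φ x • F x) 2 (leb d) :=
  (memLp_of_continuous F.continuous ∞).smul (Lp.memLp φ)

/-- The product of a square-integrable function and a continuous field. -/
def smulC (φ : L2 d) (F : C(Torus d, Vec d)) : L2Vec d := (memLp_smulC φ F).toLp _

lemma coeFn_smulC (φ : L2 d) (F : C(Torus d, Vec d)) :
    smulC φ F =ᵐ[leb d] fun x => φ x • F x := (memLp_smulC φ F).coeFn_toLp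

lemma norm_smulC_le (φ : L2 d) {F : C(Torus d, Vec d)} {C : ℝ} (hC : ∀ x, ‖F x‖ ≤ C) :
    ‖smulC φ F‖ ≤ C * ‖φ‖ := by
  refine Lp.norm_le_mul_norm_of_ae_le_mul ?_
  filter_upwards [coeFn_smulC φ F] with x hx
  rw [hx, norm_smul, mul_comm]
  exact mul_le_mul_of_nonneg_right (hC x) (norm_nonneg _)

lemma smulC_sub (φ ψ : L2 d) (F : C(Torus d, Vec d)) :
    smulC (φ - ψ) F = smulC φ F - smulC ψ F := by
  refine Lp.ext ?_
  filter_upwards [coeFn_smulC φ F, coeFn_smulC ψ F, coeFn_smulC (φ - ψ) F, Lp.coeFn_sub φ ψ,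
    Lp.coeFn_sub (smulC φ F) (smulC ψ F)] with x h1 h2 h3 h4 h5
  rw [h3, h5, Pi.sub_apply, h1, h2, h4, Pi.sub_apply, sub_smul]

lemma inner_smulC (v : L2Vec d) (φ : L2 d) (F : C(Torus d, Vec d)) :
    ⟪v, smulC φ F⟫ = ∫ x, φ x * ⟪v x, F x⟫ ∂(leb d) := by
  rw [L2.inner_def]
  refine integral_congr_ae ?_
  filter_upwards [coeFn_smulC φ F] with x hx
  rw [hx, real_inner_smul_right]

lemma integrable_smulC (v : L2Vec d) (φ : L2 d) (F : C(Torus d, Vec d)) :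
    Integrable (fun x => φ x * ⟪v x, F x⟫) (leb d) := by
  refine (L2.integrable_inner (𝕜 := ℝ) v (smulC φ F)).congr ?_
  filter_upwards [coeFn_smulC φ F] with x hx
  rw [hx, real_inner_smul_right]

lemma smulC_toL2 (f : C(Torus d, ℝ)) (F : C(Torus d, Vec d)) :
    smulC (toL2 f) F = toL2 (f • F) := by
  refine Lp.ext ?_
  filter_upwards [coeFn_smulC (toL2 f) F, coeFn_toL2 f, coeFn_toL2 (f • F)] with x h1 h2 h3
  rw [h1, h2, h3]
  rfl

lemma continuous_toL2_smul {Z : Type*} [TopologicalSpace Z] {f : Z → C(Torus d, ℝ)}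
    {F : Z → C(Torus d, Vec d)} (hf : Continuous f) (hF : Continuous F) :
    Continuous fun z => toL2 (f z • F z) := by
  refine toL2.continuous.comp (ContinuousMap.continuous_of_continuous_uncurry _ ?_)
  change Continuous fun p : Z × Torus d => f p.1 p.2 • F p.1 p.2
  fun_prop

/-! ### Test functions -/

lemma SmoothOn.grad {ψ : ℝ → Torus d → ℝ} (hψ : SmoothOn univ ψ) :
    Continuous fun p : ℝ × Torus d => grad (ψ p.1) p.2 := by
  refine (PiLp.continuous_toLp 2 _).comp (continuous_pi fun i => ?_)
  exact (hψ.pderiv uniqueDiffOn_univ i).continuous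

lemma SmoothOn.iterate_pderiv {ψ : ℝ → Torus d → ℝ} (hψ : SmoothOn univ ψ) (i : Fin d) (n : ℕ) :
    SmoothOn univ fun s => (GradFlow.pderiv i)^[n] (ψ s) := by
  induction n with
  | zero => exact hψ
  | succ n ih =>
    simp only [Function.iterate_succ_apply']
    exact ih.pderiv uniqueDiffOn_univ i

lemma exists_bound_of_smoothOn {ψ : ℝ → Torus d → ℝ} (hψ : SmoothOn univ ψ) (R : ℝ) :
    ∃ C, 0 ≤ C ∧ ∀ i j, ∀ s ∈ Icc 0 R, ∀ x, |(pderiv j)^[d + 1] (pderiv i (ψ s)) x| ≤ C := by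
  have h1 : ∀ i j, ∃ C, ∀ s ∈ Icc 0 R, ∀ x, |(pderiv j)^[d + 1] (pderiv i (ψ s)) x| ≤ C := by
    intro i j
    obtain ⟨C, hC⟩ := ((isCompact_Icc (a := 0) (b := R)).prod
      (isCompact_univ (X := Torus d))).exists_bound_of_continuousOn
      (SmoothOn.continuous (SmoothOn.iterate_pderiv
        (hψ.pderiv uniqueDiffOn_univ i : SmoothOn univ fun s => pderiv i (ψ s)) j (d +
            1))).continuousOn
    exact ⟨C, fun s hs x => hC (s, x) ⟨hs, mem_univ _⟩⟩
  choose C hC using h1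
  refine ⟨∑ i, ∑ j, |C i j|, by positivity, fun i j s hs x => ?_⟩
  refine (hC i j s hs x).trans ((le_abs_self _).trans ?_)
  exact (Finset.single_le_sum (f := fun j => |C i j|) (fun _ _ => abs_nonneg _) (Finset.mem_univ
      j)).trans
    (Finset.single_le_sum (f := fun i => ∑ j, |C i j|)
      (fun _ _ => Finset.sum_nonneg fun _ _ => abs_nonneg _) (Finset.mem_univ i))

lemma grad_trunc_sub {N : ℕ} {g : Torus d → ℝ} (hg : Smooth g) :
    Smooth (fun x => trunc N g x + -(g x)) ∧
      ∀ x, grad (fun x => trunc N g x + -(g x)) x = grad (trunc N g) x - grad g x := by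
  refine ⟨(smooth_trunc N g).add hg.neg, fun x => ?_⟩
  ext i
  rw [grad_apply, pderiv_add (smooth_trunc N g) hg.neg, pderiv_neg hg]
  rfl

lemma norm_grad_trunc_sub_le {N : ℕ} {g : Torus d → ℝ} (hg : Smooth g) {ε : ℝ}
    (h : ∀ i x, |pderiv i g x - trunc N (pderiv i g) x| ≤ ε) (x : Torus d) :
    ‖grad (fun x => trunc N g x + -(g x)) x‖ ≤ d * ε := by
  rw [(grad_trunc_sub hg).2, EuclideanSpace.norm_eq]
  refine (Real.sqrt_le_sqrt (Finset.sum_sq_le_sq_sum_of_nonneg fun i _ => norm_nonneg _)).trans ?_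
  rw [Real.sqrt_sq (Finset.sum_nonneg fun i _ => norm_nonneg _)]
  refine (Finset.sum_le_card_nsmul _ _ ε fun i _ => ?_).trans (by simp)
  have h1 : pderiv i (trunc N g) x = trunc N (pderiv i g) x := by rw [pderiv_trunc_smooth N i hg]
  rw [PiLp.sub_apply, grad_apply, grad_apply, h1, Real.norm_eq_abs, abs_sub_comm]
  exact h i x

/-- The weak form of the transport equation holds up to a small error. -/
lemma IsGalerkin.abs_transport_le {N : ℕ} {φ₀ : L2 d} {X : ℝ → GState d N} (h : IsGalerkin m φ₀ X)
    {B₀ : L2Vec d} (hB : HasWeakGrad φ₀ B₀) {ψ : ℝ → Torus d → ℝ} (hψ : SmoothOn univ ψ) {R : ℝ}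
    (hR : 0 ≤ R) (hzero : ∀ x, ψ R x = 0) {ε : ℝ}
    (hε : ∀ i, ∀ s ∈ Icc 0 R, ∀ x, |pderiv i (ψ s) x - trunc N (pderiv i (ψ s)) x| ≤ ε) :
    |(∫ s in (0 : ℝ)..R, ⟪toL2 (phiC (X s)),
        toL2 (curve (fun s x => deriv (fun u => ψ u x) s) hψ.deriv_time.2.continuous s)⟫)
      + (∫ s in (0 : ℝ)..R, ⟪jetU m (X s) none,
        toL2 (phiC (X s) • curve (fun s => GradFlow.grad (ψ s)) hψ.grad s)⟫)
      + ∫ x, phiC (X 0) x * ψ 0 x ∂(leb d)| ≤ d * ε * ‖φ₀‖ * (R + ‖B₀‖ ^ 2) := by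
  have hc := h.cont
  have hf := phiC.continuous.comp hc
  have i1 : Continuous fun s => ⟪toL2 (phiC (X s)),
      toL2 (curve (fun s x => deriv (fun u => ψ u x) s) hψ.deriv_time.2.continuous s)⟫ :=
    (toL2.continuous.comp hf).inner
      (toL2.continuous.comp (continuous_curve (fun s x => deriv (fun u => ψ u x) s)
          hψ.deriv_time.2.continuous))
  have i2 : Continuous fun s => ⟪jetU m (X s) none,
      toL2 (phiC (X s) • curve (fun s => GradFlow.grad (ψ s)) hψ.grad s)⟫ :=
    ((PiLp.continuous_apply 2 _ none).comp (continuous_jetU.comp hc)).inner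
      (continuous_toL2_smul hf (continuous_curve (fun s => GradFlow.grad (ψ s)) hψ.grad))
  have i3 : Continuous fun s => ∫ x, phiC (X s) x * ⟪vel m (X s) x, GradFlow.grad (trunc N (ψ s)) x⟫
      ∂(leb d) := by
    have h1 : Continuous fun s => intC (phiC (galerkin m (X s)) * curve ψ hψ.continuous s) := by
      have hg := (continuous_galerkin (m := m)).comp hc
      have h1 := continuous_curve ψ hψ.continuous
      simp only [Function.comp_def] at hg
      fun_prop
    refine h1.congr fun s => ?_
    exact integral_phiC_galerkin (X s) (hψ.smooth (mem_univ s))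
  have h1 := h.weak_form hψ hR
  have e1 : ∀ s, ∫ x, phiC (X s) x * deriv (fun s => ψ s x) s ∂(leb d) = ⟪toL2 (phiC (X s)),
      toL2 (curve (fun s x => deriv (fun u => ψ u x) s) hψ.deriv_time.2.continuous s)⟫ := fun s =>
          by
    rw [inner_toL2_toL2]
    refine integral_congr_ae (Eventually.of_forall fun x => ?_)
    exact mul_comm _ _
  simp only [e1, hzero, mul_zero, integral_zero, zero_sub] at h1
  rw [intervalIntegral.integral_add (i1.intervalIntegrable _ _) (i3.intervalIntegrable _ _)] at h1
  have e2 : ∀ s, ⟪jetU m (X s) none,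
      toL2 (phiC (X s) • curve (fun s => GradFlow.grad (ψ s)) hψ.grad s)⟫
      = ∫ x, phiC (X s) x * ⟪vel m (X s) x, GradFlow.grad (ψ s) x⟫ ∂(leb d) := fun s => by
    rw [jetU_none, inner_toL2_toL2]
    refine integral_congr_ae (Eventually.of_forall fun x => ?_)
    exact real_inner_smul_right _ _ _
  have e3 : ∀ s, (∫ x, phiC (X s) x * ⟪vel m (X s) x, GradFlow.grad (trunc N (ψ s)) x⟫ ∂(leb d))
      - ⟪jetU m (X s) none, toL2 (phiC (X s) • curve (fun s => GradFlow.grad (ψ s)) hψ.grad s)⟫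
      = ∫ x, phiC (X s) x * ⟪vel m (X s) x,
        GradFlow.grad (fun x => trunc N (ψ s) x + -(ψ s x)) x⟫ ∂(leb d) := fun s => by
    have hs := hψ.smooth (mem_univ s)
    have hv := (smooth_vel m (X s)).continuous
    have hp := (phiC (X s)).continuous
    have q : ∀ {g : Torus d → ℝ}, Smooth g →
        Integrable (fun x => phiC (X s) x * ⟪vel m (X s) x, GradFlow.grad g x⟫) (leb d) := fun hg =>
      integrable_of_continuous (hp.mul (hv.inner hg.grad.continuous))
    rw [e2, ← integral_sub (q (smooth_trunc N (ψ s))) (q hs)]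
    refine integral_congr_ae (Eventually.of_forall fun x => ?_)
    dsimp only
    rw [(grad_trunc_sub hs).2, inner_sub_right, mul_sub]
  -- The whole error is the replacement of the truncated test function by the test function itself.
  have e4 : |∫ s in (0 : ℝ)..R, ((∫ x, phiC (X s) x * ⟪vel m (X s) x,
        GradFlow.grad (trunc N (ψ s)) x⟫ ∂(leb d))
      - ⟪jetU m (X s) none, toL2 (phiC (X s) • curve (fun s => GradFlow.grad (ψ s)) hψ.grad s)⟫)|
      ≤ d * ε * ‖φ₀‖ * (R + ‖B₀‖ ^ 2) := by
    have hε0 : 0 ≤ d * ε * ‖φ₀‖ := by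
      have h3 := norm_grad_trunc_sub_le (hψ.smooth (mem_univ 0)) (fun i x => hε i 0 ⟨le_rfl, hR⟩ x)
          0
      exact mul_nonneg ((norm_nonneg _).trans h3) (norm_nonneg _)
    have hr : IntervalIntegrable (fun s => 2 * rate m (X s)) volume 0 R :=
      (continuous_const.mul (continuous_rate.comp hc)).intervalIntegrable _ _
    have h3 : ∫ s in (0 : ℝ)..R, d * ε * ‖φ₀‖ * (1 + 2 * rate m (X s))
        ≤ d * ε * ‖φ₀‖ * (R + ‖B₀‖ ^ 2) := by
      rw [intervalIntegral.integral_const_mul, intervalIntegral.integral_add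
        intervalIntegrable_const hr, h.integral_rate hR, intervalIntegral.integral_const]
      refine mul_le_mul_of_nonneg_left ?_ hε0
      have h4 := h.energy_le hB le_rfl
      have h5 : 0 ≤ energy (X R) := sq_nonneg _
      simp only [sub_zero, smul_eq_mul, mul_one]
      linarith
    rw [← Real.norm_eq_abs]
    refine (intervalIntegral.norm_integral_le_of_norm_le hR (Eventually.of_forall fun s hs => ?_)
      ((intervalIntegrable_const.add hr).const_mul _)).trans h3
    have hs' : s ∈ Icc 0 R := ⟨hs.1.le, hs.2⟩
    rw [e3, Real.norm_eq_abs]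
    refine (abs_integral_transport_le (X s) (grad_trunc_sub (hψ.smooth (mem_univ s))).1
      (norm_grad_trunc_sub_le (hψ.smooth (mem_univ s)) fun i x => hε i s hs' x)).trans ?_
    have h4 : 0 ≤ d * ε := (norm_nonneg _).trans
      (norm_grad_trunc_sub_le (hψ.smooth (mem_univ s)) (fun i x => hε i s hs' x) 0)
    rw [mul_assoc (d * ε)]
    refine mul_le_mul_of_nonneg_left ?_ h4
    refine mul_le_mul (h.norm_phiC_le hs'.1) ?_ (norm_nonneg _) (norm_nonneg _)
    have h5 := norm_jetU_none_sq_le (m := m) (X s)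
    have h6 := rate_nonneg (m := m) (X s)
    -- From `2a ≤ 1 + a²`, the velocity norm is at most `1 + 2 * rate`, whose time integral the
    -- energy balance controls.
    nlinarith [sq_nonneg (‖jetU m (X s) none‖ - 1)]
  rw [intervalIntegral.integral_sub (i3.intervalIntegrable _ _) (i2.intervalIntegrable _ _),
    ← abs_neg] at e4
  refine le_trans (le_of_eq ?_) e4
  congr 1
  linarith

end Transport

/-! ### Passage to the limit in the transport equation -/

section Conclusion

open Filter Topology

variable {d m : ℕ}

lemma intervalIntegral_eq_setIntegral_Ici {E : Type*} [NormedAddCommGroup E] [NormedSpace ℝ E]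
    {f : ℝ → E} {R : ℝ} (hR : 0 ≤ R) (hf : ∀ s, R ≤ s → f s = 0) :
    ∫ s in (0 : ℝ)..R, f s = ∫ s in Ici 0, f s := by
  rw [intervalIntegral.integral_of_le hR, integral_Ici_eq_integral_Ioi]
  refine (setIntegral_eq_of_subset_of_forall_sdiff_eq_zero measurableSet_Ioi Ioc_subset_Ioi_self
    fun s hs => hf s ?_).symm
  by_contra! h
  exact hs.2 ⟨hs.1, h.le⟩

lemma norm_sub_sq_toLp {Ω E : Type*} [MeasurableSpace Ω] {μ : Measure Ω} [NormedAddCommGroup E]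
    [InnerProductSpace ℝ E] {f g : Ω → E} (hf : MemLp f 2 μ) (hg : MemLp g 2 μ) :
    ‖hf.toLp f - hg.toLp g‖ ^ 2 = ∫ s, ‖f s - g s‖ ^ 2 ∂μ := by
  rw [← MemLp.toLp_sub, ← real_inner_self_eq_norm_sq, L2.inner_def]
  refine integral_congr_ae ?_
  filter_upwards [(hf.sub hg).coeFn_toLp] with s hs
  rw [hs, real_inner_self_eq_norm_sq, Pi.sub_apply]

/-- Dominated convergence in `L²`. -/
lemma tendsto_toLp_of_dominated {Ω E : Type*} [MeasurableSpace Ω] {μ : Measure Ω}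
    [NormedAddCommGroup E] [InnerProductSpace ℝ E] {f : ℕ → Ω → E} {g : Ω → E}
    (hf : ∀ n, MemLp (f n) 2 μ) (hg : MemLp g 2 μ) {b : Ω → ℝ} (hb : MemLp b 2 μ)
    (hfb : ∀ n, ∀ᵐ s ∂μ, ‖f n s‖ ≤ b s) (hgb : ∀ᵐ s ∂μ, ‖g s‖ ≤ b s)
    (hlim : ∀ᵐ s ∂μ, Tendsto (fun n => f n s) atTop (𝓝 (g s))) :
    Tendsto (fun n => (hf n).toLp (f n)) atTop (𝓝 (hg.toLp g)) := by
  rw [tendsto_iff_norm_sub_tendsto_zero]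
  have h1 : Tendsto (fun n => ∫ s, ‖f n s - g s‖ ^ 2 ∂μ) atTop (𝓝 (∫ _, (0 : ℝ) ∂μ)) := by
    refine tendsto_integral_of_dominated_convergence (fun s => (2 * b s) ^ 2)
      (fun n => ((hf n).1.sub hg.1).norm.pow 2) ?_ (fun n => ?_) ?_
    · exact (hb.const_mul 2).integrable_sq
    · filter_upwards [hfb n, hgb] with s h1 h2
      rw [Real.norm_of_nonneg (by positivity)]
      refine pow_le_pow_left₀ (norm_nonneg _) ((norm_sub_le _ _).trans ?_) 2
      linarith
    · filter_upwards [hlim] with s hs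
      simpa using ((tendsto_iff_norm_sub_tendsto_zero.1 hs).pow 2)
  rw [integral_zero] at h1
  have h2 := h1.sqrt
  rw [Real.sqrt_zero] at h2
  refine h2.congr fun n => ?_
  rw [← norm_sub_sq_toLp (hf n) hg, Real.sqrt_sq (norm_nonneg _)]

variable {φ₀ : L2 d} {B₀ : L2Vec d} {N : ℕ → ℕ} {X : ∀ n, ℝ → GState d (N n)}

namespace GalerkinLimit

/-- Convergence of the transport term. -/
lemma tendsto_integral_transport (h : GalerkinLimit m φ₀ B₀ N X) {F : ℝ → C(Torus d, Vec d)}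
    (hF : Continuous F) {R : ℝ} (hR : ∀ s, R ≤ s → F s = 0) :
    Integrable (fun s => ⟪h.vel s, smulC (h.phi s) (F s)⟫) (volume.restrict (Ici (0 : ℝ))) ∧
    Tendsto (fun n => ∫ s in Ici (0 : ℝ), ⟪jetU m (X n s) none, toL2 (phiC (X n s) • F s)⟫)
      (hyperfilter ℕ) (𝓝 (∫ s in Ici (0 : ℝ), ⟪h.vel s, smulC (h.phi s) (F s)⟫)) := by
  set μ := volume.restrict (Ici (0 : ℝ))
  obtain ⟨D, hD⟩ := (isCompact_Icc (a := 0) (b := R)).exists_bound_of_continuousOn hF.continuousOn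
  -- The dominating function is square integrable because `F` vanishes after `R` and the states are
  -- bounded in `L²` uniformly in time.
  let b : ℝ → ℝ := (Icc 0 R).indicator fun _ => D * ‖φ₀‖
  have hb : MemLp b 2 μ := memLp_indicator_const 2 measurableSet_Icc _
    (Or.inr ((Measure.restrict_apply_le _ _).trans_lt measure_Icc_lt_top).ne)
  have hle : ∀ s, 0 ≤ s → ∀ φ : L2 d, ‖φ‖ ≤ ‖φ₀‖ → ‖smulC φ (F s)‖ ≤ b s := by
    intro s hs φ hφ
    have h1 := norm_smulC_le φ (F := F s) fun x => (F s).norm_coe_le_norm x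
    by_cases hsR : s ≤ R
    · simp only [b, indicator_of_mem (show s ∈ Icc 0 R from ⟨hs, hsR⟩)]
      exact h1.trans (mul_le_mul (hD s ⟨hs, hsR⟩) hφ (norm_nonneg _)
        ((norm_nonneg _).trans (hD s ⟨hs, hsR⟩)))
    · rw [hR s (le_of_not_ge hsR), norm_zero, zero_mul] at h1
      rw [hR s (le_of_not_ge hsR)]
      refine h1.trans (indicator_nonneg (fun u hu => ?_) s)
      exact mul_nonneg ((norm_nonneg _).trans (hD u hu)) (norm_nonneg _)
  have hfm : ∀ n, AEStronglyMeasurable (fun s => toL2 (phiC (X n s) • F s)) μ := fun n =>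
    (continuous_toL2_smul (phiC.continuous.comp (h.galerkin n).cont) hF).aestronglyMeasurable
  have hfb : ∀ n, ∀ᵐ s ∂μ, ‖toL2 (phiC (X n s) • F s)‖ ≤ b s := fun n => by
    filter_upwards [ae_restrict_mem measurableSet_Ici] with s hs
    rw [← smulC_toL2]
    exact hle s hs _ ((h.galerkin n).norm_phiC_le hs)
  have hgb : ∀ᵐ s ∂μ, ‖smulC (h.phi s) (F s)‖ ≤ b s := by
    filter_upwards [ae_restrict_mem measurableSet_Ici] with s hs
    exact hle s hs _ (h.norm_phi_le hs)
  have hlim : ∀ᵐ s ∂μ, Tendsto (fun n => toL2 (phiC (X n s) • F s)) atTop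
      (𝓝 (smulC (h.phi s) (F s))) := by
    filter_upwards [ae_restrict_mem measurableSet_Ici] with s hs
    rw [tendsto_iff_norm_sub_tendsto_zero]
    have h1 := (tendsto_iff_norm_sub_tendsto_zero.1 (h.tendsto_phi hs)).const_mul ‖F s‖
    rw [mul_zero] at h1
    refine squeeze_zero (fun _ => norm_nonneg _) (fun n => ?_) h1
    rw [← smulC_toL2, ← smulC_sub]
    exact norm_smulC_le _ fun x => (F s).norm_coe_le_norm x
  have hf : ∀ n, MemLp (fun s => toL2 (phiC (X n s) • F s)) 2 μ := fun n =>
    hb.mono' (hfm n) (hfb n)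
  have hg : MemLp (fun s => smulC (h.phi s) (F s)) 2 μ :=
    hb.mono' (aestronglyMeasurable_of_tendsto_ae atTop hfm hlim) hgb
  have hstrong := (tendsto_toLp_of_dominated hf hg hb hfb hgb hlim).mono_left
    Nat.hyperfilter_le_atTop
  let P : Jet d m →L[ℝ] L2Vec d := PiLp.proj 2 _ none
  have hv : ∀ u : Lp (Jet d m) 2 μ, ∀ {f : ℝ → L2Vec d} (hf : MemLp f 2 μ),
      ⟪P.compLpL 2 μ u, hf.toLp f⟫ = ∫ s, ⟪u s none, f s⟫ ∂μ := by
    intro u f hf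
    rw [L2.inner_def]
    refine integral_congr_ae ?_
    filter_upwards [P.coeFn_compLpL u, hf.coeFn_toLp] with s h1 h2
    rw [h1, h2]
    rfl
  -- The velocities converge weakly and the products of states with `F` strongly, both in `L²` of
  -- space-time.
  have key := weak_strong_tendsto (C := ‖P.compLpL 2 μ‖ * ‖B₀‖) (Eventually.of_forall fun n =>
    ((P.compLpL 2 μ).le_opNorm (h.jets n)).trans
      (mul_le_mul_of_nonneg_left (h.norm_jets_le n) (norm_nonneg _)))
    (weak_tendsto_clm h.tendsto_jets (P.compLpL 2 μ)) hstrong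
  refine ⟨integrable_inner_of_memLp h.memL2Sol.1 hg, ?_⟩
  rw [hv] at key
  refine key.congr fun n => ?_
  rw [hv]
  refine integral_congr_ae ?_
  filter_upwards [h.coeFn_jets n] with s hs
  rw [hs]

/-- Convergence of the term with the time derivative. -/
lemma tendsto_integral_time (h : GalerkinLimit m φ₀ B₀ N X) {F : ℝ → C(Torus d, ℝ)}
    (hF : Continuous F) {R : ℝ} (hR : ∀ s, R ≤ s → F s = 0) :
    Integrable (fun s => ⟪h.phi s, toL2 (F s)⟫) (volume.restrict (Ici (0 : ℝ))) ∧
    Tendsto (fun n => ∫ s in Ici (0 : ℝ), ⟪toL2 (phiC (X n s)), toL2 (F s)⟫) atTop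
      (𝓝 (∫ s in Ici (0 : ℝ), ⟪h.phi s, toL2 (F s)⟫)) := by
  set μ := volume.restrict (Ici (0 : ℝ))
  have hF2 : Continuous fun s => toL2 (F s) := toL2.continuous.comp hF
  obtain ⟨D, hD⟩ := (isCompact_Icc (a := 0) (b := R)).exists_bound_of_continuousOn hF2.continuousOn
  let b : ℝ → ℝ := (Icc 0 R).indicator fun _ => ‖φ₀‖ * D
  have hb : Integrable b μ := (integrable_indicator_iff measurableSet_Icc).2
    (integrableOn_const ((Measure.restrict_apply_le _ _).trans_lt measure_Icc_lt_top).ne)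
  have hle : ∀ s, 0 ≤ s → ∀ φ : L2 d, ‖φ‖ ≤ ‖φ₀‖ → ‖⟪φ, toL2 (F s)⟫‖ ≤ b s := by
    intro s hs φ hφ
    by_cases hsR : s ≤ R
    · simp only [b, indicator_of_mem (show s ∈ Icc 0 R from ⟨hs, hsR⟩)]
      exact (norm_inner_le_norm _ _).trans (mul_le_mul hφ (hD s ⟨hs, hsR⟩) (norm_nonneg _)
        (norm_nonneg _))
    · rw [hR s (le_of_not_ge hsR), map_zero, inner_zero_right, norm_zero]
      refine indicator_nonneg (fun u hu => ?_) s
      exact mul_nonneg (norm_nonneg _) ((norm_nonneg _).trans (hD u hu))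
  have hfm : ∀ n, AEStronglyMeasurable (fun s => ⟪toL2 (phiC (X n s)), toL2 (F s)⟫) μ := fun n =>
    ((toL2.continuous.comp (phiC.continuous.comp (h.galerkin n).cont)).inner
        hF2).aestronglyMeasurable
  have hlim : ∀ᵐ s ∂μ, Tendsto (fun n => ⟪toL2 (phiC (X n s)), toL2 (F s)⟫) atTop
      (𝓝 ⟪h.phi s, toL2 (F s)⟫) := by
    filter_upwards [ae_restrict_mem measurableSet_Ici] with s hs
    exact (h.tendsto_phi hs).inner tendsto_const_nhds
  refine ⟨hb.mono' (aestronglyMeasurable_of_tendsto_ae atTop hfm hlim) ?_,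
    tendsto_integral_of_dominated_convergence b hfm hb (fun n => ?_) hlim⟩
  · filter_upwards [ae_restrict_mem measurableSet_Ici] with s hs
    exact hle s hs _ (h.norm_phi_le hs)
  · filter_upwards [ae_restrict_mem measurableSet_Ici] with s hs
    exact hle s hs _ ((h.galerkin n).norm_phiC_le hs)

lemma solvesTransport (h : GalerkinLimit m φ₀ B₀ N X) : SolvesTransport φ₀ h.phi h.vel := by
  rintro ψ hψ ⟨R₀, hR₀⟩
  -- Strictly beyond `R₀`, so that `ψ` vanishes in a neighbourhood of every time `s ≥ R` and its
  -- time derivative vanishes there as well.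
  set R := max R₀ 0 + 1
  have hR : 0 ≤ R := by positivity
  let F : ℝ → C(Torus d, ℝ) :=
    curve (fun s x => deriv (fun u => ψ u x) s) hψ.deriv_time.2.continuous
  let G : ℝ → C(Torus d, Vec d) := curve (fun s => GradFlow.grad (ψ s)) hψ.grad
  have hFR : ∀ s, R ≤ s → F s = 0 := fun s hs => by
    ext x
    have h1 : (fun u => ψ u x) =ᶠ[𝓝 s] fun _ => 0 := by
      filter_upwards [Ioi_mem_nhds (show R₀ < s by linarith [le_max_left R₀ 0])] with u hu
      exact hR₀ u (le_of_lt hu) x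
    exact h1.deriv_eq.trans (deriv_const s 0)
  have hGR : ∀ s, R ≤ s → G s = 0 := fun s hs => by
    ext x i
    have h1 : ψ s = fun _ => 0 := funext fun x => hR₀ s (by linarith [le_max_left R₀ 0]) x
    change pderiv i (ψ s) x = 0
    rw [h1, pderiv_const]
  obtain ⟨iF, hF⟩ := h.tendsto_integral_time (continuous_curve _ _ : Continuous F) hFR
  obtain ⟨iG, hG⟩ := h.tendsto_integral_transport (continuous_curve _ _ : Continuous G) hGR
  have h0 : Tendsto (fun n => ∫ x, phiC (X n 0) x * ψ 0 x ∂(leb d)) atTop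
      (𝓝 (∫ x, φ₀ x * ψ 0 x ∂(leb d))) := by
    have h1 := (h.tendsto_phi le_rfl).inner (𝕜 := ℝ)
      (tendsto_const_nhds (x := toL2 (hψ.smooth (mem_univ 0)).toC))
    rw [h.phi_zero, inner_toL2_real] at h1
    refine h1.congr fun n => ?_
    rw [inner_toL2_toL2]
    exact integral_congr_ae (Eventually.of_forall fun x => mul_comm _ _)
  obtain ⟨C, hC0, hC⟩ := exists_bound_of_smoothOn hψ R
  obtain ⟨ε, hε, -, hε2⟩ := exists_trunc_rate d
  have hbound : ∀ n, |(∫ s in Ici (0 : ℝ), ⟪toL2 (phiC (X n s)), toL2 (F s)⟫)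
      + (∫ s in Ici (0 : ℝ), ⟪jetU m (X n s) none, toL2 (phiC (X n s) • G s)⟫)
      + ∫ x, phiC (X n 0) x * ψ 0 x ∂(leb d)|
      ≤ d * (C * ε (N n)) * ‖φ₀‖ * (R + ‖B₀‖ ^ 2) := fun n => by
    rw [← intervalIntegral_eq_setIntegral_Ici hR fun s hs => by
        rw [hFR s hs, map_zero, inner_zero_right],
      ← intervalIntegral_eq_setIntegral_Ici hR fun s hs => by
        rw [hGR s hs, show phiC (X n s) • (0 : C(Torus d, Vec d)) = 0 from
          ContinuousMap.ext fun x => smul_zero _, map_zero, inner_zero_right]]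
    exact (h.galerkin n).abs_transport_le h.weakGrad hψ hR
      (hR₀ R (by linarith [le_max_left R₀ 0])) fun i s hs x =>
        hε2 _ ((hψ.smooth (mem_univ s)).pderiv i) C (fun j x => hC i j s hs x) (N n) x
  have hlim : Tendsto (fun n => d * (C * ε (N n)) * ‖φ₀‖ * (R + ‖B₀‖ ^ 2)) atTop (𝓝 0) := by
    have h1 := ((((hε.comp h.tendsto).const_mul C).const_mul (d : ℝ)).mul_const ‖φ₀‖).mul_const
      (R + ‖B₀‖ ^ 2)
    simpa using h1
  have hU : (hyperfilter ℕ : Filter ℕ) ≤ atTop := Nat.hyperfilter_le_atTop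
  -- The velocity term converges only along the hyperfilter, so the other limits are restricted to
  -- it.
  have hzero := tendsto_nhds_unique (((hF.mono_left hU).add hG).add (h0.mono_left hU))
    ((squeeze_zero_norm hbound hlim).mono_left hU)
  rw [← integral_add iF iG] at hzero
  refine Eq.trans ?_ hzero
  congr 1
  refine integral_congr_ae (Eventually.of_forall fun s => ?_)
  dsimp only
  rw [inner_smulC, inner_toL2_real, ← integral_add
    (integrable_mul_continuous (integrable_L2 (h.phi s)) (F s).continuous)
    (integrable_smulC (h.vel s) (h.phi s) (G s))]
  refine integral_congr_ae (Eventually.of_forall fun x => ?_)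
  exact mul_add _ _ _

end GalerkinLimit

end Conclusion

end GradFlow

end

theorem mainTheorem2 (d m : ℕ) (φ₀ : GradFlow.L2 d) (hφ₀ : GradFlow.dirichlet φ₀ < ⊤) :
    ∃ (φ : ℝ → GradFlow.L2 d) (B v : ℝ → GradFlow.L2Vec d),
      GradFlow.MemCw B ∧ GradFlow.MemL2Sol v ∧
      GradFlow.IsGlobalDissipativeSolution m φ₀ φ B v := by
  -- Without a weak gradient the infimum defining the Dirichlet integral is empty, hence infinite.
  obtain ⟨B₀, hB₀⟩ : ∃ B₀, GradFlow.HasWeakGrad φ₀ B₀ := by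
    by_contra! h
    simp [GradFlow.dirichlet, h] at hφ₀
  obtain ⟨N, X, h⟩ := GradFlow.exists_galerkinLimit m hB₀
  exact ⟨h.phi, h.grad, h.vel, h.memCw, h.memL2Sol, h.phi_zero, fun _ ht => h.integral_phi ht,
    fun _ ht => h.hasWeakGrad ht, h.solvesTransport, fun _ hT => h.dissipationInequality hT⟩
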